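/- Let $n\ge 2$ and let $\Gamma$ be the star graph with $n$ edges $e_j=[0,\infty)$ joined at the vertex $0$. Let $V$ be a real potential on $\Gamma$ with $V_j=V|_{e_j}\in L^1(0,\infty)$ for $1\le j\le n$. Let $H=-\frac{d^2}{dx^2}+V$ be the self-adjoint Schrödinger operator in $L^2(\Gamma)=\bigoplus_{j=1}^n L^2(e_j)$ with continuity and Kirchhoff conditions $\psi_1(0)=\dots=\psi_n(0)$, $\sum_j\psi_j'(0)=0$, defined by the quadratic form $h[\phi]=\int_\Gamma|\phi'|^2\,dx+\int_\Gamma V|\phi|^2\,dx$ with form domain $H^1(\Gamma)$, the space of all continuous $\phi$ on $\Gamma$ with $\phi_j\in H^1(e_j)$ for every $j$. Let $H_0$ be the same operator with $V\equiv 0$, and write $R(z)=(H-z)^{-1}$, $R_0(z)=(H_0-z)^{-1}$. For $\operatorname{Im}\zeta>0$ let $\theta_j(\cdot,\zeta)$ be the Jost solution on $e_j$, that is, the unique solution of $-\theta''+V_j\theta=\zeta^2\theta$ on $[0,\infty)$ with $\theta_j(x,\zeta)=e^{ix\zeta}(1+o(1))$ as $x\to\infty$. Put $$w_j(\zeta)=\theta_j(0,\zeta),\qquad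 K(\zeta)=\sum_{j=1}^n\frac{\theta_j'(0,\zeta)}{\theta_j(0,\zeta)} .$$ Theorem. The Jost solutions exist for all $\operatorname{Im}\zeta>0$, and the resolvent set $\rho(H)$ contains $\mathbb C\setminus\mathbb R$. For every $\zeta$ with $\operatorname{Im}\zeta>0$ and $\zeta^2\in\rho(H)$, also $\zeta^2\in\rho(H_0)$, the operator $R(\zeta^2)-R_0(\zeta^2)$ is trace class, and $$\operatorname{tr}\bigl(R_0(\zeta^2)-R(\zeta^2)\bigr)=\frac1{2\zeta}\,\frac{d}{d\zeta}\ln\Bigl(\frac{K(\zeta)}{\zeta}\prod_{j=1}^n w_j(\zeta)\Bigr).$$ Here $\frac{d}{d\zeta}\ln F=F'/F$. If $w_j(\zeta)\ne0$ for all $j$, the function $F(\zeta)=\frac{K(\zeta)}{\zeta}\prod_j w_j(\zeta)$ is complex differentiable and nonzero at $\zeta$, and the formula holds as written; and in all cases (in particular if some $w_j(\zeta)=0$, so that $K(\zeta)$ is undefined) the trace is the limit of $\frac{1}{2\eta}F'(\eta)/F(\eta)$ as $\eta\to\zeta$, $\eta\ne\zeta$. -/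

import Mathlib

open MeasureTheory Set Filter Topology
open scoped ComplexConjugate

noncomputable section

/-- The Hilbert space `L²(Γ) = ⊕ⱼ L²(0, ∞)` of the star graph `Γ` with `n` half-line edges
(the Hilbert space direct sum, complex-valued functions). -/
abbrev StarL2 (n : ℕ) : Type :=
  PiLp 2 (fun _ : Fin n => Lp ℂ 2 (volume.restrict (Ioi (0 : ℝ))))

/-- `φ`, on `[0, ∞)`, is (the continuous representative of) an element of `H¹(0, ∞)`: it is
locally absolutely continuous on `[0, ∞)`, and it and its derivative are square integrable. -/
structure IsHalfLineH1 (φ : ℝ → ℂ) : Prop where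
  memLp : MemLp φ 2 (volume.restrict (Ioi (0 : ℝ)))
  memLp_deriv : MemLp (deriv φ) 2 (volume.restrict (Ioi (0 : ℝ)))
  eq_integral : ∀ x : ℝ, 0 ≤ x → φ x = φ 0 + ∫ t in (0 : ℝ)..x, deriv φ t

/-- The form domain `H¹(Γ)`: each component is in `H¹` of its edge, and the function is
continuous at the vertex. -/
structure IsStarH1 {n : ℕ} (φ : Fin n → ℝ → ℂ) : Prop where
  edge : ∀ j, IsHalfLineH1 (φ j)
  vertex : ∀ j k, φ j 0 = φ k 0

/-- The sesquilinear form `h[ψ, φ] = ∫_Γ ψ' conj φ' + ∫_Γ V ψ conj φ`, whose diagonal is the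
quadratic form `h[φ] = ∫_Γ |φ'|² + ∫_Γ V |φ|²`. -/
def starForm {n : ℕ} (V : Fin n → ℝ → ℝ) (ψ φ : Fin n → ℝ → ℂ) : ℂ :=
  ∑ j, ((∫ x in Ioi (0 : ℝ), deriv (ψ j) x * conj (deriv (φ j) x)) +
    ∫ x in Ioi (0 : ℝ), (V j x : ℂ) * ψ j x * conj (φ j x))

/-- The Schrödinger operator `H = -d²/dx² + V` on the star graph with continuity and Kirchhoff
vertex condition, given by its graph `{(u, H u) | u ∈ dom H}`. It is the operator associated with
the form `h` on `H¹(Γ)`: `u ∈ dom H` and `H u = f` iff `u ∈ H¹(Γ)` and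
`h[u, φ] = ⟨f, φ⟩` (the product of `L²(Γ)`, linear in `f`) for all `φ ∈ H¹(Γ)`. -/
def starSchrodinger {n : ℕ} (V : Fin n → ℝ → ℝ) : Set (StarL2 n × StarL2 n) :=
  {p | ∃ ψ : Fin n → ℝ → ℂ, IsStarH1 ψ ∧
    (∀ j, p.1 j =ᵐ[volume.restrict (Ioi (0 : ℝ))] ψ j) ∧
    ∀ φ : Fin n → ℝ → ℂ, IsStarH1 φ →
      starForm V ψ φ = ∑ j, ∫ x in Ioi (0 : ℝ), p.2 j x * conj (φ j x)}

section HilbertSpace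

variable {E : Type*} [NormedAddCommGroup E] [InnerProductSpace ℂ E]

/-- For an unbounded operator `A` given by its graph, the bounded operator `R` is
`(A - z)⁻¹`, that is, `R f = u` iff `u ∈ dom A` and `A u - z u = f`. -/
def IsResolventAt (A : Set (E × E)) (z : ℂ) (R : E →L[ℂ] E) : Prop :=
  ∀ f u : E, R f = u ↔ (u, f + z • u) ∈ A

/-- The resolvent set `ρ(A)` of an unbounded operator given by its graph. -/
def opResolventSet (A : Set (E × E)) : Set ℂ :=
  {z | ∃ R : E →L[ℂ] E, IsResolventAt A z R}

open Classical in
/-- The resolvent `(A - z)⁻¹` for `z ∈ ρ(A)` (and `0` by convention for `z ∉ ρ(A)`). -/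
def opResolvent (A : Set (E × E)) (z : ℂ) : E →L[ℂ] E :=
  if h : ∃ R : E →L[ℂ] E, IsResolventAt A z R then h.choose else 0

/-- `T` is trace class (nuclear): `T = ∑ᵢ ⟨xᵢ, ·⟩ yᵢ` with `∑ᵢ ‖xᵢ‖ ‖yᵢ‖ < ∞`. -/
def IsTraceClass (T : E →L[ℂ] E) : Prop :=
  ∃ x y : ℕ → E, Summable (fun i => ‖x i‖ * ‖y i‖) ∧
    ∀ f : E, HasSum (fun i => inner ℂ (x i) f • y i) (T f)

end HilbertSpace

/-- `T` has trace `τ`: in every orthonormal basis `(eᵢ)` of the Hilbert space, the sum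
`∑ᵢ ⟨eᵢ, T eᵢ⟩` converges (unconditionally) to `τ`. -/
def HasTrace {E : Type} [NormedAddCommGroup E] [InnerProductSpace ℂ E] [CompleteSpace E]
    (T : E →L[ℂ] E) (τ : ℂ) : Prop :=
  ∀ (ι : Type) (e : HilbertBasis ι ℂ E), HasSum (fun i => inner ℂ (e i) (T (e i))) τ

/-- `θ`, on `[0, ∞)`, is the Jost solution at `ζ` for the potential `v`: it is differentiable, its
derivative (one-sided at `0`) is locally absolutely continuous with `-θ'' + v θ = ζ² θ` almost
everywhere, and `θ(x) = exp(i x ζ) (1 + o(1))` as `x → ∞`. -/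
structure IsJostSolution (v : ℝ → ℝ) (ζ : ℂ) (θ : ℝ → ℂ) : Prop where
  differentiableOn : DifferentiableOn ℝ θ (Ici 0)
  eqn : ∀ x : ℝ, 0 ≤ x → derivWithin θ (Ici 0) x =
    derivWithin θ (Ici 0) 0 + ∫ t in (0 : ℝ)..x, ((v t : ℂ) - ζ ^ 2) * θ t
  asymptotics : Tendsto (fun x : ℝ => θ x / Complex.exp (Complex.I * x * ζ)) atTop (𝓝 1)

open Classical in
/-- The Jost solution `θ(·, ζ)` for the potential `v`; for integrable `v` and `Im ζ > 0` it exists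
and is unique on `[0, ∞)`. (If it does not exist, `0` by convention.) -/
def jostSolution (v : ℝ → ℝ) (ζ : ℂ) : ℝ → ℂ :=
  if h : ∃ θ : ℝ → ℂ, IsJostSolution v ζ θ then h.choose else 0

/-- The Jost function `w(ζ) = θ(0, ζ)`. -/
def jostFunction (v : ℝ → ℝ) (ζ : ℂ) : ℂ := jostSolution v ζ 0

/-- `K(ζ) = ∑ⱼ θⱼ'(0, ζ) / θⱼ(0, ζ)`. -/
def starK {n : ℕ} (V : Fin n → ℝ → ℝ) (ζ : ℂ) : ℂ :=
  ∑ j, derivWithin (jostSolution (V j) ζ) (Ici 0) 0 / jostSolution (V j) ζ 0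

/-- The function `K(ζ) / ζ * ∏ⱼ wⱼ(ζ)`. -/
def starJost {n : ℕ} (V : Fin n → ℝ → ℝ) (ζ : ℂ) : ℂ :=
  starK V ζ / ζ * ∏ j, jostFunction (V j) ζ

end

/-!
Write `θⱼ` for the Jost solutions, `wⱼ = θⱼ(0)`, and `G(ζ) = ∑ⱼ θⱼ'(0) ∏_{l ≠ j} wₗ` for the
*characteristic function* (`starChar`). Where no `wⱼ` vanishes, `G = K ∏ⱼ wⱼ`; `G` itself is
holomorphic on the whole upper half-plane, so the formula to be proved is
`tr (R₀ - R) = (G'/G - 1/ζ) / (2ζ)`, and the points where some `wⱼ` vanishes need no separate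
treatment.

**Jost solutions.** `θ = exp(iζx) m`, where `m` solves a Volterra equation whose iteration converges
uniformly because `V` is integrable. Iteration also gives holomorphy in `ζ`, and the decay of `m - 1`
and of the derivative of `m` in `ζ` as `x → ∞`.

**Resolvent.** If `G(ζ) = 0` then a combination of Jost solutions is an eigenfunction
(`exists_eigenvector`), so `G ≠ 0` on the resolvent set, and `G ≠ 0` for nonreal `ζ²` because the
operator is symmetric. If `G(ζ) ≠ 0`, let `χⱼ` be the solution on the edge `j` that satisfies the
vertex conditions imposed by the Jost solutions on the other edges (`IsVertexFamily`). Its Wronskian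
with `θⱼ` is `G`, and Green's function is `-χⱼ(x) θⱼ(y) / G` for `x ≤ y` on one edge, and
`-(∏_{l ≠ j, k} wₗ) θₖ(y) θⱼ(x) / G` on two different edges (`green_solution`). Solvability of
`(H - z) u = f` for every `f` is enough for `z` to be in the resolvent set, by symmetry and the closed
graph theorem (`mem_opResolventSet_of_solvable`).

**Trace class.** The weak form gives the second resolvent identity
`⟨g, (R₀ - R) f⟩ = ∫ V (R f) (R₀ ḡ)` (`inner_resolvent_sub`). Since the values of `R f` and `R₀ f` at a
point are bounded functionals of `f`, uniformly in the point, `√|V| R` and `√|V| R₀` are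
Hilbert-Schmidt, so that `R₀ - R` is trace class and its trace is the double integral of `V` and the
two Green's functions (`isTraceClass_and_hasTrace`).

**Evaluation.** The derivative of the Wronskian of a solution for `V` and a free solution is `V` times
their product. Hence the integral of `V` and the two Green's functions over the first variable is the
difference of the diagonals of the Green's functions, the vertex terms cancelling
(`sum_integral_potential_mul_greenKernel`). The integral of `χⱼ θⱼ` over `[0, X]` is a difference of
Wronskians of `χⱼ` with the derivative of `θⱼ` in `ζ` (`IsSchrodingerSol.integral_mul_jostTheta`). At
the vertex these add up to `G'`; at `X` they are `i X G + G / (2ζ) + o(1)`, which after division by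
`G` does not depend on `V` (`tendsto_sum_integral_diagonal`). For `V = 0` one has `G = i n ζ`, whence
the term `1/ζ`.
-/

noncomputable section

local notation "μ₀" => Measure.restrict (volume : Measure ℝ) (Ioi (0 : ℝ))

/-! ### Locally absolutely continuous functions on the half-line -/

/-- `F` is locally absolutely continuous on `[0, ∞)` with (almost everywhere) derivative `f`. -/
structure HasACDeriv (F f : ℝ → ℂ) : Prop where
  intervalIntegrable : ∀ x, 0 ≤ x → IntervalIntegrable f volume 0 x
  eq : ∀ x, 0 ≤ x → F x = F 0 + ∫ t in (0 : ℝ)..x, f t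

namespace HasACDeriv

variable {F G f g : ℝ → ℂ} {X : ℝ}

lemma integral_eq_sub (h : HasACDeriv F f) {x y : ℝ} (hx : 0 ≤ x) (hy : 0 ≤ y) :
    ∫ t in x..y, f t = F y - F x := by
  rw [h.eq y hy, h.eq x hx, ← intervalIntegral.integral_interval_sub_left
    (h.intervalIntegrable y hy) (h.intervalIntegrable x hx)]
  ring

lemma congr (h : HasACDeriv F f) (hF : ∀ x, 0 ≤ x → F x = G x)
    (hf : ∀ᵐ x ∂volume.restrict (Ioi (0 : ℝ)), f x = g x) : HasACDeriv G g := by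
  have key : ∀ x : ℝ, 0 ≤ x → f =ᵐ[volume.restrict (uIoc 0 x)] g := by
    intro x hx
    rw [uIoc_of_le hx]
    exact ae_restrict_of_ae_restrict_of_subset Ioc_subset_Ioi_self hf
  refine ⟨fun x hx => (h.intervalIntegrable x hx).congr_ae (key x hx), fun x hx => ?_⟩
  rw [← hF x hx, ← hF 0 le_rfl, h.eq x hx]
  congr 1
  refine intervalIntegral.integral_congr_ae_restrict (key x hx)

lemma congr' (h : HasACDeriv F f) (hF : ∀ x, 0 ≤ x → F x = G x)
    (hf : ∀ x, 0 < x → f x = g x) : HasACDeriv G g :=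
  h.congr hF ((ae_restrict_iff' measurableSet_Ioi).2 (Eventually.of_forall fun x hx => hf x hx))

lemma continuousOn (h : HasACDeriv F f) : ContinuousOn F (Ici 0) := by
  have key : ∀ X : ℝ, 0 < X → ContinuousOn F (Icc 0 X) := by
    intro X hX
    have := (intervalIntegral.continuousOn_primitive_interval' (a := 0)
      (h.intervalIntegrable X hX.le) (by simp)).const_add (F 0)
    rw [uIcc_of_le hX.le] at this
    exact this.congr fun x hx => h.eq x hx.1
  intro x hx
  have hx0 : (0 : ℝ) ≤ x := hx
  have := key (x + 1) (by linarith) x ⟨hx, by linarith⟩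
  refine this.mono_of_mem_nhdsWithin ?_
  rw [← Ici_inter_Iic]
  exact inter_mem self_mem_nhdsWithin (mem_nhdsWithin_of_mem_nhds (Iic_mem_nhds (by linarith)))

lemma add (hF : HasACDeriv F f) (hG : HasACDeriv G g) :
    HasACDeriv (fun x => F x + G x) (fun x => f x + g x) := by
  refine ⟨fun x hx => (hF.intervalIntegrable x hx).add (hG.intervalIntegrable x hx), fun x hx => ?_⟩
  rw [intervalIntegral.integral_add (hF.intervalIntegrable x hx) (hG.intervalIntegrable x hx),
    hF.eq x hx, hG.eq x hx]
  ring

lemma const_mul (c : ℂ) (hF : HasACDeriv F f) :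
    HasACDeriv (fun x => c * F x) (fun x => c * f x) := by
  refine ⟨fun x hx => (hF.intervalIntegrable x hx).const_mul c, fun x hx => ?_⟩
  rw [intervalIntegral.integral_const_mul, hF.eq x hx]
  ring

lemma const (c : ℂ) : HasACDeriv (fun _ => c) (fun _ => 0) :=
  ⟨fun _ _ => by simp, fun _ _ => by simp⟩

lemma neg (hF : HasACDeriv F f) : HasACDeriv (fun x => -F x) (fun x => -f x) := by
  simpa using hF.const_mul (-1)

lemma sub (hF : HasACDeriv F f) (hG : HasACDeriv G g) :
    HasACDeriv (fun x => F x - G x) (fun x => f x - g x) := by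
  simpa [sub_eq_add_neg] using hF.add hG.neg

lemma complex_conj (hF : HasACDeriv F f) : HasACDeriv (fun x => conj (F x)) (fun x => conj (f x)) := by
  refine ⟨fun x hx => ?_, fun x hx => ?_⟩
  · have := hF.intervalIntegrable x hx
    rw [intervalIntegrable_iff] at this ⊢
    exact (Complex.conjLIE.toContinuousLinearEquiv.toContinuousLinearMap).integrable_comp this
  · rw [hF.eq x hx, map_add, intervalIntegral.integral_of_le hx, intervalIntegral.integral_of_le hx,
      integral_conj]

lemma of_hasDerivAt (h : ∀ x, HasDerivAt F (f x) x) (hf : Continuous f) : HasACDeriv F f := by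
  refine ⟨fun x _ => hf.intervalIntegrable _ _, fun x _ => ?_⟩
  rw [intervalIntegral.integral_eq_sub_of_hasDerivAt (fun t _ => h t) (hf.intervalIntegrable _ _)]
  ring

lemma exp (c : ℂ) :
    HasACDeriv (fun x => Complex.exp (c * x)) (fun x => c * Complex.exp (c * x)) := by
  refine of_hasDerivAt (fun x => ?_) (by fun_prop)
  have h1 : HasDerivAt (fun x : ℝ => c * (x : ℂ)) c x := by
    simpa using (Complex.ofRealCLM.hasDerivAt (x := x)).const_mul c
  simpa [mul_comm] using h1.cexp

lemma absolutelyContinuousOnInterval (hF : HasACDeriv F f) (hX : 0 ≤ X) :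
    AbsolutelyContinuousOnInterval F 0 X := by
  have hi := hF.intervalIntegrable X hX
  have hc : ∀ c : ℂ, AbsolutelyContinuousOnInterval (fun _ : ℝ => c) 0 X := fun c =>
    LipschitzOnWith.absolutelyContinuousOnInterval (K := 0) (LipschitzOnWith.of_dist_le_mul (by simp))
  have hre : IntervalIntegrable (fun t => (f t).re) volume 0 X := by
    rw [intervalIntegrable_iff] at hi ⊢; exact hi.re
  have him : IntervalIntegrable (fun t => (f t).im) volume 0 X := by
    rw [intervalIntegrable_iff] at hi ⊢; exact hi.im
  have h1 := ((hc (F 0)).fun_add ((hre.absolutelyContinuousOnInterval_intervalIntegral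
    (c := 0) (by simp)).fun_smul (hc 1))).fun_add ((him.absolutelyContinuousOnInterval_intervalIntegral
    (c := 0) (by simp)).fun_smul (hc Complex.I))
  have key : ∀ x ∈ uIcc 0 X, F 0 + (∫ t in (0 : ℝ)..x, (f t).re) • (1 : ℂ) +
      (∫ t in (0 : ℝ)..x, (f t).im) • Complex.I = F x := by
    intro x hx
    rw [uIcc_of_le hX] at hx
    have hix := (hF.intervalIntegrable x hx.1)
    rw [hF.eq x hx.1, intervalIntegral.integral_of_le hx.1, intervalIntegral.integral_of_le hx.1,
      intervalIntegral.integral_of_le hx.1]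
    rw [intervalIntegrable_iff_integrableOn_Ioc_of_le hx.1] at hix
    rw [← integral_re_add_im hix]
    simp [add_assoc]
  rw [absolutelyContinuousOnInterval_iff] at h1 ⊢
  intro ε hε
  obtain ⟨δ, hδ, h⟩ := h1 ε hε
  refine ⟨δ, hδ, fun E hE hs => ?_⟩
  convert h E hE hs using 1
  refine Finset.sum_congr rfl fun i hi => ?_
  rw [key _ (hE.1 i hi).1, key _ (hE.1 i hi).2]

lemma ae_hasDerivAt_of_pos (h : HasACDeriv F f) :
    ∀ᵐ x : ℝ, 0 < x → HasDerivAt F (f x) x := by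
  have : ∀ n : ℕ, ∀ᵐ x : ℝ, x ∈ uIcc (0 : ℝ) n → ∀ c ∈ uIcc (0 : ℝ) n,
      HasDerivAt (fun x => ∫ t in c..x, f t) (f x) x := fun n =>
    (h.intervalIntegrable n n.cast_nonneg).ae_hasDerivAt_integral
  filter_upwards [ae_all_iff.2 this] with x hx hx0
  obtain ⟨n, hn⟩ := exists_nat_ge x
  have h1 := (hx n (by rw [uIcc_of_le n.cast_nonneg]; exact ⟨hx0.le, hn⟩) 0 (by simp)).const_add (F 0)
  refine h1.congr_of_eventuallyEq ?_
  filter_upwards [Ioi_mem_nhds hx0] with y hy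
  exact h.eq y (le_of_lt hy)

lemma ae_hasDerivAt (h : HasACDeriv F f) :
    ∀ᵐ x ∂volume.restrict (Ioi (0 : ℝ)), HasDerivAt F (f x) x :=
  (ae_restrict_iff' measurableSet_Ioi).2 h.ae_hasDerivAt_of_pos

lemma mul (hF : HasACDeriv F f) (hG : HasACDeriv G g) :
    HasACDeriv (fun x => F x * G x) (fun x => f x * G x + F x * g x) := by
  have hi : ∀ X : ℝ, 0 ≤ X → IntervalIntegrable (fun x => f x * G x + F x * g x) volume 0 X := by
    intro X hX
    have hs : uIcc 0 X ⊆ Ici 0 := by rw [uIcc_of_le hX]; exact Icc_subset_Ici_self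
    exact ((hF.intervalIntegrable X hX).mul_continuousOn (hG.continuousOn.mono hs)).add
      ((hG.intervalIntegrable X hX).continuousOn_mul (hF.continuousOn.mono hs))
  refine ⟨hi, fun X hX => ?_⟩
  have hP : HasACDeriv (fun x => F 0 * G 0 + ∫ t in (0 : ℝ)..x, (f t * G t + F t * g t))
      (fun x => f x * G x + F x * g x) := ⟨hi, fun x _ => by simp⟩
  have aK := ((hF.absolutelyContinuousOnInterval hX).fun_smul
    (hG.absolutelyContinuousOnInterval hX)).fun_sub (hP.absolutelyContinuousOnInterval hX)
  obtain ⟨C, hC⟩ := aK.const_of_ae_hasDerivAt_zero (by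
    filter_upwards [hF.ae_hasDerivAt_of_pos, hG.ae_hasDerivAt_of_pos, hP.ae_hasDerivAt_of_pos,
      Measure.ae_ne volume 0] with x h1 h2 h3 hx0 hx
    rw [uIcc_of_le hX] at hx
    have hx1 : 0 < x := lt_of_le_of_ne hx.1 (Ne.symm hx0)
    simpa using! ((h1 hx1).mul (h2 hx1)).sub (h3 hx1))
  have e0 := hC 0 (by simp)
  have eX := hC X (by simp)
  rw [← e0] at eX
  simp only [smul_eq_mul, intervalIntegral.integral_same, add_zero, sub_self] at eX
  linear_combination eX

lemma deriv_ae_eq (h : HasACDeriv F f) : deriv F =ᵐ[volume.restrict (Ioi (0 : ℝ))] f := by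
  filter_upwards [h.ae_hasDerivAt] with x hx using hx.deriv

/-- If the derivative is continuous, it is the derivative in the classical sense, one-sided at the
end point. -/
lemma hasDerivWithinAt (h : HasACDeriv F f) (hf : ContinuousOn f (Ici 0)) {x : ℝ} (hx : 0 ≤ x) :
    HasDerivWithinAt F (f x) (Ici 0) x := by
  set f' : ℝ → ℂ := fun t => f (max t 0) with hf'
  have hc : Continuous f' := hf.comp_continuous (by fun_prop) fun t => mem_Ici.2 (le_max_right _ _)
  have key : ∀ y, 0 ≤ y → F y = F 0 + ∫ t in (0 : ℝ)..y, f' t := by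
    intro y hy
    rw [h.eq y hy]
    congr 1
    refine intervalIntegral.integral_congr fun t ht => ?_
    rw [uIcc_of_le hy] at ht
    simp [hf', max_eq_left ht.1]
  have := ((hc.integral_hasStrictDerivAt 0 x).hasDerivAt.const_add (F 0)).hasDerivWithinAt
    (s := Ici 0)
  have e : f' x = f x := by simp [hf', max_eq_left hx]
  rw [e] at this
  exact this.congr (fun y hy => key y hy) (key x hx)

lemma of_intervalIntegrable (hf : ∀ x, 0 ≤ x → IntervalIntegrable f volume 0 x) (c : ℂ) :
    HasACDeriv (fun x => c + ∫ t in (0 : ℝ)..x, f t) f :=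
  ⟨hf, fun x _ => by simp⟩

lemma of_integrableOn (hf : IntegrableOn f (Ioi 0)) (c : ℂ) :
    HasACDeriv (fun x => c + ∫ t in (0 : ℝ)..x, f t) f :=
  of_intervalIntegrable (fun x hx => by
    rw [intervalIntegrable_iff_integrableOn_Ioc_of_le hx]
    exact hf.mono_set Ioc_subset_Ioi_self) c

lemma integral_Ioi (hf : IntegrableOn f (Ioi 0)) :
    HasACDeriv (fun x => ∫ t in Ioi x, f t) (fun x => -f x) := by
  have := (of_integrableOn hf (-∫ t in Ioi (0 : ℝ), f t)).neg
  refine this.congr' (fun x hx => ?_) (fun _ _ => rfl)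
  have h1 := intervalIntegral.integral_Ioi_sub_Ioi hf hx
  have h2 : IntegrableOn f (Ioi x) := hf.mono_set (Ioi_subset_Ioi hx)
  linear_combination h1

lemma tendsto (h : HasACDeriv F f) (hf : IntegrableOn f (Ioi 0)) :
    Tendsto F atTop (𝓝 (F 0 + ∫ t in Ioi (0 : ℝ), f t)) := by
  have := (intervalIntegral_tendsto_integral_Ioi 0 hf tendsto_id).const_add (F 0)
  refine this.congr' ?_
  filter_upwards [eventually_ge_atTop 0] with x hx using (h.eq x hx).symm

/-- An integrable locally absolutely continuous function with integrable derivative vanishes at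
infinity. -/
lemma tendsto_zero (h : HasACDeriv F f) (hf : IntegrableOn f (Ioi 0)) (hF : IntegrableOn F (Ioi 0)) :
    Tendsto F atTop (𝓝 0) := by
  have h1 := h.tendsto hf
  set L := F 0 + ∫ t in Ioi (0 : ℝ), f t
  have hL : L = 0 := by
    by_contra hL
    have hpos : 0 < ‖L‖ / 2 := by positivity
    have h2 : ∀ᶠ x in atTop, ‖L‖ / 2 < ‖F x‖ :=
      (h1.norm).eventually_const_lt (by linarith [norm_pos_iff.2 hL])
    obtain ⟨X, hX⟩ := (h2.and (eventually_ge_atTop 0)).exists_forall_of_atTop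
    have h3 : IntegrableOn (fun _ : ℝ => ‖L‖ / 2) (Ioi X) := by
      refine Integrable.mono' (hF.mono_set (Ioi_subset_Ioi (hX X le_rfl).2)).norm (by fun_prop) ?_
      refine (ae_restrict_iff' measurableSet_Ioi).2 (Eventually.of_forall fun x hx => ?_)
      rw [Real.norm_of_nonneg hpos.le]
      exact (hX x (le_of_lt hx)).1.le
    rw [integrableOn_const_iff] at h3
    rcases h3 with h3 | h3
    · exact hpos.ne' (by simpa using h3)
    · simp at h3
  rwa [hL] at h1

lemma setIntegral_Ioi (h : HasACDeriv F f) (hf : IntegrableOn f (Ioi 0))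
    (h0 : Tendsto F atTop (𝓝 0)) {x : ℝ} (hx : 0 ≤ x) : ∫ t in Ioi x, f t = -F x := by
  have h1 := tendsto_nhds_unique (h.tendsto hf) h0
  have h2 := intervalIntegral.integral_Ioi_sub_Ioi hf hx
  have h3 := h.eq x hx
  linear_combination h1 - h2 + h3

end HasACDeriv

/-! ### Volterra integral equations -/

/-- Differentiation under the integral sign for holomorphic integrands: a locally dominated integral
of functions that are holomorphic in a parameter is holomorphic. -/
lemma differentiableOn_integral_of_dominated {α : Type*} [MeasurableSpace α] {μ : Measure α}
    {U : Set ℂ} (hU : IsOpen U) {F : ℂ → α → ℂ} {bound : α → ℝ}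
    (hm : ∀ ζ ∈ U, AEStronglyMeasurable (F ζ) μ)
    (hd : ∀ᵐ t ∂μ, DifferentiableOn ℂ (fun ζ => F ζ t) U)
    (hb : ∀ᵐ t ∂μ, ∀ ζ ∈ U, ‖F ζ t‖ ≤ bound t) (hbi : Integrable bound μ) :
    DifferentiableOn ℂ (fun ζ => ∫ t, F ζ t ∂μ) U := by
  intro ζ hζ
  obtain ⟨r, hr, hrU⟩ := Metric.isOpen_iff.1 hU ζ hζ
  have hsub : ∀ x ∈ Metric.ball ζ (r / 2), Metric.closedBall x (r / 3) ⊆ U := by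
    intro x hx y hy
    refine hrU ?_
    rw [Metric.mem_ball] at hx ⊢
    rw [Metric.mem_closedBall] at hy
    linarith [dist_triangle y x ζ]
  have hF' : AEStronglyMeasurable (fun t => deriv (fun ζ => F ζ t) ζ) μ := by
    -- the derivative is the limit of a sequence of difference quotients
    set h : ℕ → ℂ := fun n => ((r / 2 / (n + 1) : ℝ) : ℂ) with hh
    have hh0 : ∀ n, h n ≠ 0 := fun n => by
      rw [hh]; exact Complex.ofReal_ne_zero.2 (by positivity)
    have hhU : ∀ n, ζ + h n ∈ U := by
      intro n
      refine hrU ?_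
      rw [Metric.mem_ball, dist_eq_norm, add_sub_cancel_left, hh, Complex.norm_real,
        Real.norm_of_nonneg (by positivity), div_lt_iff₀ (by positivity)]
      nlinarith [n.cast_nonneg (α := ℝ)]
    have hhl : Tendsto h atTop (𝓝[≠] 0) := by
      refine tendsto_nhdsWithin_iff.2 ⟨?_, Eventually.of_forall hh0⟩
      have : Tendsto (fun n : ℕ => r / 2 / ((n : ℝ) + 1)) atTop (𝓝 0) :=
        tendsto_const_nhds.div_atTop (tendsto_natCast_atTop_atTop.atTop_add tendsto_const_nhds)
      simpa only [Complex.ofReal_zero] using! (Complex.continuous_ofReal.tendsto 0).comp this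
    refine aestronglyMeasurable_of_tendsto_ae atTop
      (f := fun n t => (h n)⁻¹ • (F (ζ + h n) t - F ζ t))
      (fun n => ((hm _ (hhU n)).sub (hm _ hζ)).const_smul (h n)⁻¹) ?_
    filter_upwards [hd] with t ht
    exact (hasDerivAt_iff_tendsto_slope_zero.1
      ((ht.differentiableAt (hU.mem_nhds hζ)).hasDerivAt)).comp hhl
  have := (hasDerivAt_integral_of_dominated_loc_of_deriv_le (μ := μ) (F := F)
    (F' := fun x t => deriv (fun ζ => F ζ t) x) (bound := fun t => bound t / (r / 3))
    (Metric.ball_mem_nhds ζ (half_pos hr)) (by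
      filter_upwards [hU.mem_nhds hζ] with x hx using hm x hx)
    (hbi.mono' (hm ζ hζ) (by filter_upwards [hb] with t ht using ht ζ hζ)) hF' (by
      filter_upwards [hb, hd] with t ht hdt x hx
      refine Complex.norm_deriv_le_of_forall_mem_sphere_norm_le (by positivity) ?_ fun y hy =>
        ht y (hsub x hx (Metric.sphere_subset_closedBall hy))
      exact DifferentiableOn.diffContOnCl
        (hdt.mono (Metric.closure_ball_subset_closedBall.trans (hsub x hx))))
    (hbi.div_const _) (by
      filter_upwards [hd] with t hdt x hx
      exact (hdt.differentiableAt (hU.mem_nhds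
        (hsub x hx (Metric.mem_closedBall_self (by positivity))))).hasDerivAt)).2
  exact this.differentiableAt.differentiableWithinAt

/-- The domains of integration `S x`, `x ≥ 0`, and the weight `q` of a Volterra equation
`m(x) = g(x) + ∫_{S x} k(x, t) q(t) m(t) dt`. The last condition is what makes the Neumann series
converge like an exponential series. -/
structure IsVolterra (S : ℝ → Set ℝ) (q : ℝ → ℂ) : Prop where
  measurableSet : MeasurableSet {p : ℝ × ℝ | p.2 ∈ S p.1}
  subset : ∀ x, 0 ≤ x → S x ⊆ Ioi 0
  integrableOn : IntegrableOn q (Ioi 0)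
  continuousOn : ContinuousOn (fun x => ∫ t in S x, ‖q t‖) (Ici 0)
  integral_pow_le : ∀ (n : ℕ) (x : ℝ), 0 ≤ x →
    ∫ t in S x, ‖q t‖ * (∫ s in S t, ‖q s‖) ^ n ≤ (∫ s in S x, ‖q s‖) ^ (n + 1) / (n + 1)

/-- The terms of the Neumann series of the Volterra equation. -/
def volterraIter (S : ℝ → Set ℝ) (k : ℝ → ℝ → ℂ) (q g : ℝ → ℂ) : ℕ → ℝ → ℂ
  | 0 => g
  | n + 1 => fun x => ∫ t in S x, k x t * (q t * volterraIter S k q g n t)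

/-- The solution of the Volterra equation `m(x) = g(x) + ∫_{S x} k(x, t) q(t) m(t) dt`, as the sum
of its Neumann series. -/
def volterraSol (S : ℝ → Set ℝ) (k : ℝ → ℝ → ℂ) (q g : ℝ → ℂ) (x : ℝ) : ℂ :=
  ∑' n, volterraIter S k q g n x

namespace IsVolterra

variable {S : ℝ → Set ℝ} {q g : ℝ → ℂ} {k : ℝ → ℝ → ℂ} {M C : ℝ}

lemma measurableSet_section (hS : IsVolterra S q) (x : ℝ) : MeasurableSet (S x) :=
  measurable_prodMk_left hS.measurableSet

lemma mass_nonneg (x : ℝ) : 0 ≤ ∫ t in S x, ‖q t‖ := integral_nonneg fun _ => norm_nonneg _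

lemma mass_le (hS : IsVolterra S q) {x : ℝ} (hx : 0 ≤ x) :
    ∫ t in S x, ‖q t‖ ≤ ∫ t in Ioi (0 : ℝ), ‖q t‖ :=
  setIntegral_mono_set hS.integrableOn.norm (Eventually.of_forall fun _ => norm_nonneg _)
    (hS.subset x hx).eventuallyLE

lemma integrableOn_mul_pow (hS : IsVolterra S q) (n : ℕ) {x : ℝ} (hx : 0 ≤ x) :
    IntegrableOn (fun t => ‖q t‖ * (∫ s in S t, ‖q s‖) ^ n) (S x) := by
  refine IntegrableOn.mono_set ?_ (hS.subset x hx)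
  refine hS.integrableOn.norm.mul_bdd (c := (∫ t in Ioi (0 : ℝ), ‖q t‖) ^ n)
    (((hS.continuousOn.pow n).mono Ioi_subset_Ici_self).aestronglyMeasurable measurableSet_Ioi) ?_
  refine (ae_restrict_iff' measurableSet_Ioi).2 (Eventually.of_forall fun t ht => ?_)
  rw [norm_pow, Real.norm_of_nonneg (mass_nonneg t)]
  exact pow_le_pow_left₀ (mass_nonneg t) (hS.mass_le (le_of_lt ht)) n

/-- The `n`-th term is bounded by the `n`-th term of an exponential series in the mass of `q` on
`S x`. -/
lemma norm_iter_le (hS : IsVolterra S q) (hk : ∀ x t, 0 ≤ x → t ∈ S x → ‖k x t‖ ≤ M) (hM : 0 ≤ M)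
    (hg : ∀ x, 0 ≤ x → ‖g x‖ ≤ C) (n : ℕ) {x : ℝ} (hx : 0 ≤ x) :
    ‖volterraIter S k q g n x‖ ≤ C * (M ^ n * (∫ t in S x, ‖q t‖) ^ n / n.factorial) := by
  have hC : 0 ≤ C := (norm_nonneg _).trans (hg 0 le_rfl)
  induction n generalizing x with
  | zero => simpa [volterraIter] using hg x hx
  | succ n ih =>
    calc ‖volterraIter S k q g (n + 1) x‖
        ≤ ∫ t in S x, M * (C * (M ^ n / n.factorial)) * (‖q t‖ * (∫ s in S t, ‖q s‖) ^ n) := by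
          refine norm_integral_le_of_norm_le ((hS.integrableOn_mul_pow n hx).const_mul _) ?_
          refine (ae_restrict_iff' (hS.measurableSet_section x)).2 (Eventually.of_forall fun t ht => ?_)
          rw [norm_mul, norm_mul]
          have h1 := ih (le_of_lt (hS.subset x hx ht))
          have h2 := hk x t hx ht
          calc ‖k x t‖ * (‖q t‖ * ‖volterraIter S k q g n t‖)
              ≤ M * (‖q t‖ * (C * (M ^ n * (∫ t in S t, ‖q t‖) ^ n / n.factorial))) := by gcongr
            _ = _ := by ring
      _ = M * (C * (M ^ n / n.factorial)) * ∫ t in S x, ‖q t‖ * (∫ s in S t, ‖q s‖) ^ n := by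
          rw [integral_const_mul]
      _ ≤ M * (C * (M ^ n / n.factorial)) * ((∫ s in S x, ‖q s‖) ^ (n + 1) / (n + 1)) := by
          gcongr
          exact hS.integral_pow_le n x hx
      _ = _ := by
          rw [Nat.factorial_succ]
          push_cast
          field_simp
          ring

lemma norm_iter_le' (hS : IsVolterra S q) (hk : ∀ x t, 0 ≤ x → t ∈ S x → ‖k x t‖ ≤ M) (hM : 0 ≤ M)
    (hg : ∀ x, 0 ≤ x → ‖g x‖ ≤ C) (n : ℕ) {x : ℝ} (hx : 0 ≤ x) :
    ‖volterraIter S k q g n x‖ ≤ C * ((M * ∫ t in Ioi (0 : ℝ), ‖q t‖) ^ n / n.factorial) := by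
  have hC : 0 ≤ C := (norm_nonneg _).trans (hg 0 le_rfl)
  refine (hS.norm_iter_le hk hM hg n hx).trans ?_
  rw [mul_pow]
  have := hS.mass_le hx
  have := mass_nonneg (S := S) (q := q) x
  gcongr

lemma hasSum_bound (C B : ℝ) : HasSum (fun n : ℕ => C * (B ^ n / n.factorial)) (C * Real.exp B) := by
  rw [Real.exp_eq_exp_ℝ]
  exact (NormedSpace.expSeries_div_hasSum_exp B).mul_left C

lemma hasSum_iter (hS : IsVolterra S q) (hk : ∀ x t, 0 ≤ x → t ∈ S x → ‖k x t‖ ≤ M) (hM : 0 ≤ M)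
    (hg : ∀ x, 0 ≤ x → ‖g x‖ ≤ C) {x : ℝ} (hx : 0 ≤ x) :
    HasSum (fun n => volterraIter S k q g n x) (volterraSol S k q g x) :=
  (Summable.of_norm_bounded (hasSum_bound _ _).summable
    fun n => hS.norm_iter_le' hk hM hg n hx).hasSum

lemma norm_sol_le (hS : IsVolterra S q) (hk : ∀ x t, 0 ≤ x → t ∈ S x → ‖k x t‖ ≤ M) (hM : 0 ≤ M)
    (hg : ∀ x, 0 ≤ x → ‖g x‖ ≤ C) {x : ℝ} (hx : 0 ≤ x) :
    ‖volterraSol S k q g x‖ ≤ C * Real.exp (M * ∫ t in Ioi (0 : ℝ), ‖q t‖) :=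
  tsum_of_norm_bounded (hasSum_bound _ _) fun n => hS.norm_iter_le' hk hM hg n hx

lemma aestronglyMeasurable_iter (hS : IsVolterra S q) (hkc : Continuous (Function.uncurry k))
    (hgc : ContinuousOn g (Ici 0)) (n : ℕ) :
    AEStronglyMeasurable (volterraIter S k q g n) (volume.restrict (Ioi 0)) := by
  induction n with
  | zero => exact (hgc.mono Ioi_subset_Ici_self).aestronglyMeasurable measurableSet_Ioi
  | succ n ih =>
    have h1 : AEStronglyMeasurable (fun p : ℝ × ℝ => k p.1 p.2 *
        (q p.2 * volterraIter S k q g n p.2))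
        ((volume.restrict (Ioi (0 : ℝ))).prod (volume.restrict (Ioi (0 : ℝ)))) :=
      hkc.aestronglyMeasurable.mul
        ((hS.integrableOn.aestronglyMeasurable.comp_snd).mul ih.comp_snd)
    have h2 := (h1.indicator hS.measurableSet).integral_prod_right'
    refine h2.congr ?_
    refine (ae_restrict_iff' measurableSet_Ioi).2 (Eventually.of_forall fun x hx => ?_)
    have h3 : ∀ t, ({p : ℝ × ℝ | p.2 ∈ S p.1}.indicator
        (fun p : ℝ × ℝ => k p.1 p.2 * (q p.2 * volterraIter S k q g n p.2)) (x, t)) =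
        (S x).indicator (fun t => k x t * (q t * volterraIter S k q g n t)) t := fun t => rfl
    simp only [h3, volterraIter]
    rw [integral_indicator (hS.measurableSet_section x),
      Measure.restrict_restrict (hS.measurableSet_section x),
      inter_eq_left.2 (hS.subset x (le_of_lt hx))]

lemma aestronglyMeasurable_sol (hS : IsVolterra S q)
    (hk : ∀ x t, 0 ≤ x → t ∈ S x → ‖k x t‖ ≤ M) (hM : 0 ≤ M)
    (hg : ∀ x, 0 ≤ x → ‖g x‖ ≤ C) (hkc : Continuous (Function.uncurry k))
    (hgc : ContinuousOn g (Ici 0)) :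
    AEStronglyMeasurable (volterraSol S k q g) (volume.restrict (Ioi 0)) := by
  refine aestronglyMeasurable_of_tendsto_ae atTop
    (f := fun N x => ∑ n ∈ Finset.range N, volterraIter S k q g n x)
    (fun N => Finset.aestronglyMeasurable_fun_sum _ fun n _ =>
      hS.aestronglyMeasurable_iter hkc hgc n) ?_
  refine (ae_restrict_iff' measurableSet_Ioi).2 (Eventually.of_forall fun x hx => ?_)
  exact (hS.hasSum_iter hk hM hg (le_of_lt hx)).tendsto_sum_nat

lemma integrableOn_mul_sol (hS : IsVolterra S q)
    (hk : ∀ x t, 0 ≤ x → t ∈ S x → ‖k x t‖ ≤ M) (hM : 0 ≤ M)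
    (hg : ∀ x, 0 ≤ x → ‖g x‖ ≤ C) (hkc : Continuous (Function.uncurry k))
    (hgc : ContinuousOn g (Ici 0)) :
    IntegrableOn (fun t => q t * volterraSol S k q g t) (Ioi 0) := by
  refine hS.integrableOn.mul_bdd (hS.aestronglyMeasurable_sol hk hM hg hkc hgc)
    (c := C * Real.exp (M * ∫ t in Ioi (0 : ℝ), ‖q t‖)) ?_
  exact (ae_restrict_iff' measurableSet_Ioi).2 (Eventually.of_forall fun x hx =>
    hS.norm_sol_le hk hM hg (le_of_lt hx))

/-- The sum of the Neumann series solves the Volterra equation. -/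
lemma sol_eq (hS : IsVolterra S q) (hk : ∀ x t, 0 ≤ x → t ∈ S x → ‖k x t‖ ≤ M) (hM : 0 ≤ M)
    (hg : ∀ x, 0 ≤ x → ‖g x‖ ≤ C) (hkc : Continuous (Function.uncurry k))
    (hgc : ContinuousOn g (Ici 0)) {x : ℝ} (hx : 0 ≤ x) :
    volterraSol S k q g x = g x + ∫ t in S x, k x t * (q t * volterraSol S k q g t) := by
  have hC : 0 ≤ C := (norm_nonneg _).trans (hg 0 le_rfl)
  have h1 : HasSum (fun n => volterraIter S k q g (n + 1) x)
      (∫ t in S x, k x t * (q t * volterraSol S k q g t)) := by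
    set B := M * ∫ t in Ioi (0 : ℝ), ‖q t‖
    have hi : IntegrableOn q (S x) := hS.integrableOn.mono_set (hS.subset x hx)
    have hsum : ∀ t, Summable fun n : ℕ => M * (‖q t‖ * (C * (B ^ n / n.factorial))) := fun t =>
      ((hasSum_bound C B).summable.mul_left _).mul_left _
    refine hasSum_integral_of_dominated_convergence
      (fun n t => M * (‖q t‖ * (C * (B ^ n / n.factorial)))) (fun n => ?_) (fun n => ?_)
      (Eventually.of_forall hsum) ?_ ?_
    · exact (hkc.comp (by fun_prop : Continuous fun t => (x, t))).aestronglyMeasurable.mul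
        (hi.aestronglyMeasurable.mul ((hS.aestronglyMeasurable_iter hkc hgc n).mono_measure
          (Measure.restrict_mono (hS.subset x hx) le_rfl)))
    · refine (ae_restrict_iff' (hS.measurableSet_section x)).2 (Eventually.of_forall fun t ht => ?_)
      rw [norm_mul, norm_mul]
      have h1 := hS.norm_iter_le' hk hM hg n (le_of_lt (hS.subset x hx ht))
      have h2 := hk x t hx ht
      gcongr
    · have : (fun t => ∑' n : ℕ, M * (‖q t‖ * (C * (B ^ n / n.factorial)))) =
          fun t => M * (‖q t‖ * (C * Real.exp B)) := by
        funext t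
        rw [tsum_mul_left, tsum_mul_left, (hasSum_bound C B).tsum_eq]
      rw [this]
      exact (hi.norm.mul_const _).const_mul _
    · refine (ae_restrict_iff' (hS.measurableSet_section x)).2 (Eventually.of_forall fun t ht => ?_)
      exact ((hS.hasSum_iter hk hM hg (le_of_lt (hS.subset x hx ht))).mul_left _).mul_left _
  have h2 := (hasSum_nat_add_iff' 1).2 (hS.hasSum_iter hk hM hg hx)
  have h3 := h1.unique h2
  rw [h3]
  simp [volterraIter]

/-- If the kernel is holomorphic in a parameter and bounded uniformly in it, the solution of the
Volterra equation is holomorphic in the parameter. -/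
lemma differentiableOn_sol (hS : IsVolterra S q) {U : Set ℂ} (hU : IsOpen U)
    {k : ℂ → ℝ → ℝ → ℂ} (hk : ∀ ζ ∈ U, ∀ x t, 0 ≤ x → t ∈ S x → ‖k ζ x t‖ ≤ M) (hM : 0 ≤ M)
    (hg : ∀ x, 0 ≤ x → ‖g x‖ ≤ C) (hkc : ∀ ζ ∈ U, Continuous (Function.uncurry (k ζ)))
    (hkd : ∀ x t, DifferentiableOn ℂ (fun ζ => k ζ x t) U)
    (hgc : ContinuousOn g (Ici 0)) {x : ℝ} (hx : 0 ≤ x) :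
    DifferentiableOn ℂ (fun ζ => volterraSol S (k ζ) q g x) U := by
  have hC : 0 ≤ C := (norm_nonneg _).trans (hg 0 le_rfl)
  have h1 : ∀ n x, 0 ≤ x → DifferentiableOn ℂ (fun ζ => volterraIter S (k ζ) q g n x) U := by
    intro n
    induction n with
    | zero => intro x _; exact differentiableOn_const _
    | succ n ih =>
      intro x hx
      refine differentiableOn_integral_of_dominated hU
        (bound := fun t => M * (‖q t‖ * (C * ((M * ∫ t in Ioi (0 : ℝ), ‖q t‖) ^ n / n.factorial))))
        (fun ζ hζ => ?_) ?_ ?_ ?_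
      · exact ((hkc ζ hζ).comp (by fun_prop : Continuous fun t => (x, t))).aestronglyMeasurable.mul
          ((hS.integrableOn.mono_set (hS.subset x hx)).aestronglyMeasurable.mul
            ((hS.aestronglyMeasurable_iter (hkc ζ hζ) hgc n).mono_measure
              (Measure.restrict_mono (hS.subset x hx) le_rfl)))
      · refine (ae_restrict_iff' (hS.measurableSet_section x)).2
          (Eventually.of_forall fun t ht => ?_)
        exact (hkd x t).mul ((ih t (le_of_lt (hS.subset x hx ht))).const_mul _)
      · refine (ae_restrict_iff' (hS.measurableSet_section x)).2
          (Eventually.of_forall fun t ht ζ hζ => ?_)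
        rw [norm_mul, norm_mul]
        have h1 := hS.norm_iter_le' (hk ζ hζ) hM hg n (le_of_lt (hS.subset x hx ht))
        have h2 := hk ζ hζ x t hx ht
        gcongr
      · exact ((hS.integrableOn.mono_set (hS.subset x hx)).norm.mul_const _).const_mul _
  exact Complex.differentiableOn_tsum_of_summable_norm (hasSum_bound _ _).summable
    (fun n => h1 n x hx) hU fun n ζ hζ => hS.norm_iter_le' (hk ζ hζ) hM hg n hx

end IsVolterra

/-! ### Solutions of the Schrödinger equation on the half-line -/

/-- `y` solves `-y'' + v y = z y` on `[0, ∞)` and `p = y'`, in the sense of locally absolutely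
continuous functions. -/
structure IsSchrodingerSol (v : ℝ → ℝ) (z : ℂ) (y p : ℝ → ℂ) : Prop where
  left : HasACDeriv y p
  right : HasACDeriv p (fun t => ((v t : ℂ) - z) * y t)

/-- The Wronskian of two solutions, possibly for different potentials and spectral parameters. -/
lemma IsSchrodingerSol.wronskian {v₁ v₂ : ℝ → ℝ} {z₁ z₂ : ℂ} {y₁ p₁ y₂ p₂ : ℝ → ℂ}
    (h₁ : IsSchrodingerSol v₁ z₁ y₁ p₁) (h₂ : IsSchrodingerSol v₂ z₂ y₂ p₂) :
    HasACDeriv (fun x => y₁ x * p₂ x - p₁ x * y₂ x)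
      (fun x => ((v₂ x - z₂) - (v₁ x - z₁)) * (y₁ x * y₂ x)) :=
  ((h₁.left.mul h₂.right).sub (h₁.right.mul h₂.left)).congr' (fun _ _ => rfl) fun x _ => by ring

/-- The Wronskian of two solutions of the same equation is constant. -/
lemma IsSchrodingerSol.wronskian_const {v : ℝ → ℝ} {z : ℂ} {y₁ p₁ y₂ p₂ : ℝ → ℂ}
    (h₁ : IsSchrodingerSol v z y₁ p₁) (h₂ : IsSchrodingerSol v z y₂ p₂) {x : ℝ} (hx : 0 ≤ x) :
    y₁ x * p₂ x - p₁ x * y₂ x = y₁ 0 * p₂ 0 - p₁ 0 * y₂ 0 := by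
  have := (h₁.wronskian h₂).eq x hx
  simpa using this

lemma IsSchrodingerSol.const_mul {v : ℝ → ℝ} {z : ℂ} {y p : ℝ → ℂ}
    (h : IsSchrodingerSol v z y p) (c : ℂ) :
    IsSchrodingerSol v z (fun x => c * y x) (fun x => c * p x) :=
  ⟨h.left.const_mul c, (h.right.const_mul c).congr' (fun _ _ => rfl) fun x _ => by ring⟩

/-- Variation of constants: a combination of `exp(iζx)` and `exp(-iζx)` with coefficients `A`, `B`
solves the equation if `A` and `B` satisfy the usual first order system. -/
lemma isSchrodingerSol_of_variation {v : ℝ → ℝ} {ζ : ℂ} (hζ : ζ ≠ 0) {A B a b y p : ℝ → ℂ}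
    (hA : HasACDeriv A a) (hB : HasACDeriv B b)
    (hy : ∀ x, 0 ≤ x →
      y x = Complex.exp (Complex.I * ζ * x) * A x + Complex.exp (-(Complex.I * ζ) * x) * B x)
    (hp : ∀ x, 0 ≤ x → p x = Complex.I * ζ *
      (Complex.exp (Complex.I * ζ * x) * A x - Complex.exp (-(Complex.I * ζ) * x) * B x))
    (ha : ∀ x : ℝ, 0 < x → Complex.exp (Complex.I * ζ * x) * a x = v x * y x / (2 * Complex.I * ζ))
    (hb : ∀ x : ℝ, 0 < x →
      Complex.exp (-(Complex.I * ζ) * x) * b x = -(v x * y x / (2 * Complex.I * ζ))) :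
    IsSchrodingerSol v (ζ ^ 2) y p := by
  have h1 := (HasACDeriv.exp (Complex.I * ζ)).mul hA
  have h2 := (HasACDeriv.exp (-(Complex.I * ζ))).mul hB
  constructor
  · refine (h1.add h2).congr' (fun x hx => (hy x hx).symm) fun x hx => ?_
    rw [hp x hx.le]
    linear_combination ha x hx + hb x hx
  · refine ((h1.sub h2).const_mul (Complex.I * ζ)).congr' (fun x hx => (hp x hx).symm) fun x hx => ?_
    have e : Complex.I * ζ * (v x * y x / (2 * Complex.I * ζ)) * 2 = v x * y x := by
      field_simp
    have hI := Complex.I_sq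
    linear_combination Complex.I * ζ * ha x hx - Complex.I * ζ * hb x hx + e +
      ζ ^ 2 * hy x hx.le + ζ ^ 2 * (Complex.exp (Complex.I * ζ * x) * A x +
        Complex.exp (-(Complex.I * ζ) * x) * B x) * hI

/-- Equations integrated from infinity, as for the Jost solution. -/
lemma isVolterra_Ioi {q : ℝ → ℂ} (hq : IntegrableOn q (Ioi 0)) : IsVolterra (fun x => Ioi x) q := by
  have hn : IntegrableOn (fun t => (‖q t‖ : ℂ)) (Ioi 0) := hq.norm.ofReal
  have hQ := HasACDeriv.integral_Ioi hn
  have hQr : ∀ x : ℝ, ∫ t in Ioi x, (‖q t‖ : ℂ) = ((∫ t in Ioi x, ‖q t‖ : ℝ) : ℂ) := fun x =>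
    integral_complex_ofReal
  simp only [hQr] at hQ
  have hc : ContinuousOn (fun x => ∫ t in Ioi x, ‖q t‖) (Ici 0) := by
    exact Complex.continuous_re.comp_continuousOn hQ.continuousOn
  have hpow : ∀ n : ℕ, HasACDeriv (fun x => ((∫ t in Ioi x, ‖q t‖ : ℝ) : ℂ) ^ (n + 1))
      (fun x => -((n + 1) * (‖q x‖ * ((∫ t in Ioi x, ‖q t‖ : ℝ) : ℂ) ^ n))) := by
    intro n
    induction n with
    | zero => simpa using hQ
    | succ n ih =>
      refine (ih.mul hQ).congr' (fun x _ => by ring) fun x _ => ?_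
      push_cast
      ring
  refine ⟨measurableSet_lt measurable_fst measurable_snd, fun x hx => Ioi_subset_Ioi hx, hq, hc,
    fun n x hx => le_of_eq ?_⟩
  have hi : IntegrableOn (fun x => -((n + 1) * (‖q x‖ * ((∫ t in Ioi x, ‖q t‖ : ℝ) : ℂ) ^ n)))
      (Ioi 0) := by
    refine ((hn.mul_bdd (c := (∫ t in Ioi (0 : ℝ), ‖q t‖) ^ n)
      ((((Complex.continuous_ofReal.comp_continuousOn hc).pow n).mono
        Ioi_subset_Ici_self).aestronglyMeasurable measurableSet_Ioi) ?_).const_mul _).neg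
    refine (ae_restrict_iff' measurableSet_Ioi).2 (Eventually.of_forall fun t ht => ?_)
    have h0 : 0 ≤ ∫ s in Ioi t, ‖q s‖ := integral_nonneg fun _ => norm_nonneg _
    show ‖((∫ s in Ioi t, ‖q s‖ : ℝ) : ℂ) ^ n‖ ≤ _
    rw [norm_pow, Complex.norm_real, Real.norm_of_nonneg h0]
    refine pow_le_pow_left₀ h0 ?_ n
    exact setIntegral_mono_set hq.norm (Eventually.of_forall fun _ => norm_nonneg _)
      (Ioi_subset_Ioi (le_of_lt ht)).eventuallyLE
  have hlim : Tendsto (fun x => ((∫ t in Ioi x, ‖q t‖ : ℝ) : ℂ) ^ (n + 1)) atTop (𝓝 0) := by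
    have h1 := tendsto_integral_Ioi_zero (f := fun t => ‖q t‖) (μ := volume) tendsto_id
    have h2 := ((Complex.continuous_ofReal.tendsto 0).comp h1).pow (n + 1)
    simpa using! h2
  have h := (hpow n).setIntegral_Ioi hi hlim hx
  have h2 : (((n : ℝ) + 1) * ∫ t in Ioi x, ‖q t‖ * (∫ s in Ioi t, ‖q s‖) ^ n : ℝ) =
      (∫ t in Ioi x, ‖q t‖) ^ (n + 1) := by
    rw [integral_neg, neg_inj, integral_const_mul] at h
    have e : ∫ t in Ioi x, (‖q t‖ : ℂ) * ((∫ s in Ioi t, ‖q s‖ : ℝ) : ℂ) ^ n =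
        ((∫ t in Ioi x, ‖q t‖ * (∫ s in Ioi t, ‖q s‖) ^ n : ℝ) : ℂ) := by
      rw [← integral_complex_ofReal]
      simp
    rw [e] at h
    exact_mod_cast h
  rw [← h2]
  field_simp

/-- Equations integrated from the vertex, as for solutions with given Cauchy data. -/
lemma isVolterra_Ioc {q : ℝ → ℂ} (hq : IntegrableOn q (Ioi 0)) :
    IsVolterra (fun x => Ioc 0 x) q := by
  have hn : IntegrableOn (fun t => (‖q t‖ : ℂ)) (Ioi 0) := hq.norm.ofReal
  have hQr : ∀ x : ℝ, 0 ≤ x →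
      0 + ∫ t in (0 : ℝ)..x, (‖q t‖ : ℂ) = ((∫ t in Ioc 0 x, ‖q t‖ : ℝ) : ℂ) := fun x hx => by
    rw [zero_add, intervalIntegral.integral_of_le hx, integral_complex_ofReal]
  have hQ := (HasACDeriv.of_integrableOn hn 0).congr' hQr fun _ _ => rfl
  have hc : ContinuousOn (fun x => ∫ t in Ioc 0 x, ‖q t‖) (Ici 0) := by
    exact Complex.continuous_re.comp_continuousOn hQ.continuousOn
  have hpow : ∀ n : ℕ, HasACDeriv (fun x => ((∫ t in Ioc 0 x, ‖q t‖ : ℝ) : ℂ) ^ (n + 1))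
      (fun x => ((n + 1) * (‖q x‖ * ((∫ t in Ioc 0 x, ‖q t‖ : ℝ) : ℂ) ^ n))) := by
    intro n
    induction n with
    | zero => simpa using hQ
    | succ n ih =>
      refine (ih.mul hQ).congr' (fun x _ => by ring) fun x _ => ?_
      push_cast
      ring
  refine ⟨(measurableSet_lt measurable_const measurable_snd).inter
    (measurableSet_le measurable_snd measurable_fst), fun x _ => Ioc_subset_Ioi_self, hq, hc,
    fun n x hx => le_of_eq ?_⟩
  have h := (hpow n).eq x hx
  have h2 : (((n : ℝ) + 1) * ∫ t in Ioc 0 x, ‖q t‖ * (∫ s in Ioc 0 t, ‖q s‖) ^ n : ℝ) =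
      (∫ t in Ioc 0 x, ‖q t‖) ^ (n + 1) := by
    rw [intervalIntegral.integral_of_le hx, integral_const_mul] at h
    have e : ∫ t in Ioc 0 x, (‖q t‖ : ℂ) * ((∫ s in Ioc 0 t, ‖q s‖ : ℝ) : ℂ) ^ n =
        ((∫ t in Ioc 0 x, ‖q t‖ * (∫ s in Ioc 0 t, ‖q s‖) ^ n : ℝ) : ℂ) := by
      rw [← integral_complex_ofReal]
      simp
    rw [e] at h
    simp only [Ioc_self, Measure.restrict_empty, integral_zero_measure, Complex.ofReal_zero] at h
    rw [zero_pow (Nat.succ_ne_zero n), zero_add] at h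
    exact_mod_cast h.symm
  rw [← h2]
  field_simp

/-- The kernel `(exp(2iζ(t - x)) - 1) / (2iζ)` of the Volterra equation for `exp(-ixζ) θ(x, ζ)`. -/
def jostKernel (ζ : ℂ) (x t : ℝ) : ℂ :=
  (Complex.exp (2 * Complex.I * ζ * (t - x)) - 1) / (2 * Complex.I * ζ)

lemma norm_exp_le_one {ζ : ℂ} (hζ : 0 < ζ.im) {s : ℝ} (hs : 0 ≤ s) :
    ‖Complex.exp (2 * Complex.I * ζ * s)‖ ≤ 1 := by
  rw [Complex.norm_exp, Real.exp_le_one_iff]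
  have : (2 * Complex.I * ζ * s).re = -(2 * (ζ.im * s)) := by simp; ring
  rw [this]
  have := mul_nonneg hζ.le hs
  linarith

lemma norm_jostKernel_le {ζ : ℂ} (hζ : 0 < ζ.im) {x t : ℝ} (h : x ≤ t) :
    ‖jostKernel ζ x t‖ ≤ 1 / ‖ζ‖ := by
  have h0 : 0 < ‖ζ‖ := norm_pos_iff.2 fun h => by simp [h] at hζ
  have h1 := norm_exp_le_one hζ (sub_nonneg.2 h)
  push_cast at h1
  rw [jostKernel, norm_div, div_le_div_iff₀ (by simpa using h0) h0]
  have h2 := norm_sub_le (Complex.exp (2 * Complex.I * ζ * (t - x))) 1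
  simp only [norm_mul, Complex.norm_ofNat, Complex.norm_I, norm_one] at h2 ⊢
  nlinarith

lemma continuous_jostKernel (ζ : ℂ) : Continuous (Function.uncurry (jostKernel ζ)) := by
  unfold jostKernel Function.uncurry
  fun_prop

lemma ne_zero_of_im_pos {ζ : ℂ} (hζ : 0 < ζ.im) : ζ ≠ 0 := fun h => by simp [h] at hζ

/-- `exp(-ixζ) θ(x, ζ)` for the Jost solution `θ`. -/
def jostM (v : ℝ → ℝ) (ζ : ℂ) : ℝ → ℂ :=
  volterraSol (fun x => Ioi x) (jostKernel ζ) (fun t => (v t : ℂ)) (fun _ => 1)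

/-- The derivative of `jostM`. -/
def jostM' (v : ℝ → ℝ) (ζ : ℂ) (x : ℝ) : ℂ :=
  -∫ t in Ioi x, Complex.exp (2 * Complex.I * ζ * (t - x)) * (v t * jostM v ζ t)

/-- The Jost solution, constructed from the Volterra equation. -/
def jostTheta (v : ℝ → ℝ) (ζ : ℂ) (x : ℝ) : ℂ := Complex.exp (Complex.I * ζ * x) * jostM v ζ x

/-- The derivative of `jostTheta`. -/
def jostTheta' (v : ℝ → ℝ) (ζ : ℂ) (x : ℝ) : ℂ :=
  Complex.exp (Complex.I * ζ * x) * (Complex.I * ζ * jostM v ζ x + jostM' v ζ x)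

section Jost

variable {v : ℝ → ℝ}

lemma norm_jostM_le (hv : IntegrableOn v (Ioi 0)) {ζ : ℂ} (hζ : 0 < ζ.im) {x : ℝ} (hx : 0 ≤ x) :
    ‖jostM v ζ x‖ ≤ Real.exp (1 / ‖ζ‖ * ∫ t in Ioi (0 : ℝ), |v t|) := by
  have := (isVolterra_Ioi (q := fun t => (v t : ℂ)) hv.ofReal).norm_sol_le (g := fun _ => 1) (C := 1)
    (fun x t _ ht => norm_jostKernel_le hζ (le_of_lt ht)) (by positivity) (by simp) hx
  simpa [jostM] using this

lemma integrableOn_mul_jostM (hv : IntegrableOn v (Ioi 0)) {ζ : ℂ} (hζ : 0 < ζ.im) :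
    IntegrableOn (fun t => v t * jostM v ζ t) (Ioi 0) :=
  (isVolterra_Ioi (q := fun t => (v t : ℂ)) hv.ofReal).integrableOn_mul_sol
    (fun x t _ ht => norm_jostKernel_le hζ (le_of_lt ht)) (by positivity) (C := 1) (by simp)
    (continuous_jostKernel ζ) continuousOn_const

lemma jostM_eq (hv : IntegrableOn v (Ioi 0)) {ζ : ℂ} (hζ : 0 < ζ.im) {x : ℝ} (hx : 0 ≤ x) :
    jostM v ζ x = 1 + ∫ t in Ioi x, jostKernel ζ x t * (v t * jostM v ζ t) :=
  (isVolterra_Ioi (q := fun t => (v t : ℂ)) hv.ofReal).sol_eq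
    (fun x t _ ht => norm_jostKernel_le hζ (le_of_lt ht)) (by positivity) (C := 1) (by simp)
    (continuous_jostKernel ζ) continuousOn_const hx

lemma integral_abs_mul_jostM_le (hv : IntegrableOn v (Ioi 0)) {ζ : ℂ} (hζ : 0 < ζ.im) {x : ℝ}
    (hx : 0 ≤ x) {M : ℝ} {k : ℝ → ℂ} (hM : 0 ≤ M) (hk : ∀ t, x < t → ‖k t‖ ≤ M) :
    ‖∫ t in Ioi x, k t * (v t * jostM v ζ t)‖ ≤
      M * Real.exp (1 / ‖ζ‖ * ∫ t in Ioi (0 : ℝ), |v t|) * ∫ t in Ioi x, |v t| := by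
  rw [← integral_const_mul]
  refine norm_integral_le_of_norm_le
    ((hv.mono_set (Ioi_subset_Ioi hx)).abs.const_mul _) ?_
  refine (ae_restrict_iff' measurableSet_Ioi).2 (Eventually.of_forall fun t ht => ?_)
  have h1 := norm_jostM_le hv hζ (hx.trans (le_of_lt ht))
  have h2 := hk t ht
  rw [norm_mul, norm_mul, Complex.norm_real, Real.norm_eq_abs]
  calc ‖k t‖ * (|v t| * ‖jostM v ζ t‖)
      ≤ M * (|v t| * Real.exp (1 / ‖ζ‖ * ∫ t in Ioi (0 : ℝ), |v t|)) := by gcongr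
    _ = _ := by ring

lemma norm_jostM_sub_one_le (hv : IntegrableOn v (Ioi 0)) {ζ : ℂ} (hζ : 0 < ζ.im) {x : ℝ}
    (hx : 0 ≤ x) : ‖jostM v ζ x - 1‖ ≤
      1 / ‖ζ‖ * Real.exp (1 / ‖ζ‖ * ∫ t in Ioi (0 : ℝ), |v t|) * ∫ t in Ioi x, |v t| := by
  rw [jostM_eq hv hζ hx, add_sub_cancel_left]
  exact integral_abs_mul_jostM_le hv hζ hx (by positivity)
    fun t ht => norm_jostKernel_le hζ (le_of_lt ht)

lemma norm_jostM'_le (hv : IntegrableOn v (Ioi 0)) {ζ : ℂ} (hζ : 0 < ζ.im) {x : ℝ}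
    (hx : 0 ≤ x) : ‖jostM' v ζ x‖ ≤
      Real.exp (1 / ‖ζ‖ * ∫ t in Ioi (0 : ℝ), |v t|) * ∫ t in Ioi x, |v t| := by
  rw [jostM', norm_neg]
  have := integral_abs_mul_jostM_le hv hζ hx (k := fun t => Complex.exp (2 * Complex.I * ζ * (t - x)))
    zero_le_one fun t ht => by
      have := norm_exp_le_one hζ (sub_nonneg.2 (le_of_lt ht))
      push_cast at this
      exact this
  simpa using this

lemma isSchrodingerSol_jostTheta (hv : IntegrableOn v (Ioi 0)) {ζ : ℂ} (hζ : 0 < ζ.im) :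
    IsSchrodingerSol v (ζ ^ 2) (jostTheta v ζ) (jostTheta' v ζ) := by
  -- the Volterra equation is the variation of constants formula with data at infinity
  have hζ0 := ne_zero_of_im_pos hζ
  set c : ℂ := 1 / (2 * Complex.I * ζ) with hc
  have hi := integrableOn_mul_jostM hv hζ
  have hi2 : IntegrableOn (fun t : ℝ => Complex.exp (2 * Complex.I * ζ * t) * (v t * jostM v ζ t))
      (Ioi 0) := by
    refine Integrable.bdd_mul (c := 1) hi (by fun_prop) ?_
    exact (ae_restrict_iff' measurableSet_Ioi).2 (Eventually.of_forall fun t ht =>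
      norm_exp_le_one hζ (le_of_lt ht))
  have hA := (HasACDeriv.const 1).sub ((HasACDeriv.integral_Ioi hi).const_mul c)
  have hB := (HasACDeriv.integral_Ioi hi2).const_mul c
  have hshift : ∀ x : ℝ, ∫ t in Ioi x, Complex.exp (2 * Complex.I * ζ * (t - x)) *
      (v t * jostM v ζ t) = Complex.exp (-(2 * Complex.I * ζ * x)) *
        ∫ t in Ioi x, Complex.exp (2 * Complex.I * ζ * t) * (v t * jostM v ζ t) := by
    intro x
    rw [← integral_const_mul]
    congr 1
    funext t
    have : Complex.exp (2 * Complex.I * ζ * (t - x)) = Complex.exp (-(2 * Complex.I * ζ * x)) *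
        Complex.exp (2 * Complex.I * ζ * t) := by
      rw [← Complex.exp_add]
      ring_nf
    rw [this, mul_assoc]
  have hm : ∀ x, 0 ≤ x → jostM v ζ x = (1 - c * ∫ t in Ioi x, v t * jostM v ζ t) +
      Complex.exp (-(2 * Complex.I * ζ * x)) *
        (c * ∫ t in Ioi x, Complex.exp (2 * Complex.I * ζ * t) * (v t * jostM v ζ t)) := by
    intro x hx
    have e : ∫ t in Ioi x, jostKernel ζ x t * (v t * jostM v ζ t) =
        c * ((∫ t in Ioi x, Complex.exp (2 * Complex.I * ζ * (t - x)) * (v t * jostM v ζ t)) -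
          ∫ t in Ioi x, v t * jostM v ζ t) := by
      rw [← integral_sub, ← integral_const_mul]
      · congr 1
        funext t
        rw [jostKernel, hc]
        ring
      · have := (hi2.mono_set (Ioi_subset_Ioi hx)).const_mul (Complex.exp (-(2 * Complex.I * ζ * x)))
        refine this.congr (Eventually.of_forall fun t => ?_)
        simp only
        rw [← mul_assoc, ← Complex.exp_add]
        ring_nf
      · exact hi.mono_set (Ioi_subset_Ioi hx)
    rw [jostM_eq hv hζ hx, e, hshift]
    ring
  have he : ∀ x : ℝ, Complex.exp (Complex.I * ζ * x) * Complex.exp (-(2 * Complex.I * ζ * x)) =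
      Complex.exp (-(Complex.I * ζ) * x) := fun x => by
    rw [← Complex.exp_add]
    ring_nf
  have he2 : ∀ x : ℝ, Complex.exp (-(Complex.I * ζ) * x) * Complex.exp (2 * Complex.I * ζ * x) =
      Complex.exp (Complex.I * ζ * x) := fun x => by
    rw [← Complex.exp_add]
    ring_nf
  refine isSchrodingerSol_of_variation hζ0 hA hB (fun x hx => ?_) (fun x hx => ?_) (fun x hx => ?_)
    fun x hx => ?_
  · rw [jostTheta, hm x hx, ← he]
    ring
  · have e : 2 * (Complex.I * ζ) * c = 1 := by rw [hc]; field_simp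
    rw [jostTheta', jostM', hshift, hm x hx, ← he]
    linear_combination (Complex.exp (Complex.I * ζ * x) * Complex.exp (-(2 * Complex.I * ζ * x)) *
      ∫ t in Ioi x, Complex.exp (2 * Complex.I * ζ * t) * (v t * jostM v ζ t)) * e
  · rw [jostTheta, hc]
    ring
  · rw [jostTheta, hc, ← he2]
    ring

/-- The functions of the Jost solution are holomorphic in the spectral parameter. -/
lemma differentiableOn_jostM (hv : IntegrableOn v (Ioi 0)) {x : ℝ} (hx : 0 ≤ x) :
    DifferentiableOn ℂ (fun ζ => jostM v ζ x) {ζ | 0 < ζ.im} := by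
  intro ζ hζ
  have hζ' : 0 < ζ.im := hζ
  have hU : IsOpen {η : ℂ | ζ.im / 2 < η.im} := isOpen_lt continuous_const Complex.continuous_im
  have h := (isVolterra_Ioi (q := fun t => (v t : ℂ)) hv.ofReal).differentiableOn_sol hU
    (k := jostKernel) (M := 1 / (ζ.im / 2)) (C := 1) (g := fun _ => 1)
    (fun η hη x t _ ht => by
      have hη' : ζ.im / 2 < η.im := hη
      have h0 : 0 < η.im := by linarith
      refine (norm_jostKernel_le h0 (le_of_lt ht)).trans ?_
      have := (le_abs_self _).trans (Complex.abs_im_le_norm η)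
      exact one_div_le_one_div_of_le (by linarith) (by linarith))
    (by positivity) (by simp) (fun η _ => continuous_jostKernel η)
    (fun x t η hη => by
      have hη' : ζ.im / 2 < η.im := hη
      have h0 : η ≠ 0 := ne_zero_of_im_pos (by linarith)
      unfold jostKernel
      refine DifferentiableAt.differentiableWithinAt ?_
      refine DifferentiableAt.div (by fun_prop) (by fun_prop) ?_
      simp [h0])
    continuousOn_const hx
  have hmem : {η : ℂ | ζ.im / 2 < η.im} ∈ 𝓝 ζ := hU.mem_nhds (by
    show ζ.im / 2 < ζ.im
    linarith)
  exact (h.differentiableAt hmem).differentiableWithinAt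

lemma differentiableOn_jostM' (hv : IntegrableOn v (Ioi 0)) {x : ℝ} (hx : 0 ≤ x) :
    DifferentiableOn ℂ (fun ζ => jostM' v ζ x) {ζ | 0 < ζ.im} := by
  intro ζ hζ
  have hζ' : 0 < ζ.im := hζ
  have hU : IsOpen {η : ℂ | ζ.im / 2 < η.im} := isOpen_lt continuous_const Complex.continuous_im
  have hpos : ∀ η ∈ {η : ℂ | ζ.im / 2 < η.im}, 0 < η.im := fun η hη => by
    have : ζ.im / 2 < η.im := hη
    linarith
  have h := differentiableOn_integral_of_dominated (μ := volume.restrict (Ioi x)) hU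
    (F := fun ζ t => Complex.exp (2 * Complex.I * ζ * (t - x)) * (v t * jostM v ζ t))
    (bound := fun t => |v t| * Real.exp (1 / (ζ.im / 2) * ∫ t in Ioi (0 : ℝ), |v t|))
    (fun η hη => by
      have := ((integrableOn_mul_jostM hv (hpos η hη)).mono_set
        (Ioi_subset_Ioi hx)).aestronglyMeasurable
      exact AEStronglyMeasurable.mul (by fun_prop) this)
    ((ae_restrict_iff' measurableSet_Ioi).2 (Eventually.of_forall fun t ht => by
      have := (differentiableOn_jostM hv (hx.trans (le_of_lt ht))).mono hpos
      exact DifferentiableOn.mul (by fun_prop) (this.const_mul _)))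
    ((ae_restrict_iff' measurableSet_Ioi).2 (Eventually.of_forall fun t ht η hη => by
      have hη' : ζ.im / 2 < η.im := hη
      have h1 := norm_exp_le_one (hpos η hη) (sub_nonneg.2 (le_of_lt ht))
      push_cast at h1
      have h2 := norm_jostM_le hv (hpos η hη) (hx.trans (le_of_lt ht))
      have h3 : 1 / ‖η‖ ≤ 1 / (ζ.im / 2) := by
        have := (le_abs_self _).trans (Complex.abs_im_le_norm η)
        exact one_div_le_one_div_of_le (by linarith) (by linarith)
      have h4 : 0 ≤ ∫ t in Ioi (0 : ℝ), |v t| := integral_nonneg fun _ => abs_nonneg _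
      rw [norm_mul, norm_mul, Complex.norm_real, Real.norm_eq_abs]
      calc _ ≤ 1 * (|v t| * Real.exp (1 / ‖η‖ * ∫ t in Ioi (0 : ℝ), |v t|)) := by gcongr
        _ ≤ _ := by
          rw [one_mul]
          gcongr))
    ((hv.mono_set (Ioi_subset_Ioi hx)).abs.mul_const _)
  have hmem : {η : ℂ | ζ.im / 2 < η.im} ∈ 𝓝 ζ := hU.mem_nhds (by
    show ζ.im / 2 < ζ.im
    linarith)
  exact (h.neg.differentiableAt hmem).differentiableWithinAt

lemma tendsto_integral_Ioi_abs (v : ℝ → ℝ) :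
    Tendsto (fun x => ∫ t in Ioi x, |v t|) atTop (𝓝 0) :=
  tendsto_integral_Ioi_zero tendsto_id

lemma tendsto_jostM (hv : IntegrableOn v (Ioi 0)) {ζ : ℂ} (hζ : 0 < ζ.im) :
    Tendsto (jostM v ζ) atTop (𝓝 1) := by
  rw [tendsto_iff_norm_sub_tendsto_zero]
  refine squeeze_zero' (Eventually.of_forall fun _ => norm_nonneg _) ?_
    (by simpa only [mul_zero] using (tendsto_integral_Ioi_abs v).const_mul (1 / ‖ζ‖ *
      Real.exp (1 / ‖ζ‖ * ∫ t in Ioi (0 : ℝ), |v t|)))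
  filter_upwards [eventually_ge_atTop 0] with x hx using norm_jostM_sub_one_le hv hζ hx

lemma tendsto_jostM' (hv : IntegrableOn v (Ioi 0)) {ζ : ℂ} (hζ : 0 < ζ.im) :
    Tendsto (jostM' v ζ) atTop (𝓝 0) := by
  rw [tendsto_zero_iff_norm_tendsto_zero]
  refine squeeze_zero' (Eventually.of_forall fun _ => norm_nonneg _) ?_
    (by simpa only [mul_zero] using (tendsto_integral_Ioi_abs v).const_mul (Real.exp
      (1 / ‖ζ‖ * ∫ t in Ioi (0 : ℝ), |v t|)))
  filter_upwards [eventually_ge_atTop 0] with x hx using norm_jostM'_le hv hζ hx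

/-- A sequence of holomorphic functions that tends to zero uniformly near a point has derivatives
that tend to zero there. -/
lemma tendsto_deriv_zero_of_bound {ι : Type*} {l : Filter ι} {f : ι → ℂ → ℂ} {c : ℂ} {r : ℝ}
    (hr : 0 < r) {b : ι → ℝ} (hf : ∀ᶠ i in l, DifferentiableOn ℂ (f i) (Metric.closedBall c r))
    (hb : ∀ᶠ i in l, ∀ z ∈ Metric.closedBall c r, ‖f i z‖ ≤ b i) (hl : Tendsto b l (𝓝 0)) :
    Tendsto (fun i => deriv (f i) c) l (𝓝 0) := by
  rw [tendsto_zero_iff_norm_tendsto_zero]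
  refine squeeze_zero' (Eventually.of_forall fun _ => norm_nonneg _) ?_
    (by simpa using hl.div_const r)
  filter_upwards [hf, hb] with i hi hbi
  refine Complex.norm_deriv_le_of_forall_mem_sphere_norm_le hr ?_ fun z hz =>
    hbi z (Metric.sphere_subset_closedBall hz)
  exact DifferentiableOn.diffContOnCl (hi.mono Metric.closure_ball_subset_closedBall)

lemma half_im_le_of_mem_closedBall {ζ η : ℂ}
    (hη : η ∈ Metric.closedBall ζ (ζ.im / 2)) : ζ.im / 2 ≤ η.im := by
  rw [Metric.mem_closedBall, dist_eq_norm] at hη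
  have h := (abs_le.1 ((Complex.abs_im_le_norm (η - ζ)).trans hη)).1
  rw [Complex.sub_im] at h
  linarith

lemma tendsto_deriv_jostM (hv : IntegrableOn v (Ioi 0)) {ζ : ℂ} (hζ : 0 < ζ.im) :
    Tendsto (fun x => deriv (fun η => jostM v η x) ζ) atTop (𝓝 0) := by
  have h4 : 0 ≤ ∫ t in Ioi (0 : ℝ), |v t| := integral_nonneg fun _ => abs_nonneg _
  have key := tendsto_deriv_zero_of_bound (l := atTop) (f := fun x η => jostM v η x - 1)
    (c := ζ) (half_pos hζ) (b := fun x => 1 / (ζ.im / 2) *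
      Real.exp (1 / (ζ.im / 2) * ∫ t in Ioi (0 : ℝ), |v t|) * ∫ t in Ioi x, |v t|) (by
    filter_upwards [eventually_ge_atTop 0] with x hx
    exact ((differentiableOn_jostM hv hx).mono fun η hη =>
      (half_pos hζ).trans_le (half_im_le_of_mem_closedBall hη)).sub_const 1) (by
    filter_upwards [eventually_ge_atTop 0] with x hx η hη
    have hη' := half_im_le_of_mem_closedBall hη
    have h0 : 0 < η.im := (half_pos hζ).trans_le hη'
    refine (norm_jostM_sub_one_le hv h0 hx).trans ?_
    have h3 : 1 / ‖η‖ ≤ 1 / (ζ.im / 2) := by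
      have := (le_abs_self _).trans (Complex.abs_im_le_norm η)
      exact one_div_le_one_div_of_le (by linarith) (by linarith)
    have h5 : 0 ≤ ∫ t in Ioi x, |v t| := integral_nonneg fun _ => abs_nonneg _
    gcongr) (by simpa using (tendsto_integral_Ioi_abs v).const_mul _)
  simpa using key

lemma tendsto_deriv_jostM' (hv : IntegrableOn v (Ioi 0)) {ζ : ℂ} (hζ : 0 < ζ.im) :
    Tendsto (fun x => deriv (fun η => jostM' v η x) ζ) atTop (𝓝 0) := by
  have h4 : 0 ≤ ∫ t in Ioi (0 : ℝ), |v t| := integral_nonneg fun _ => abs_nonneg _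
  refine tendsto_deriv_zero_of_bound (l := atTop) (f := fun x η => jostM' v η x)
    (c := ζ) (half_pos hζ) (b := fun x =>
      Real.exp (1 / (ζ.im / 2) * ∫ t in Ioi (0 : ℝ), |v t|) * ∫ t in Ioi x, |v t|) (by
    filter_upwards [eventually_ge_atTop 0] with x hx
    exact ((differentiableOn_jostM' hv hx).mono fun η hη =>
      (half_pos hζ).trans_le (half_im_le_of_mem_closedBall hη))) (by
    filter_upwards [eventually_ge_atTop 0] with x hx η hη
    have hη' := half_im_le_of_mem_closedBall hη
    have h0 : 0 < η.im := (half_pos hζ).trans_le hη'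
    refine (norm_jostM'_le hv h0 hx).trans ?_
    have h3 : 1 / ‖η‖ ≤ 1 / (ζ.im / 2) := by
      have := (le_abs_self _).trans (Complex.abs_im_le_norm η)
      exact one_div_le_one_div_of_le (by linarith) (by linarith)
    have h5 : 0 ≤ ∫ t in Ioi x, |v t| := integral_nonneg fun _ => abs_nonneg _
    gcongr) (by simpa using (tendsto_integral_Ioi_abs v).const_mul _)

end Jost

/-! ### Regular solutions, and uniqueness of the Jost solution -/

lemma norm_exp_I_mul (ζ : ℂ) (x : ℝ) :
    ‖Complex.exp (Complex.I * ζ * x)‖ = Real.exp (-(ζ.im * x)) := by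
  rw [Complex.norm_exp]
  congr 1
  simp

lemma norm_exp_neg_I_mul (ζ : ℂ) (x : ℝ) :
    ‖Complex.exp (-(Complex.I * ζ) * x)‖ = Real.exp (ζ.im * x) := by
  rw [Complex.norm_exp]
  congr 1
  simp

section Convolution

variable {ζ : ℂ} {w : ℝ → ℂ}

lemma norm_integral_exp_mul_le (hζ : 0 < ζ.im) (hw : IntegrableOn w (Ioi 0)) {x : ℝ} (hx : 0 ≤ x) :
    ‖∫ t in (0 : ℝ)..x, Complex.exp (2 * Complex.I * ζ * (x - t)) * w t‖ ≤
      ∫ t in Ioi (0 : ℝ), ‖w t‖ := by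
  rw [intervalIntegral.integral_of_le hx]
  refine (norm_integral_le_of_norm_le (g := fun t => ‖w t‖)
    (hw.mono_set Ioc_subset_Ioi_self).norm ?_).trans
    (setIntegral_mono_set hw.norm (Eventually.of_forall fun _ => norm_nonneg _)
      Ioc_subset_Ioi_self.eventuallyLE)
  refine (ae_restrict_iff' measurableSet_Ioc).2 (Eventually.of_forall fun t ht => ?_)
  have := norm_exp_le_one hζ (sub_nonneg.2 ht.2)
  push_cast at this
  rw [norm_mul]
  exact mul_le_of_le_one_left (norm_nonneg _) this

lemma tendsto_exp_two_I_mul (hζ : 0 < ζ.im) (c : ℝ) :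
    Tendsto (fun x : ℝ => Complex.exp (2 * Complex.I * ζ * (x - c))) atTop (𝓝 0) := by
  rw [tendsto_zero_iff_norm_tendsto_zero]
  have : ∀ x : ℝ, ‖Complex.exp (2 * Complex.I * ζ * (x - c))‖ =
      Real.exp (-(2 * ζ.im * (x - c))) := by
    intro x
    rw [Complex.norm_exp]
    congr 1
    simp
  simp only [this]
  refine Real.tendsto_exp_neg_atTop_nhds_zero.comp ?_
  exact Tendsto.const_mul_atTop (by positivity) (tendsto_atTop_add_const_right _ (-c) tendsto_id)

/-- Convolution of an integrable function with a decaying exponential tends to zero. -/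
lemma tendsto_integral_exp_mul (hζ : 0 < ζ.im) (hw : IntegrableOn w (Ioi 0)) :
    Tendsto (fun x : ℝ => ∫ t in (0 : ℝ)..x, Complex.exp (2 * Complex.I * ζ * (x - t)) * w t) atTop
      (𝓝 0) := by
  have h1 : Tendsto (fun x : ℝ => ∫ t in Ioi (0 : ℝ), (Ioc 0 x).indicator
      (fun t : ℝ => Complex.exp (2 * Complex.I * ζ * (x - t)) * w t) t) atTop
      (𝓝 (∫ _ in Ioi (0 : ℝ), (0 : ℂ))) := by
    refine tendsto_integral_filter_of_dominated_convergence (fun t => ‖w t‖) ?_ ?_ hw.norm ?_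
    · refine Eventually.of_forall fun x => AEStronglyMeasurable.indicator ?_ measurableSet_Ioc
      exact AEStronglyMeasurable.mul (by fun_prop) hw.aestronglyMeasurable
    · refine Eventually.of_forall fun x => Eventually.of_forall fun t => ?_
      by_cases ht : t ∈ Ioc 0 x
      · rw [indicator_of_mem ht, norm_mul]
        have := norm_exp_le_one hζ (sub_nonneg.2 ht.2)
        push_cast at this
        exact mul_le_of_le_one_left (norm_nonneg _) this
      · rw [indicator_of_notMem ht]
        simp
    · refine (ae_restrict_iff' measurableSet_Ioi).2 (Eventually.of_forall fun t ht => ?_)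
      have h2 := (tendsto_exp_two_I_mul hζ t).mul_const (w t)
      rw [zero_mul] at h2
      refine h2.congr' ?_
      filter_upwards [eventually_ge_atTop t] with x hx
      rw [indicator_of_mem (show t ∈ Ioc 0 x from ⟨ht, hx⟩)]
  rw [integral_zero] at h1
  refine h1.congr' ?_
  filter_upwards [eventually_ge_atTop 0] with x hx
  rw [integral_indicator measurableSet_Ioc, Measure.restrict_restrict measurableSet_Ioc,
    inter_eq_left.2 Ioc_subset_Ioi_self, intervalIntegral.integral_of_le hx]

end Convolution

/-- The solution with given Cauchy data at `0` exists, grows at most like `exp(-ixζ)`, and is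
asymptotically a multiple of it. -/
lemma exists_regularSol {v : ℝ → ℝ} (hv : IntegrableOn v (Ioi 0)) {ζ : ℂ} (hζ : 0 < ζ.im)
    (α β : ℂ) : ∃ y p : ℝ → ℂ, IsSchrodingerSol v (ζ ^ 2) y p ∧ y 0 = α ∧ p 0 = β ∧
      (∃ C, ∀ x, 0 ≤ x → ‖y x‖ ≤ C * Real.exp (ζ.im * x) ∧ ‖p x‖ ≤ C * Real.exp (ζ.im * x)) ∧
      Tendsto (fun x : ℝ => Complex.exp (Complex.I * ζ * x) * (p x + Complex.I * ζ * y x)) atTop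
        (𝓝 0) := by
  have hζ0 := ne_zero_of_im_pos hζ
  set c : ℂ := 1 / (2 * Complex.I * ζ) with hc
  -- the free solution with these Cauchy data is `a₀ exp(iζx) + b₀ exp(-iζx)`
  set a₀ : ℂ := (α + β / (Complex.I * ζ)) / 2 with ha₀
  set b₀ : ℂ := (α - β / (Complex.I * ζ)) / 2 with hb₀
  set g : ℝ → ℂ := fun x => b₀ + Complex.exp (2 * Complex.I * ζ * x) * a₀ with hg
  -- `n = exp(iζx) y` solves a Volterra equation with bounded kernel
  set n : ℝ → ℂ := volterraSol (fun x => Ioc 0 x) (fun x t => jostKernel ζ t x)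
    (fun t => (v t : ℂ)) g with hn
  have hV := isVolterra_Ioc (q := fun t => (v t : ℂ)) hv.ofReal
  have hk : ∀ x t : ℝ, 0 ≤ x → t ∈ Ioc 0 x → ‖jostKernel ζ t x‖ ≤ 1 / ‖ζ‖ := fun x t _ ht =>
    norm_jostKernel_le hζ ht.2
  have hM : 0 ≤ 1 / ‖ζ‖ := by positivity
  have hgb : ∀ x, 0 ≤ x → ‖g x‖ ≤ ‖b₀‖ + ‖a₀‖ := by
    intro x hx
    refine (norm_add_le _ _).trans ?_
    rw [norm_mul]
    gcongr
    exact mul_le_of_le_one_left (norm_nonneg _) (norm_exp_le_one hζ hx)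
  have hkc : Continuous (Function.uncurry fun x t => jostKernel ζ t x) :=
    (continuous_jostKernel ζ).comp continuous_swap
  have hgc : ContinuousOn g (Ici 0) := by rw [hg]; fun_prop
  set w : ℝ → ℂ := fun t => v t * n t with hw
  have hwi : IntegrableOn w (Ioi 0) := hV.integrableOn_mul_sol hk hM hgb hkc hgc
  obtain ⟨N, hN⟩ : ∃ N, ∀ x, 0 ≤ x → ‖n x‖ ≤ N := ⟨_, fun x hx => hV.norm_sol_le hk hM hgb hx⟩
  have hint : ∀ x, 0 ≤ x → IntervalIntegrable w volume 0 x :=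
    (HasACDeriv.of_integrableOn hwi 0).intervalIntegrable
  have hint2 : ∀ x, 0 ≤ x → IntervalIntegrable
      (fun t : ℝ => Complex.exp (-(2 * Complex.I * ζ * t)) * w t) volume 0 x := fun x hx =>
    (hint x hx).continuousOn_mul (by fun_prop)
  have hA := (HasACDeriv.const a₀).add ((HasACDeriv.of_intervalIntegrable hint2 0).const_mul c)
  have hB := (HasACDeriv.const b₀).sub ((HasACDeriv.of_intervalIntegrable hint 0).const_mul c)
  simp only [zero_add] at hA hB
  set A : ℝ → ℂ := fun x => a₀ + c * ∫ t in (0 : ℝ)..x, Complex.exp (-(2 * Complex.I * ζ * t)) * w t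
    with hAd
  set B : ℝ → ℂ := fun x => b₀ - c * ∫ t in (0 : ℝ)..x, w t with hBd
  have hEA : ∀ x : ℝ, Complex.exp (2 * Complex.I * ζ * x) * A x =
      Complex.exp (2 * Complex.I * ζ * x) * a₀ +
        c * ∫ t in (0 : ℝ)..x, Complex.exp (2 * Complex.I * ζ * (x - t)) * w t := by
    intro x
    have : ∀ t : ℝ, Complex.exp (2 * Complex.I * ζ * (x - t)) * w t =
        Complex.exp (2 * Complex.I * ζ * x) * (Complex.exp (-(2 * Complex.I * ζ * t)) * w t) := by
      intro t
      have : Complex.exp (2 * Complex.I * ζ * (x - t)) = Complex.exp (2 * Complex.I * ζ * x) *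
          Complex.exp (-(2 * Complex.I * ζ * t)) := by
        rw [← Complex.exp_add]
        ring_nf
      rw [this, mul_assoc]
    simp only [this, intervalIntegral.integral_const_mul, hAd]
    ring
  have hnAB : ∀ x, 0 ≤ x → n x = Complex.exp (2 * Complex.I * ζ * x) * A x + B x := by
    intro x hx
    rw [hEA, hn, hV.sol_eq hk hM hgb hkc hgc hx, ← hn, ← intervalIntegral.integral_of_le hx]
    have : ∀ t : ℝ, jostKernel ζ t x * (v t * n t) =
        c * (Complex.exp (2 * Complex.I * ζ * (x - t)) * w t) - c * w t := by
      intro t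
      rw [jostKernel, hw, hc]
      ring
    simp only [this]
    have hi : IntervalIntegrable (fun t : ℝ => Complex.exp (2 * Complex.I * ζ * (x - t)) * w t)
      volume 0 x := (hint x hx).continuousOn_mul (by fun_prop)
    rw [intervalIntegral.integral_sub (hi.const_mul c) ((hint x hx).const_mul c),
      intervalIntegral.integral_const_mul, intervalIntegral.integral_const_mul, hg, hBd]
    ring
  have hE : ∀ x : ℝ, Complex.exp (-(Complex.I * ζ) * x) * Complex.exp (2 * Complex.I * ζ * x) =
      Complex.exp (Complex.I * ζ * x) := fun x => by
    rw [← Complex.exp_add]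
    ring_nf
  have hE2 : ∀ x : ℝ, Complex.exp (Complex.I * ζ * x) * Complex.exp (-(2 * Complex.I * ζ * x)) =
      Complex.exp (-(Complex.I * ζ) * x) := fun x => by
    rw [← Complex.exp_add]
    ring_nf
  have hE3 : ∀ x : ℝ, Complex.exp (Complex.I * ζ * x) * Complex.exp (Complex.I * ζ * x) =
      Complex.exp (2 * Complex.I * ζ * x) := fun x => by
    rw [← Complex.exp_add]
    ring_nf
  have hAbd : ∀ x : ℝ, 0 ≤ x → ‖Complex.exp (2 * Complex.I * ζ * x) * A x‖ ≤
      ‖a₀‖ + ‖c‖ * ∫ t in Ioi (0 : ℝ), ‖w t‖ := by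
    intro x hx
    rw [hEA]
    refine (norm_add_le _ _).trans ?_
    rw [norm_mul, norm_mul]
    have := norm_integral_exp_mul_le hζ hwi hx
    gcongr
    exact mul_le_of_le_one_left (norm_nonneg _) (norm_exp_le_one hζ hx)
  set y : ℝ → ℂ := fun x => Complex.exp (-(Complex.I * ζ) * x) * n x with hy
  set p : ℝ → ℂ := fun x => Complex.I * ζ *
    (Complex.exp (Complex.I * ζ * x) * A x - Complex.exp (-(Complex.I * ζ) * x) * B x) with hp
  have hyAB : ∀ x, 0 ≤ x → y x =
      Complex.exp (Complex.I * ζ * x) * A x + Complex.exp (-(Complex.I * ζ) * x) * B x := by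
    intro x hx
    rw [hy, ← hE]
    simp only
    rw [hnAB x hx]
    ring
  have hpy : ∀ x, 0 ≤ x → p x = Complex.exp (-(Complex.I * ζ) * x) *
      (2 * (Complex.I * ζ) * (Complex.exp (2 * Complex.I * ζ * x) * A x)) - Complex.I * ζ * y x := by
    intro x hx
    rw [hyAB x hx, hp]
    linear_combination -2 * (Complex.I * ζ) * A x * hE x
  refine ⟨y, p, isSchrodingerSol_of_variation hζ0 hA hB hyAB (fun _ _ => rfl) (fun x hx => ?_)
    (fun x hx => ?_), ?_, ?_, ?_, ?_⟩
  · have := hE2 x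
    rw [hy, hw, hc]
    simp only
    rw [← this]
    ring
  · rw [hy, hw, hc]
    ring
  · rw [hyAB 0 le_rfl]
    simp [hAd, hBd, ha₀, hb₀]
    ring
  · simp [hp, hAd, hBd, ha₀, hb₀]
    field_simp
    ring
  · set D := ‖a₀‖ + ‖c‖ * ∫ t in Ioi (0 : ℝ), ‖w t‖
    have hN0 : 0 ≤ N := (norm_nonneg _).trans (hN 0 le_rfl)
    have hD0 : 0 ≤ D := (norm_nonneg _).trans (hAbd 0 le_rfl)
    have hyb : ∀ x, 0 ≤ x → ‖y x‖ ≤ N * Real.exp (ζ.im * x) := by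
      intro x hx
      rw [hy]
      simp only
      rw [norm_mul, norm_exp_neg_I_mul, mul_comm]
      gcongr
      exact hN x hx
    refine ⟨N + 2 * ‖ζ‖ * D + ‖ζ‖ * N, fun x hx => ⟨(hyb x hx).trans ?_, ?_⟩⟩
    · gcongr
      have : 0 ≤ 2 * ‖ζ‖ * D + ‖ζ‖ * N := by positivity
      linarith
    · rw [hpy x hx]
      refine (norm_sub_le _ _).trans ?_
      have h1 := hyb x hx
      have h2 := hAbd x hx
      have h3 := Real.exp_pos (ζ.im * x)
      generalize Complex.exp (2 * Complex.I * ζ * x) * A x = X at h2 ⊢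
      have e1 : ‖Complex.exp (-(Complex.I * ζ) * x) * (2 * (Complex.I * ζ) * X)‖ =
          Real.exp (ζ.im * x) * (2 * ‖ζ‖ * ‖X‖) := by
        rw [norm_mul, norm_exp_neg_I_mul]
        simp
      have e2 : ‖Complex.I * ζ * y x‖ = ‖ζ‖ * ‖y x‖ := by simp
      rw [e1, e2]
      calc Real.exp (ζ.im * x) * (2 * ‖ζ‖ * ‖X‖) + ‖ζ‖ * ‖y x‖
          ≤ Real.exp (ζ.im * x) * (2 * ‖ζ‖ * D) + ‖ζ‖ * (N * Real.exp (ζ.im * x)) := by gcongr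
        _ ≤ _ := by nlinarith [mul_nonneg hN0 h3.le]
  · have h1 : Tendsto (fun x : ℝ => 2 * (Complex.I * ζ) *
        (Complex.exp (2 * Complex.I * ζ * x) * A x)) atTop (𝓝 0) := by
      have h2 := ((tendsto_exp_two_I_mul hζ 0).mul_const a₀).add
        ((tendsto_integral_exp_mul hζ hwi).const_mul c)
      simp only [Complex.ofReal_zero, sub_zero, zero_mul, mul_zero, add_zero] at h2
      simpa [hEA] using h2.const_mul (2 * (Complex.I * ζ))
    refine h1.congr' ?_
    filter_upwards [eventually_ge_atTop 0] with x hx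
    rw [hyAB x hx, hp, ← hE3]
    have : Complex.exp (Complex.I * ζ * x) * Complex.exp (-(Complex.I * ζ) * x) = 1 := by
      rw [← Complex.exp_add]
      ring_nf
      exact Complex.exp_zero
    ring

/-- A solution is determined by its Cauchy data. -/
lemma IsSchrodingerSol.eq_of_initial {v : ℝ → ℝ} (hv : IntegrableOn v (Ioi 0)) {ζ : ℂ}
    (hζ : 0 < ζ.im) {y₁ p₁ y₂ p₂ : ℝ → ℂ} (h₁ : IsSchrodingerSol v (ζ ^ 2) y₁ p₁)
    (h₂ : IsSchrodingerSol v (ζ ^ 2) y₂ p₂) (hy : y₁ 0 = y₂ 0) (hp : p₁ 0 = p₂ 0) {x : ℝ}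
    (hx : 0 ≤ x) : y₁ x = y₂ x ∧ p₁ x = p₂ x := by
  obtain ⟨c, c', hc, hc0, hc0', -⟩ := exists_regularSol hv hζ 1 0
  obtain ⟨s, s', hs, hs0, hs0', -⟩ := exists_regularSol hv hζ 0 1
  have h := hc.wronskian_const hs hx
  have a₁ := h₁.wronskian_const hc hx
  have a₂ := h₂.wronskian_const hc hx
  have b₁ := h₁.wronskian_const hs hx
  have b₂ := h₂.wronskian_const hs hx
  rw [hc0, hc0', hs0, hs0'] at h
  rw [hy, hp, ← a₂] at a₁
  rw [hy, hp, ← b₂] at b₁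
  constructor
  · linear_combination c x * b₁ - s x * a₁ - (y₁ x - y₂ x) * h
  · linear_combination c' x * b₁ - s' x * a₁ - (p₁ x - p₂ x) * h

lemma tendsto_exp_I_mul {ζ : ℂ} (hζ : 0 < ζ.im) :
    Tendsto (fun x : ℝ => Complex.exp (Complex.I * ζ * x)) atTop (𝓝 0) := by
  rw [tendsto_zero_iff_norm_tendsto_zero]
  simp only [norm_exp_I_mul]
  exact Real.tendsto_exp_neg_atTop_nhds_zero.comp (tendsto_id.const_mul_atTop hζ)

/-- A function with the asymptotics of a Jost solution that is continuous on `[0, ∞)` decays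
exponentially. -/
lemma exists_norm_le_of_asymptotics {ζ : ℂ} {θ : ℝ → ℂ} (hc : ContinuousOn θ (Ici 0))
    {L : ℂ} (h : Tendsto (fun x : ℝ => θ x / Complex.exp (Complex.I * x * ζ)) atTop (𝓝 L)) :
    ∃ C, ∀ x, 0 ≤ x → ‖θ x‖ ≤ C * Real.exp (-(ζ.im * x)) := by
  obtain ⟨X, hX⟩ := (h.norm.eventually_lt_const (lt_add_one ‖L‖)).exists_forall_of_atTop
  obtain ⟨D, hD⟩ := (isCompact_Icc (a := (0 : ℝ)) (b := X)).exists_bound_of_continuousOn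
    (f := fun x : ℝ => θ x / Complex.exp (Complex.I * x * ζ)) (by
      refine (hc.mono Icc_subset_Ici_self).div (by fun_prop) fun x _ => Complex.exp_ne_zero _)
  refine ⟨max D (‖L‖ + 1), fun x hx => ?_⟩
  have key : ‖θ x / Complex.exp (Complex.I * x * ζ)‖ ≤ max D (‖L‖ + 1) := by
    rcases le_total x X with h1 | h1
    · exact (hD x ⟨hx, h1⟩).trans (le_max_left _ _)
    · exact (hX x h1).le.trans (le_max_right _ _)
  rw [norm_div, show Complex.I * x * ζ = Complex.I * ζ * x by ring, norm_exp_I_mul,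
    div_le_iff₀ (Real.exp_pos _)] at key
  exact key

lemma integrableOn_of_norm_le_exp {a C : ℝ} (ha : 0 < a) {f : ℝ → ℂ} (hc : ContinuousOn f (Ici 0))
    (h : ∀ x, 0 ≤ x → ‖f x‖ ≤ C * Real.exp (-(a * x))) : IntegrableOn f (Ioi 0) := by
  have h1 : IntegrableOn (fun x : ℝ => C * Real.exp (-(a * x))) (Ioi 0) := by
    simpa only [neg_mul] using! (exp_neg_integrableOn_Ioi 0 ha).const_mul C
  refine h1.mono' ((hc.mono Ioi_subset_Ici_self).aestronglyMeasurable measurableSet_Ioi) ?_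
  exact (ae_restrict_iff' measurableSet_Ioi).2 (Eventually.of_forall fun x hx => h x (le_of_lt hx))

lemma tendsto_jostTheta_div {v : ℝ → ℝ} (hv : IntegrableOn v (Ioi 0)) {ζ : ℂ} (hζ : 0 < ζ.im) :
    Tendsto (fun x : ℝ => jostTheta v ζ x / Complex.exp (Complex.I * x * ζ)) atTop (𝓝 1) := by
  refine (tendsto_jostM hv hζ).congr fun x => ?_
  rw [jostTheta, show Complex.I * x * ζ = Complex.I * ζ * x by ring]
  field_simp [Complex.exp_ne_zero]

lemma isJostSolution_jostTheta {v : ℝ → ℝ} (hv : IntegrableOn v (Ioi 0)) {ζ : ℂ} (hζ : 0 < ζ.im) :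
    IsJostSolution v ζ (jostTheta v ζ) := by
  have h := isSchrodingerSol_jostTheta hv hζ
  have hd : ∀ x, 0 ≤ x → HasDerivWithinAt (jostTheta v ζ) (jostTheta' v ζ x) (Ici 0) x := fun x hx =>
    h.left.hasDerivWithinAt h.right.continuousOn hx
  have hdw : ∀ x, 0 ≤ x → derivWithin (jostTheta v ζ) (Ici 0) x = jostTheta' v ζ x := fun x hx =>
    (hd x hx).derivWithin (uniqueDiffOn_Ici 0 x hx)
  refine ⟨fun x hx => (hd x hx).differentiableWithinAt, fun x hx => ?_, tendsto_jostTheta_div hv hζ⟩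
  rw [hdw x hx, hdw 0 le_rfl]
  exact h.right.eq x hx

lemma IsJostSolution.isSchrodingerSol {v : ℝ → ℝ} (hv : IntegrableOn v (Ioi 0)) {ζ : ℂ}
    {θ : ℝ → ℂ} (h : IsJostSolution v ζ θ) :
    IsSchrodingerSol v (ζ ^ 2) θ (derivWithin θ (Ici 0)) := by
  have hc := h.differentiableOn.continuousOn
  have hr : HasACDeriv (derivWithin θ (Ici 0)) (fun t => ((v t : ℂ) - ζ ^ 2) * θ t) := by
    refine ⟨fun x hx => ?_, h.eqn⟩
    refine IntervalIntegrable.mul_continuousOn ?_ (hc.mono (by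
      rw [uIcc_of_le hx]; exact Icc_subset_Ici_self))
    refine IntervalIntegrable.sub ?_ (by simp)
    exact (HasACDeriv.of_integrableOn (f := fun t => (v t : ℂ)) hv.ofReal 0).intervalIntegrable x hx
  refine ⟨⟨fun x hx => ?_, fun x hx => ?_⟩, hr⟩
  · exact (hr.continuousOn.mono (by rw [uIcc_of_le hx]; exact Icc_subset_Ici_self)).intervalIntegrable
  · rw [intervalIntegral.integral_eq_sub_of_hasDerivAt_of_le hx (hc.mono Icc_subset_Ici_self)]
    · ring
    · intro t ht
      have h1 := (h.differentiableOn t (le_of_lt ht.1)).hasDerivWithinAt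
      exact h1.hasDerivAt (Ici_mem_nhds ht.1)
    · exact (hr.continuousOn.mono (by
        rw [uIcc_of_le hx]; exact Icc_subset_Ici_self)).intervalIntegrable

/-- The Cauchy data of the Jost solution do not vanish. -/
lemma jostTheta_ne_zero_or {v : ℝ → ℝ} (hv : IntegrableOn v (Ioi 0)) {ζ : ℂ} (hζ : 0 < ζ.im) :
    jostTheta v ζ 0 ≠ 0 ∨ jostTheta' v ζ 0 ≠ 0 := by
  by_contra! hcon
  have h := isSchrodingerSol_jostTheta hv hζ
  have h0 := h.const_mul 0
  have h1 : ∀ x, 0 ≤ x → jostTheta v ζ x = 0 := fun x hx => by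
    have := (h.eq_of_initial hv hζ h0 (by simp [hcon.1]) (by simp [hcon.2]) hx).1
    simpa using this
  have h2 := tendsto_jostTheta_div hv hζ
  have h3 : Tendsto (fun x : ℝ => jostTheta v ζ x / Complex.exp (Complex.I * x * ζ)) atTop (𝓝 0) := by
    refine tendsto_const_nhds.congr' ?_
    filter_upwards [eventually_ge_atTop 0] with x hx
    rw [h1 x hx, zero_div]
  exact one_ne_zero (tendsto_nhds_unique h2 h3)

/-- Uniqueness of the Jost solution. A second solution with the same asymptotics has vanishing
Wronskian with the first, because its derivative is bounded; hence it is a multiple of the first. -/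
lemma IsJostSolution.eq_jostTheta {v : ℝ → ℝ} (hv : IntegrableOn v (Ioi 0)) {ζ : ℂ}
    (hζ : 0 < ζ.im) {θ : ℝ → ℂ} (h : IsJostSolution v ζ θ) {x : ℝ} (hx : 0 ≤ x) :
    θ x = jostTheta v ζ x ∧ derivWithin θ (Ici 0) x = jostTheta' v ζ x := by
  have hs := h.isSchrodingerSol hv
  have hJ := isSchrodingerSol_jostTheta hv hζ
  -- the limits at infinity
  have hbound : ∀ {f f' : ℝ → ℂ}, IsSchrodingerSol v (ζ ^ 2) f f' →
      Tendsto (fun x : ℝ => f x / Complex.exp (Complex.I * x * ζ)) atTop (𝓝 1) →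
      Tendsto f atTop (𝓝 0) ∧ ∃ L, Tendsto f' atTop (𝓝 L) := by
    intro f f' hf hlim
    obtain ⟨C, hC⟩ := exists_norm_le_of_asymptotics hf.left.continuousOn hlim
    have hfi := integrableOn_of_norm_le_exp hζ hf.left.continuousOn hC
    have hC0 : 0 ≤ C := by simpa using (norm_nonneg _).trans (hC 0 le_rfl)
    constructor
    · have h1 := hlim.mul (tendsto_exp_I_mul hζ)
      rw [mul_zero] at h1
      refine h1.congr fun x => ?_
      rw [show Complex.I * x * ζ = Complex.I * ζ * x by ring]
      field_simp [Complex.exp_ne_zero]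
    · refine ⟨_, hf.right.tendsto ?_⟩
      simp only [sub_mul]
      refine Integrable.sub ?_ (hfi.const_mul _)
      refine Integrable.mul_bdd (c := C) hv.ofReal hfi.aestronglyMeasurable ?_
      refine (ae_restrict_iff' measurableSet_Ioi).2 (Eventually.of_forall fun t ht => ?_)
      refine (hC t (le_of_lt ht)).trans ?_
      have : Real.exp (-(ζ.im * t)) ≤ 1 := by
        rw [Real.exp_le_one_iff]
        have := mul_nonneg hζ.le (le_of_lt ht)
        linarith
      exact mul_le_of_le_one_right hC0 this
  obtain ⟨l₁, L₁, m₁⟩ := hbound hs h.asymptotics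
  obtain ⟨l₂, L₂, m₂⟩ := hbound hJ (tendsto_jostTheta_div hv hζ)
  have hW : θ 0 * jostTheta' v ζ 0 - derivWithin θ (Ici 0) 0 * jostTheta v ζ 0 = 0 := by
    have h1 := (l₁.mul m₂).sub (m₁.mul l₂)
    rw [zero_mul, mul_zero, sub_zero] at h1
    refine tendsto_nhds_unique (tendsto_const_nhds.congr' ?_) h1
    filter_upwards [eventually_ge_atTop 0] with t ht using (hs.wronskian_const hJ ht).symm
  obtain ⟨κ, hκ, hκ'⟩ : ∃ κ, θ 0 = κ * jostTheta v ζ 0 ∧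
      derivWithin θ (Ici 0) 0 = κ * jostTheta' v ζ 0 := by
    rcases jostTheta_ne_zero_or hv hζ with h0 | h0
    · refine ⟨θ 0 / jostTheta v ζ 0, by field_simp, ?_⟩
      field_simp
      linear_combination -hW
    · refine ⟨derivWithin θ (Ici 0) 0 / jostTheta' v ζ 0, ?_, by field_simp⟩
      field_simp
      linear_combination hW
  have hmul : ∀ t, 0 ≤ t → θ t = κ * jostTheta v ζ t ∧
      derivWithin θ (Ici 0) t = κ * jostTheta' v ζ t := fun t ht =>
    hs.eq_of_initial hv hζ (hJ.const_mul κ) hκ hκ' ht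
  have hκ1 : κ = 1 := by
    have h1 := (tendsto_jostTheta_div hv hζ).const_mul κ
    rw [mul_one] at h1
    refine tendsto_nhds_unique (h1.congr' ?_) h.asymptotics
    filter_upwards [eventually_ge_atTop 0] with t ht
    rw [(hmul t ht).1, mul_div_assoc]
  simpa [hκ1] using hmul x hx

section JostFunction

variable {v : ℝ → ℝ} {ζ : ℂ}

lemma isJostSolution_jostSolution (hv : IntegrableOn v (Ioi 0)) (hζ : 0 < ζ.im) :
    IsJostSolution v ζ (jostSolution v ζ) := by
  have h : ∃ θ : ℝ → ℂ, IsJostSolution v ζ θ := ⟨_, isJostSolution_jostTheta hv hζ⟩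
  rw [jostSolution, dif_pos h]
  exact h.choose_spec

lemma jostFunction_eq (hv : IntegrableOn v (Ioi 0)) (hζ : 0 < ζ.im) :
    jostFunction v ζ = jostTheta v ζ 0 :=
  ((isJostSolution_jostSolution hv hζ).eq_jostTheta hv hζ le_rfl).1

lemma derivWithin_jostSolution_eq (hv : IntegrableOn v (Ioi 0)) (hζ : 0 < ζ.im) :
    derivWithin (jostSolution v ζ) (Ici 0) 0 = jostTheta' v ζ 0 :=
  ((isJostSolution_jostSolution hv hζ).eq_jostTheta hv hζ le_rfl).2

end JostFunction

/-! ### Sobolev functions on the half-line and on the star graph -/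

lemma ae_halfLine_of_forall {P : ℝ → Prop} (h : ∀ x, 0 < x → P x) : ∀ᵐ x ∂μ₀, P x :=
  (ae_restrict_iff' measurableSet_Ioi).2 (Eventually.of_forall fun x hx => h x hx)

lemma HasACDeriv.aestronglyMeasurable {F f : ℝ → ℂ} (h : HasACDeriv F f) :
    AEStronglyMeasurable F μ₀ :=
  (h.continuousOn.mono Ioi_subset_Ici_self).aestronglyMeasurable measurableSet_Ioi

lemma IsHalfLineH1.hasACDeriv {φ : ℝ → ℂ} (h : IsHalfLineH1 φ) : HasACDeriv φ (deriv φ) := by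
  refine ⟨fun x hx => ?_, h.eq_integral⟩
  rw [intervalIntegrable_iff_integrableOn_Ioc_of_le hx]
  exact (h.memLp_deriv.mono_measure (Measure.restrict_mono Ioc_subset_Ioi_self le_rfl)).integrable
    (by norm_num)

lemma HasACDeriv.isHalfLineH1 {u w : ℝ → ℂ} (h : HasACDeriv u w) (hu : MemLp u 2 μ₀)
    (hw : MemLp w 2 μ₀) : IsHalfLineH1 u :=
  ⟨hu, (memLp_congr_ae h.deriv_ae_eq).2 hw,
    (h.congr (fun _ _ => rfl) h.deriv_ae_eq.symm).eq⟩

lemma memLp_conj {u : ℝ → ℂ} (hu : MemLp u 2 μ₀) : MemLp (fun x => conj (u x)) 2 μ₀ :=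
  hu.star

lemma HasACDeriv.integrable_sq_deriv {u w : ℝ → ℂ} (hu : MemLp u 2 μ₀) (hw : MemLp w 2 μ₀) :
    IntegrableOn (fun x => w x * conj (u x) + u x * conj (w x)) (Ioi 0) :=
  (hw.integrable_mul (memLp_conj hu)).add (hu.integrable_mul (memLp_conj hw))

/-- An `H¹` function on the half-line is bounded. -/
lemma HasACDeriv.exists_bound {u w : ℝ → ℂ} (h : HasACDeriv u w) (hu : MemLp u 2 μ₀)
    (hw : MemLp w 2 μ₀) : ∃ C, 0 ≤ C ∧ ∀ x, 0 ≤ x → ‖u x‖ ≤ C := by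
  have h1 := h.mul h.complex_conj
  have hi := HasACDeriv.integrable_sq_deriv hu hw
  have h0 := h1.tendsto_zero hi (hu.integrable_mul (memLp_conj hu))
  refine ⟨√(∫ t in Ioi (0 : ℝ), ‖w t * conj (u t) + u t * conj (w t)‖), Real.sqrt_nonneg _,
    fun x hx => Real.le_sqrt_of_sq_le ?_⟩
  have h2 := h1.setIntegral_Ioi hi h0 hx
  calc ‖u x‖ ^ 2 = ‖-(u x * conj (u x))‖ := by simp [sq]
    _ = ‖∫ t in Ioi x, (w t * conj (u t) + u t * conj (w t))‖ := by rw [h2]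
    _ ≤ ∫ t in Ioi x, ‖w t * conj (u t) + u t * conj (w t)‖ := norm_integral_le_integral_norm _
    _ ≤ _ := setIntegral_mono_set hi.norm (Eventually.of_forall fun _ => norm_nonneg _)
      (Ioi_subset_Ioi hx).eventuallyLE

/-- Products of an integrable potential with `H¹` functions are integrable. -/
lemma integrableOn_potential_mul {v : ℝ → ℝ} (hv : IntegrableOn v (Ioi 0)) {u φ : ℝ → ℂ} {C D : ℝ}
    (hu : AEStronglyMeasurable u μ₀) (hφ : AEStronglyMeasurable φ μ₀)
    (hC : ∀ x, 0 ≤ x → ‖u x‖ ≤ C) (hD : ∀ x, 0 ≤ x → ‖φ x‖ ≤ D) :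
    IntegrableOn (fun x => (v x : ℂ) * u x * φ x) (Ioi 0) := by
  have h1 : IntegrableOn (fun x => (v x : ℂ) * u x) (Ioi 0) :=
    Integrable.mul_bdd (c := C) hv.ofReal hu (ae_halfLine_of_forall fun x hx => hC x hx.le)
  exact Integrable.mul_bdd (c := D) h1 hφ (ae_halfLine_of_forall fun x hx => hD x hx.le)

/-- The weak form of `-u'' + v u - z u = f` on one edge, by integration by parts. -/
lemma weak_form_edge {v : ℝ → ℝ} (hv : IntegrableOn v (Ioi 0)) {z : ℂ} {u w f φ φ' : ℝ → ℂ}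
    (hu : HasACDeriv u w) (hw : HasACDeriv w (fun t => ((v t : ℂ) - z) * u t - f t))
    (hu2 : MemLp u 2 μ₀) (hw2 : MemLp w 2 μ₀) (hf2 : MemLp f 2 μ₀)
    (hφ : HasACDeriv φ φ') (hφ2 : MemLp φ 2 μ₀) (hφ'2 : MemLp φ' 2 μ₀) :
    (∫ x in Ioi (0 : ℝ), w x * φ' x) + ∫ x in Ioi (0 : ℝ), (v x : ℂ) * u x * φ x =
      (∫ x in Ioi (0 : ℝ), (f x + z * u x) * φ x) - w 0 * φ 0 := by
  obtain ⟨C, -, hC⟩ := hu.exists_bound hu2 hw2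
  obtain ⟨D, -, hD⟩ := hφ.exists_bound hφ2 hφ'2
  have i1 : IntegrableOn (fun x => (v x : ℂ) * u x * φ x) (Ioi 0) :=
    integrableOn_potential_mul hv hu.aestronglyMeasurable hφ.aestronglyMeasurable hC hD
  have i2 : IntegrableOn (fun x => w x * φ' x) (Ioi 0) := hw2.integrable_mul hφ'2
  have i3 : IntegrableOn (fun x => (f x + z * u x) * φ x) (Ioi 0) :=
    (hf2.add (hu2.const_mul z)).integrable_mul hφ2
  have h := hw.mul hφ
  have hi : IntegrableOn (fun t => (((v t : ℂ) - z) * u t - f t) * φ t + w t * φ' t) (Ioi 0) := by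
    refine ((i1.add i2).sub i3).congr (Eventually.of_forall fun t => ?_)
    simp only [Pi.add_apply, Pi.sub_apply]
    ring
  have h0 := h.tendsto_zero hi (hw2.integrable_mul hφ2)
  have h1 := h.setIntegral_Ioi hi h0 le_rfl
  have h2 : ∫ t in Ioi (0 : ℝ), ((((v t : ℂ) - z) * u t - f t) * φ t + w t * φ' t) =
      ((∫ x in Ioi (0 : ℝ), w x * φ' x) + ∫ x in Ioi (0 : ℝ), (v x : ℂ) * u x * φ x) -
        ∫ x in Ioi (0 : ℝ), (f x + z * u x) * φ x := by
    have i12 : IntegrableOn (fun x => w x * φ' x + (v x : ℂ) * u x * φ x) (Ioi 0) := i2.add i1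
    rw [← integral_add i2 i1, ← integral_sub i12 i3]
    congr 1
    funext t
    ring
  linear_combination h1 - h2

section Star

variable {n : ℕ} {V : Fin n → ℝ → ℝ}

/-- Weak form on the star graph, for a function satisfying the equation on the edges and the
Kirchhoff condition at the vertex. -/
lemma starForm_eq_of_sol (hV : ∀ j, IntegrableOn (V j) (Ioi 0)) {z : ℂ} {u w f : Fin n → ℝ → ℂ}
    (hu : ∀ j, HasACDeriv (u j) (w j))
    (hw : ∀ j, HasACDeriv (w j) (fun t => ((V j t : ℂ) - z) * u j t - f j t))
    (hu2 : ∀ j, MemLp (u j) 2 μ₀) (hw2 : ∀ j, MemLp (w j) 2 μ₀) (hf2 : ∀ j, MemLp (f j) 2 μ₀)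
    (hK : ∑ j, w j 0 = 0) {φ : Fin n → ℝ → ℂ} (hφ : IsStarH1 φ) :
    starForm V u φ = ∑ j, ∫ x in Ioi (0 : ℝ), (f j x + z * u j x) * conj (φ j x) := by
  have key : ∀ j, (∫ x in Ioi (0 : ℝ), deriv (u j) x * conj (deriv (φ j) x)) +
      ∫ x in Ioi (0 : ℝ), (V j x : ℂ) * u j x * conj (φ j x) =
      (∫ x in Ioi (0 : ℝ), (f j x + z * u j x) * conj (φ j x)) - w j 0 * conj (φ j 0) := by
    intro j
    rw [← weak_form_edge (hV j) (hu j) (hw j) (hu2 j) (hw2 j) (hf2 j)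
      (hφ.edge j).hasACDeriv.complex_conj (memLp_conj (hφ.edge j).memLp)
      (memLp_conj (hφ.edge j).memLp_deriv)]
    congr 1
    refine integral_congr_ae ?_
    filter_upwards [(hu j).deriv_ae_eq] with x hx
    rw [hx]
  rw [starForm, Finset.sum_congr rfl fun j _ => key j, Finset.sum_sub_distrib]
  suffices h : ∑ j, w j 0 * conj (φ j 0) = 0 by rw [h, sub_zero]
  rcases isEmpty_or_nonempty (Fin n) with h | ⟨⟨k⟩⟩
  · simp
  · rw [Finset.sum_congr rfl fun j _ => by rw [hφ.vertex j k], ← Finset.sum_mul, hK, zero_mul]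

/-- The element of `L²(Γ)` with given square integrable components. -/
def starToLp (u : Fin n → ℝ → ℂ) (h : ∀ j, MemLp (u j) 2 μ₀) : StarL2 n :=
  WithLp.toLp 2 fun j => (h j).toLp (u j)

lemma starToLp_ae (u : Fin n → ℝ → ℂ) (h : ∀ j, MemLp (u j) 2 μ₀) (j : Fin n) :
    starToLp u h j =ᵐ[μ₀] u j :=
  (h j).coeFn_toLp

/-- The bilinear pairing `∫_Γ f g`. -/
def starPairing (f g : StarL2 n) : ℂ := ∑ j, ∫ x in Ioi (0 : ℝ), f j x * g j x

/-- The complex conjugation on `L²(Γ)`. -/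
def starConj (f : StarL2 n) : StarL2 n :=
  starToLp (fun j x => conj (f j x)) fun j => memLp_conj (Lp.memLp (f j))

lemma starConj_ae (f : StarL2 n) (j : Fin n) :
    starConj f j =ᵐ[μ₀] fun x => conj (f j x) :=
  starToLp_ae _ _ j

lemma star_inner_eq (f g : StarL2 n) :
    inner ℂ f g = ∑ j, ∫ x in Ioi (0 : ℝ), g j x * conj (f j x) := by
  rw [PiLp.inner_apply]
  refine Finset.sum_congr rfl fun j _ => ?_
  rw [L2.inner_def]
  rfl

lemma starPairing_eq_inner (f g : StarL2 n) : starPairing f g = inner ℂ (starConj f) g := by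
  rw [star_inner_eq, starPairing]
  refine Finset.sum_congr rfl fun j _ => integral_congr_ae ?_
  filter_upwards [starConj_ae f j] with x hx
  rw [hx, Complex.conj_conj, mul_comm]

lemma starPairing_comm (f g : StarL2 n) : starPairing f g = starPairing g f := by
  simp only [starPairing, mul_comm]

lemma starConj_conj (f : StarL2 n) : starConj (starConj f) = f := by
  ext j
  filter_upwards [starConj_ae (starConj f) j, starConj_ae f j] with x h1 h2
  rw [h1, h2, Complex.conj_conj]

lemma starPairing_add_left (f f' g : StarL2 n) :
    starPairing (f + f') g = starPairing f g + starPairing f' g := by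
  rw [starPairing_comm, starPairing_eq_inner, inner_add_right, ← starPairing_eq_inner,
    ← starPairing_eq_inner, starPairing_comm g, starPairing_comm g]

lemma starPairing_smul_left (c : ℂ) (f g : StarL2 n) :
    starPairing (c • f) g = c * starPairing f g := by
  rw [starPairing_comm, starPairing_eq_inner, inner_smul_right, ← starPairing_eq_inner,
    starPairing_comm g]

lemma continuous_starPairing_left (g : StarL2 n) : Continuous fun f => starPairing f g := by
  have : (fun f => starPairing f g) = fun f => inner ℂ (starConj g) f := by
    funext f
    rw [starPairing_comm, starPairing_eq_inner]
  rw [this]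
  fun_prop

/-- The bilinear pairing is nondegenerate. -/
lemma eq_of_starPairing_eq {u u' : StarL2 n} (h : ∀ g, starPairing u g = starPairing u' g) :
    u = u' := by
  refine ext_inner_left ℂ fun g => ?_
  have := h (starConj g)
  rwa [starPairing_comm, starPairing_comm u', starPairing_eq_inner, starPairing_eq_inner,
    starConj_conj] at this

lemma IsStarH1.complex_conj {φ : Fin n → ℝ → ℂ} (h : IsStarH1 φ) :
    IsStarH1 fun j x => conj (φ j x) := by
  refine ⟨fun j => ?_, fun j k => by rw [h.vertex j k]⟩
  exact (h.edge j).hasACDeriv.complex_conj.isHalfLineH1 (memLp_conj (h.edge j).memLp)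
    (memLp_conj (h.edge j).memLp_deriv)

lemma deriv_complex_conj (φ : ℝ → ℂ) (x : ℝ) :
    deriv (fun x => conj (φ x)) x = conj (deriv φ x) :=
  deriv.star

/-- The form is symmetric as a bilinear form, the potential being real. -/
lemma starForm_conj_comm (ψ φ : Fin n → ℝ → ℂ) :
    starForm V ψ (fun j x => conj (φ j x)) = starForm V φ (fun j x => conj (ψ j x)) := by
  simp only [starForm, deriv_complex_conj, Complex.conj_conj]
  refine Finset.sum_congr rfl fun j _ => ?_
  congr 2 <;> funext x <;> ring

/-- Green's formula: the operator is symmetric with respect to the bilinear pairing. -/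
lemma starPairing_symm {u f w g : StarL2 n} (h₁ : (u, f) ∈ starSchrodinger V)
    (h₂ : (w, g) ∈ starSchrodinger V) : starPairing f w = starPairing u g := by
  obtain ⟨ψ, hψ, hu, h₁⟩ := h₁
  obtain ⟨φ, hφ, hw, h₂⟩ := h₂
  have e₁ := h₁ _ hφ.complex_conj
  have e₂ := h₂ _ hψ.complex_conj
  rw [starForm_conj_comm, e₂] at e₁
  simp only [Complex.conj_conj] at e₁
  rw [starPairing, starPairing]
  have a₁ : ∀ j, ∫ x in Ioi (0 : ℝ), f j x * w j x = ∫ x in Ioi (0 : ℝ), f j x * φ j x := fun j =>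
    integral_congr_ae (by
      filter_upwards [hw j] with x hx
      rw [hx])
  have a₂ : ∀ j, ∫ x in Ioi (0 : ℝ), u j x * g j x = ∫ x in Ioi (0 : ℝ), g j x * ψ j x := fun j =>
    integral_congr_ae (by
      filter_upwards [hu j] with x hx
      rw [hx, mul_comm])
  simp only [a₁, a₂]
  exact e₁.symm

/-- If `(H - z) u = f` is solvable for every `f`, then `z` is in the resolvent set. Uniqueness of
the solution and boundedness of the solution operator follow from the symmetry of the operator. -/
lemma mem_opResolventSet_of_solvable {z : ℂ}
    (h : ∀ f : StarL2 n, ∃ u, (u, f + z • u) ∈ starSchrodinger V) :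
    z ∈ opResolventSet (starSchrodinger V) := by
  choose R hR using h
  have hsymm : ∀ {f u : StarL2 n} (_ : (u, f + z • u) ∈ starSchrodinger V) (g : StarL2 n),
      starPairing u g = starPairing f (R g) := by
    intro f u hu g
    have := starPairing_symm hu (hR g)
    rw [starPairing_add_left, starPairing_smul_left, starPairing_comm u (g + _),
      starPairing_add_left, starPairing_smul_left, starPairing_comm _ u, starPairing_comm _ u] at this
    linear_combination -this
  let L : StarL2 n →ₗ[ℂ] StarL2 n :=
    { toFun := R
      map_add' := fun f f' => eq_of_starPairing_eq fun g => by
        rw [starPairing_add_left, hsymm (hR _), hsymm (hR _), hsymm (hR _), starPairing_add_left]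
      map_smul' := fun c f => eq_of_starPairing_eq fun g => by
        rw [RingHom.id_apply, starPairing_smul_left, hsymm (hR _), hsymm (hR _),
          starPairing_smul_left] }
  have hL : Continuous L := by
    refine L.continuous_of_seq_closed_graph fun s x y hx hy => ?_
    refine eq_of_starPairing_eq fun g => ?_
    have h1 := ((continuous_starPairing_left g).tendsto y).comp hy
    have h2 := ((continuous_starPairing_left (R g)).tendsto x).comp hx
    have h3 : ∀ i, ((fun f => starPairing f g) ∘ (L ∘ s)) i =
        ((fun f => starPairing f (R g)) ∘ s) i := fun i => hsymm (hR (s i)) g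
    exact (tendsto_nhds_unique h1 (h2.congr fun i => (h3 i).symm)).trans (hsymm (hR x) g).symm
  refine ⟨⟨L, hL⟩, fun f u => ⟨fun hu => hu ▸ hR f, fun hu => ?_⟩⟩
  exact eq_of_starPairing_eq fun g => (hsymm (hR f) g).trans (hsymm hu g).symm

lemma notMem_opResolventSet_of_eigenvector {E : Type*} [NormedAddCommGroup E]
    [InnerProductSpace ℂ E] {A : Set (E × E)} {z : ℂ} {u : E} (hu : u ≠ 0) (h : (u, z • u) ∈ A) :
    z ∉ opResolventSet A := by
  rintro ⟨R, hR⟩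
  have := (hR 0 u).2 (by simpa using h)
  rw [map_zero] at this
  exact hu this.symm

/-- Eigenvalues are real. -/
lemma im_eq_zero_of_eigenvector {z : ℂ} {u : StarL2 n} (hu : u ≠ 0)
    (h : (u, z • u) ∈ starSchrodinger V) : z.im = 0 := by
  obtain ⟨ψ, hψ, hae, h⟩ := h
  have e := h ψ hψ
  have h1 : ∑ j, ∫ x in Ioi (0 : ℝ), (z • u) j x * conj (ψ j x) = z * inner ℂ u u := by
    rw [← inner_smul_right, star_inner_eq]
    refine Finset.sum_congr rfl fun j _ => integral_congr_ae ?_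
    filter_upwards [hae j] with x hx
    rw [hx]
  have h2 : ∃ r : ℝ, starForm V ψ ψ = r := by
    refine ⟨∑ j, ((∫ x in Ioi (0 : ℝ), Complex.normSq (deriv (ψ j) x)) +
      ∫ x in Ioi (0 : ℝ), V j x * Complex.normSq (ψ j x)), ?_⟩
    rw [starForm, Complex.ofReal_sum]
    refine Finset.sum_congr rfl fun j _ => ?_
    rw [Complex.ofReal_add, ← integral_complex_ofReal, ← integral_complex_ofReal]
    congr 2 <;> funext x
    · rw [Complex.mul_conj]
    · rw [mul_assoc, Complex.mul_conj, Complex.ofReal_mul]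
  obtain ⟨r, hr⟩ := h2
  have h3 : (‖u‖ ^ 2 : ℝ) ≠ 0 := by simpa using hu
  rw [hr, h1, inner_self_eq_norm_sq_to_K] at e
  have h5 : (r : ℂ) = z * ((‖u‖ ^ 2 : ℝ) : ℂ) := by
    rw [e]
    simp
  have h4 := congrArg Complex.im h5
  rw [Complex.im_mul_ofReal, Complex.ofReal_im] at h4
  rcases mul_eq_zero.1 h4.symm with h6 | h6
  · exact h6
  · exact absurd h6 h3

end Star

/-! ### The characteristic function of the star graph and its eigenfunctions -/

section Algebra

variable {n : ℕ} (w p : Fin n → ℂ)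

/-- The product of all `w l` but one. -/
def cofactor (j : Fin n) : ℂ := ∏ l ∈ Finset.univ.erase j, w l

/-- The product of all `w l` but two. -/
def cofactor₂ (j k : Fin n) : ℂ := ∏ l ∈ (Finset.univ.erase j).erase k, w l

/-- `(∑ₖ pₖ / wₖ) ∏ₖ wₖ`, the edge `j` being left out of the sum and the product. -/
def cofactorSum (j : Fin n) : ℂ := ∑ k ∈ Finset.univ.erase j, cofactor₂ w j k * p k

/-- `(∑ⱼ pⱼ / wⱼ) ∏ⱼ wⱼ`, written without denominators. -/
def starDet : ℂ := ∑ j, p j * cofactor w j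

variable {w p}

lemma cofactor₂_comm (j k : Fin n) : cofactor₂ w j k = cofactor₂ w k j := by
  rw [cofactor₂, cofactor₂, Finset.erase_right_comm]

lemma cofactor₂_mul {j k : Fin n} (h : k ≠ j) : cofactor₂ w j k * w k = cofactor w j :=
  Finset.prod_erase_mul _ _ (by simp [h])

lemma cofactor_mul (j : Fin n) : cofactor w j * w j = ∏ k, w k :=
  Finset.prod_erase_mul _ _ (by simp)

/-- Expansion of `starDet` with respect to one edge. -/
lemma starDet_eq (j : Fin n) : starDet w p = cofactor w j * p j + cofactorSum w p j * w j := by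
  rw [starDet, ← Finset.add_sum_erase _ _ (Finset.mem_univ j), cofactorSum, Finset.sum_mul,
    mul_comm (p j)]
  congr 1
  refine Finset.sum_congr rfl fun k hk => ?_
  rw [← cofactor₂_mul (Finset.ne_of_mem_erase hk).symm, cofactor₂_comm]
  ring

/-- If `starDet` vanishes then the vertex conditions have a nontrivial solution. -/
lemma exists_vertex_solution (hn : 0 < n) (h0 : ∀ j, w j ≠ 0 ∨ p j ≠ 0) (h : starDet w p = 0) :
    ∃ c : Fin n → ℂ, c ≠ 0 ∧ (∀ j k, c j * w j = c k * w k) ∧ ∑ j, c j * p j = 0 := by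
  by_cases hw : ∀ j, w j ≠ 0
  · refine ⟨fun j => (w j)⁻¹, ?_, fun j k => by simp [hw], ?_⟩
    · intro hc
      exact inv_ne_zero (hw ⟨0, hn⟩) (congrFun hc ⟨0, hn⟩)
    · have hP : ∏ k, w k ≠ 0 := Finset.prod_ne_zero_iff.2 fun j _ => hw j
      have h1 : starDet w p = (∑ j, (w j)⁻¹ * p j) * ∏ k, w k := by
        rw [starDet, Finset.sum_mul]
        refine Finset.sum_congr rfl fun j _ => ?_
        rw [← cofactor_mul j]
        field_simp [hw j]
      rw [h1] at h
      exact (mul_eq_zero.1 h).resolve_right hP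
  · push Not at hw
    obtain ⟨j, hj⟩ := hw
    have hp : p j ≠ 0 := (h0 j).resolve_left fun h => h hj
    rw [starDet_eq j, hj, mul_zero, add_zero] at h
    obtain ⟨k, hk, hwk⟩ := Finset.prod_eq_zero_iff.1 ((mul_eq_zero.1 h).resolve_right hp)
    have hkj : k ≠ j := Finset.ne_of_mem_erase hk
    have hpk : p k ≠ 0 := (h0 k).resolve_left fun h => h hwk
    refine ⟨fun l => if l = j then p k else if l = k then -p j else 0, ?_, ?_, ?_⟩
    · intro hc
      have := congrFun hc j
      simp [hpk] at this
    · have : ∀ l, (if l = j then p k else if l = k then -p j else 0) * w l = 0 := by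
        intro l
        split_ifs with h1 h2
        · rw [h1, hj, mul_zero]
        · rw [h2, hwk, mul_zero]
        · rw [zero_mul]
      intro l m
      rw [this, this]
    · rw [← Finset.add_sum_erase _ _ (Finset.mem_univ j),
        ← Finset.add_sum_erase _ _ (Finset.mem_erase.2 ⟨hkj, Finset.mem_univ k⟩),
        Finset.sum_eq_zero]
      · simp [hkj]
        ring
      · intro l hl
        simp only [Finset.mem_erase] at hl
        simp [hl.1, hl.2.1]

end Algebra

lemma exists_norm_jostTheta_le {v : ℝ → ℝ} (hv : IntegrableOn v (Ioi 0)) {ζ : ℂ} (hζ : 0 < ζ.im) :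
    ∃ C, 0 ≤ C ∧ ∀ x, 0 ≤ x → ‖jostTheta v ζ x‖ ≤ C * Real.exp (-(ζ.im * x)) ∧
      ‖jostTheta' v ζ x‖ ≤ C * Real.exp (-(ζ.im * x)) := by
  have hs := isSchrodingerSol_jostTheta hv hζ
  obtain ⟨C, hC⟩ := exists_norm_le_of_asymptotics hs.left.continuousOn (tendsto_jostTheta_div hv hζ)
  have h1 : Tendsto (fun x : ℝ => jostTheta' v ζ x / Complex.exp (Complex.I * x * ζ)) atTop
      (𝓝 (Complex.I * ζ * 1 + 0)) := by
    refine (((tendsto_jostM hv hζ).const_mul (Complex.I * ζ)).add (tendsto_jostM' hv hζ)).congr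
      fun x => ?_
    rw [jostTheta', show Complex.I * x * ζ = Complex.I * ζ * x by ring]
    field_simp [Complex.exp_ne_zero]
  obtain ⟨D, hD⟩ := exists_norm_le_of_asymptotics hs.right.continuousOn h1
  refine ⟨max C D, ?_, fun x hx => ⟨(hC x hx).trans ?_, (hD x hx).trans ?_⟩⟩
  · refine le_max_of_le_left ?_
    simpa using (norm_nonneg _).trans (hC 0 le_rfl)
  · gcongr
    exact le_max_left _ _
  · gcongr
    exact le_max_right _ _

lemma memLp_of_norm_le_exp {a C : ℝ} (ha : 0 < a) {f : ℝ → ℂ} (hc : ContinuousOn f (Ici 0))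
    (h : ∀ x, 0 ≤ x → ‖f x‖ ≤ C * Real.exp (-(a * x))) : MemLp f 2 μ₀ := by
  have hm : AEStronglyMeasurable f μ₀ :=
    (hc.mono Ioi_subset_Ici_self).aestronglyMeasurable measurableSet_Ioi
  rw [memLp_two_iff_integrable_sq_norm hm]
  have h1 : IntegrableOn (fun x : ℝ => C ^ 2 * Real.exp (-(2 * a * x))) (Ioi 0) := by
    simpa only [neg_mul] using!
      (exp_neg_integrableOn_Ioi 0 (by positivity : 0 < 2 * a)).const_mul (C ^ 2)
  refine h1.mono' (hm.norm.pow 2) (ae_halfLine_of_forall fun x hx => ?_)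
  rw [Real.norm_of_nonneg (by positivity)]
  have h2 : Real.exp (-(2 * a * x)) = Real.exp (-(a * x)) ^ 2 := by
    rw [← Real.exp_nat_mul]
    congr 1
    push_cast
    ring
  rw [h2, ← mul_pow]
  exact pow_le_pow_left₀ (norm_nonneg _) (h x hx.le) 2

section Eigenfunction

variable {n : ℕ} {V : Fin n → ℝ → ℝ} {ζ : ℂ}

/-- `K(ζ) ∏ⱼ wⱼ(ζ)`, written without denominators. -/
def starChar (V : Fin n → ℝ → ℝ) (ζ : ℂ) : ℂ :=
  starDet (fun j => jostTheta (V j) ζ 0) (fun j => jostTheta' (V j) ζ 0)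

/-- A zero of the characteristic function gives an eigenfunction composed of Jost solutions. -/
lemma exists_eigenvector (hn : 0 < n) (hV : ∀ j, IntegrableOn (V j) (Ioi 0)) (hζ : 0 < ζ.im)
    (h : starChar V ζ = 0) : ∃ u : StarL2 n, u ≠ 0 ∧ (u, ζ ^ 2 • u) ∈ starSchrodinger V := by
  obtain ⟨c, hc, hw, hp⟩ := exists_vertex_solution hn
    (fun j => jostTheta_ne_zero_or (hV j) hζ) h
  have hs : ∀ j, IsSchrodingerSol (V j) (ζ ^ 2) (fun x => c j * jostTheta (V j) ζ x)
      (fun x => c j * jostTheta' (V j) ζ x) := fun j =>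
    (isSchrodingerSol_jostTheta (hV j) hζ).const_mul (c j)
  have hL : ∀ j, MemLp (jostTheta (V j) ζ) 2 μ₀ ∧ MemLp (jostTheta' (V j) ζ) 2 μ₀ := fun j => by
    obtain ⟨C, -, hC⟩ := exists_norm_jostTheta_le (hV j) hζ
    have hs := isSchrodingerSol_jostTheta (hV j) hζ
    exact ⟨memLp_of_norm_le_exp hζ hs.left.continuousOn fun x hx => (hC x hx).1,
      memLp_of_norm_le_exp hζ hs.right.continuousOn fun x hx => (hC x hx).2⟩
  have hu2 : ∀ j, MemLp (fun x => c j * jostTheta (V j) ζ x) 2 μ₀ := fun j => (hL j).1.const_mul _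
  have hw2 : ∀ j, MemLp (fun x => c j * jostTheta' (V j) ζ x) 2 μ₀ := fun j => (hL j).2.const_mul _
  have hae := starToLp_ae _ hu2
  refine ⟨starToLp _ hu2, ?_, fun j x => c j * jostTheta (V j) ζ x,
    ⟨fun j => (hs j).left.isHalfLineH1 (hu2 j) (hw2 j), hw⟩, hae, fun φ hφ => ?_⟩
  · intro h0
    obtain ⟨j, hj⟩ := Function.ne_iff.1 hc
    have h1 : ∀ᵐ x ∂μ₀, c j * jostTheta (V j) ζ x = 0 := by
      have h2 := hae j
      rw [h0] at h2
      filter_upwards [h2, Lp.coeFn_zero ℂ 2 μ₀] with x h3 h4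
      rw [← h3]
      exact h4
    have h2 : ∀ᶠ x : ℝ in atTop, jostTheta (V j) ζ x ≠ 0 := by
      filter_upwards [(tendsto_jostTheta_div (hV j) hζ).eventually_ne one_ne_zero] with x hx h3
      rw [h3, zero_div] at hx
      exact hx rfl
    obtain ⟨X, hX⟩ := (h2.and (eventually_ge_atTop 0)).exists_forall_of_atTop
    rw [ae_restrict_iff' measurableSet_Ioi, ae_iff] at h1
    have h3 : Ioi X ⊆ {x | ¬(x ∈ Ioi (0 : ℝ) → c j * jostTheta (V j) ζ x = 0)} := by
      intro x hx
      have hx' : X < x := hx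
      have h4 := hX X le_rfl
      simp only [mem_ofPred_eq, Classical.not_imp]
      exact ⟨lt_of_le_of_lt h4.2 hx', mul_ne_zero hj (hX x hx'.le).1⟩
    have h4 := measure_mono_null h3 h1
    simp at h4
  · rw [starForm_eq_of_sol hV (z := ζ ^ 2) (f := fun _ _ => 0) (fun j => (hs j).left)
      (fun j => (hs j).right.congr' (fun _ _ => rfl) fun x _ => by simp) hu2 hw2
      (fun _ => MemLp.zero') hp hφ]
    refine Finset.sum_congr rfl fun j _ => integral_congr_ae ?_
    filter_upwards [hae j, Lp.coeFn_smul (ζ ^ 2) (starToLp _ hu2 j)] with x h1 h2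
    have h3 : (ζ ^ 2 • starToLp _ hu2) j x = ζ ^ 2 • (starToLp _ hu2 j x) := h2
    rw [h3, h1, smul_eq_mul, zero_add]

/-- The characteristic function does not vanish at points of the resolvent set. -/
lemma starChar_ne_zero (hn : 0 < n) (hV : ∀ j, IntegrableOn (V j) (Ioi 0)) (hζ : 0 < ζ.im)
    (h : ζ ^ 2 ∈ opResolventSet (starSchrodinger V)) : starChar V ζ ≠ 0 := fun h0 => by
  obtain ⟨u, hu, hmem⟩ := exists_eigenvector hn hV hζ h0
  exact notMem_opResolventSet_of_eigenvector hu hmem h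

/-- The characteristic function does not vanish at nonreal energies. -/
lemma starChar_ne_zero_of_im (hn : 0 < n) (hV : ∀ j, IntegrableOn (V j) (Ioi 0)) (hζ : 0 < ζ.im)
    (h : (ζ ^ 2).im ≠ 0) : starChar V ζ ≠ 0 := fun h0 => by
  obtain ⟨u, hu, hmem⟩ := exists_eigenvector hn hV hζ h0
  exact h (im_eq_zero_of_eigenvector hu hmem)

/-- Jost functions do not vanish at nonreal energies: otherwise two copies of the edge would carry
an odd eigenfunction. -/
lemma jostTheta_zero_ne_zero {v : ℝ → ℝ} (hv : IntegrableOn v (Ioi 0)) (hζ : 0 < ζ.im)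
    (h : (ζ ^ 2).im ≠ 0) : jostTheta v ζ 0 ≠ 0 := fun h0 => by
  refine starChar_ne_zero_of_im (n := 2) (V := fun _ => v) (by norm_num) (fun _ => hv) hζ h ?_
  have h1 : ∀ j : Fin 2, cofactor (fun _ : Fin 2 => jostTheta v ζ 0) j = 0 := fun j => by
    refine Finset.prod_eq_zero (i := 1 - j) ?_ h0
    fin_cases j <;> simp
  simp [starChar, starDet, h1]

end Eigenfunction

/-! ### Green's function and the resolvent -/

lemma integrable_exp_neg_mul_abs {a : ℝ} (ha : 0 < a) :
    Integrable (fun s : ℝ => Real.exp (-(a * |s|))) := by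
  rw [← integrableOn_univ, ← Iic_union_Ioi (a := (0 : ℝ))]
  refine IntegrableOn.union ?_ ?_
  · refine (integrableOn_exp_mul_Iic ha 0).congr_fun (fun s hs => ?_) measurableSet_Iic
    simp only
    rw [abs_of_nonpos hs]
    ring_nf
  · refine (exp_neg_integrableOn_Ioi 0 ha).congr_fun (fun s hs => ?_) measurableSet_Ioi
    simp only
    rw [abs_of_pos hs]
    ring_nf

lemma norm_exp_neg_mul_abs_le {a : ℝ} (ha : 0 < a) (s : ℝ) : ‖Real.exp (-(a * |s|))‖ ≤ 1 := by
  rw [Real.norm_of_nonneg (Real.exp_pos _).le, Real.exp_le_one_iff]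
  have := mul_nonneg ha.le (abs_nonneg s)
  linarith

lemma integrableOn_exp_mul_norm {a : ℝ} (ha : 0 < a) {f : ℝ → ℂ} (hf : MemLp f 2 μ₀) (y : ℝ) :
    IntegrableOn (fun x => Real.exp (-(a * |x - y|)) * ‖f x‖) (Ioi 0) := by
  have hk : IntegrableOn (fun x : ℝ => Real.exp (-(a * |x - y|))) (Ioi 0) :=
    ((integrable_exp_neg_mul_abs ha).comp_sub_right y).integrableOn
  have hkf : IntegrableOn (fun x : ℝ => Real.exp (-(a * |x - y|)) * ‖f x‖ ^ 2) (Ioi 0) :=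
    Integrable.bdd_mul (c := 1) (hf.integrable_norm_pow two_ne_zero) (by fun_prop)
      (Eventually.of_forall fun x => norm_exp_neg_mul_abs_le ha _)
  refine (hk.add hkf).mono' (AEStronglyMeasurable.mul (by fun_prop) hf.1.norm)
    (Eventually.of_forall fun x => ?_)
  have h := Real.exp_pos (-(a * |x - y|))
  rw [Real.norm_of_nonneg (by positivity), Pi.add_apply]
  nlinarith [mul_nonneg h.le (sq_nonneg (‖f x‖ - 1)), mul_nonneg h.le (sq_nonneg (‖f x‖))]

/-- The integral operator with kernel `exp(-a|x - y|)` is bounded on `L²`. -/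
lemma integrableOn_sq_integral_exp_mul {a : ℝ} (ha : 0 < a) {f : ℝ → ℂ} (hf : MemLp f 2 μ₀) :
    ∃ S : ℝ → ℝ, IntegrableOn S (Ioi 0) ∧
      ∀ y, (∫ x in Ioi (0 : ℝ), Real.exp (-(a * |x - y|)) * ‖f x‖) ^ 2 ≤ S y := by
  have hk := integrable_exp_neg_mul_abs ha
  have hf2 : IntegrableOn (fun x => ‖f x‖ ^ 2) (Ioi 0) := hf.integrable_norm_pow two_ne_zero
  set K := (∫ s : ℝ, Real.exp (-(a * |s|))) + 1 with hK
  have hK0 : 0 < K := by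
    have : 0 ≤ ∫ s : ℝ, Real.exp (-(a * |s|)) := integral_nonneg fun _ => (Real.exp_pos _).le
    linarith
  refine ⟨fun y => K * ∫ x in Ioi (0 : ℝ), Real.exp (-(a * |x - y|)) * ‖f x‖ ^ 2,
    Integrable.const_mul ?_ K, fun y => ?_⟩
  · have h1 := Integrable.integrable_convolution (ContinuousLinearMap.mul ℝ ℝ)
      (hf2.integrable_indicator measurableSet_Ioi) hk
    refine (h1.integrableOn (s := Ioi 0)).congr (Eventually.of_forall fun y => ?_)
    simp only [convolution_def, ContinuousLinearMap.mul_apply']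
    rw [← integral_indicator measurableSet_Ioi]
    congr 1
    funext x
    by_cases hx : x ∈ Ioi (0 : ℝ)
    · simp only [indicator_of_mem hx, mul_comm, abs_sub_comm x y]
    · simp only [indicator_of_notMem hx, zero_mul]
  · have hky : IntegrableOn (fun x : ℝ => Real.exp (-(a * |x - y|))) (Ioi 0) :=
      (hk.comp_sub_right y).integrableOn
    have hkf : IntegrableOn (fun x : ℝ => Real.exp (-(a * |x - y|)) * ‖f x‖ ^ 2) (Ioi 0) :=
      Integrable.bdd_mul (c := 1) hf2 (by fun_prop)
        (Eventually.of_forall fun x => norm_exp_neg_mul_abs_le ha _)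
    have hkh := integrableOn_exp_mul_norm ha hf y
    set h := ∫ x in Ioi (0 : ℝ), Real.exp (-(a * |x - y|)) * ‖f x‖
    set S := ∫ x in Ioi (0 : ℝ), Real.exp (-(a * |x - y|)) * ‖f x‖ ^ 2
    have hKy : ∫ x in Ioi (0 : ℝ), Real.exp (-(a * |x - y|)) ≤ K := by
      have h1 : ∫ x in Ioi (0 : ℝ), Real.exp (-(a * |x - y|)) ≤ ∫ x, Real.exp (-(a * |x - y|)) :=
        setIntegral_le_integral (hk.comp_sub_right y)
          (Eventually.of_forall fun _ => (Real.exp_pos _).le)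
      rw [integral_sub_right_eq_self (fun s => Real.exp (-(a * |s|))) (μ := volume) y] at h1
      linarith
    -- Cauchy-Schwarz, from the positivity of `∫ exp(-a|x - y|) (|f x| - t)² dx` at `t = h / K`
    set t := h / K with ht
    have hpos : 0 ≤ ∫ x in Ioi (0 : ℝ), Real.exp (-(a * |x - y|)) * (‖f x‖ - t) ^ 2 :=
      integral_nonneg fun _ => by positivity
    have hexp : ∫ x in Ioi (0 : ℝ), Real.exp (-(a * |x - y|)) * (‖f x‖ - t) ^ 2 =
        S - 2 * t * h + t ^ 2 * ∫ x in Ioi (0 : ℝ), Real.exp (-(a * |x - y|)) := by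
      rw [← integral_const_mul, ← integral_const_mul, ← integral_sub hkf (hkh.const_mul _),
        ← integral_add]
      · congr 1
        funext x
        ring
      · exact hkf.sub (hkh.const_mul _)
      · exact hky.const_mul _
    rw [hexp] at hpos
    have h2 : t ^ 2 * ∫ x in Ioi (0 : ℝ), Real.exp (-(a * |x - y|)) ≤ t ^ 2 * K := by gcongr
    have h3 : t * K = h := by rw [ht]; field_simp
    have h4 : 0 ≤ K * (S - 2 * t * h + t ^ 2 * K) := mul_nonneg hK0.le (by linarith)
    nlinarith

/-- `χⱼ`, with derivative `χ' j`, solves the equation on the edge `j` and satisfies, at the vertex,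
the conditions imposed by the Jost solutions on the other edges: continuing `χⱼ` by multiples of
these Jost solutions gives a function that is continuous at the vertex and satisfies the Kirchhoff
condition. The initial values are normalized without denominators, so that zeros of Jost functions
are allowed. The constant `C` bounds the growth of `χⱼ` and the decay of the Jost solutions, and
`tendsto` says that `χⱼ` grows like a multiple of `exp(-iζx)`. -/
structure IsVertexFamily {n : ℕ} (V : Fin n → ℝ → ℝ) (ζ : ℂ) (χ χ' : Fin n → ℝ → ℂ) (C : ℝ) :
    Prop where
  sol : ∀ j, IsSchrodingerSol (V j) (ζ ^ 2) (χ j) (χ' j)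
  nonneg : 0 ≤ C
  norm_le : ∀ j x, 0 ≤ x → ‖χ j x‖ ≤ C * Real.exp (ζ.im * x)
  norm_le' : ∀ j x, 0 ≤ x → ‖χ' j x‖ ≤ C * Real.exp (ζ.im * x)
  theta_le : ∀ j x, 0 ≤ x → ‖jostTheta (V j) ζ x‖ ≤ C * Real.exp (-(ζ.im * x))
  theta_le' : ∀ j x, 0 ≤ x → ‖jostTheta' (V j) ζ x‖ ≤ C * Real.exp (-(ζ.im * x))
  zero : ∀ j, χ j 0 = cofactor (fun k => jostTheta (V k) ζ 0) j
  zero' : ∀ j, χ' j 0 =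
    -cofactorSum (fun k => jostTheta (V k) ζ 0) (fun k => jostTheta' (V k) ζ 0) j
  tendsto : ∀ j, Tendsto (fun x : ℝ =>
    Complex.exp (Complex.I * ζ * x) * (χ' j x + Complex.I * ζ * χ j x)) atTop (𝓝 0)

lemma exists_vertexFamily {n : ℕ} {V : Fin n → ℝ → ℝ} (hV : ∀ j, IntegrableOn (V j) (Ioi 0)) {ζ : ℂ}
    (hζ : 0 < ζ.im) : ∃ χ χ' C, IsVertexFamily V ζ χ χ' C := by
  choose χ χ' hs h0 h0' hb ht using fun j => exists_regularSol (hV j) hζ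
    (cofactor (fun k => jostTheta (V k) ζ 0) j)
    (-cofactorSum (fun k => jostTheta (V k) ζ 0) (fun k => jostTheta' (V k) ζ 0) j)
  choose C hC using hb
  choose D hD0 hD using fun j => exists_norm_jostTheta_le (hV j) hζ
  have hM : ∀ j, C j ≤ ∑ j, (|C j| + D j) ∧ D j ≤ ∑ j, (|C j| + D j) := fun j => by
    have h := Finset.single_le_sum (f := fun j => |C j| + D j)
      (fun i _ => add_nonneg (abs_nonneg _) (hD0 i)) (Finset.mem_univ j)
    have h1 := le_abs_self (C j)
    have h2 := abs_nonneg (C j)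
    have h3 := hD0 j
    exact ⟨by linarith, by linarith⟩
  refine ⟨χ, χ', ∑ j, (|C j| + D j), hs, Finset.sum_nonneg fun i _ =>
    add_nonneg (abs_nonneg _) (hD0 i), fun j x hx => ?_, fun j x hx => ?_, fun j x hx => ?_,
    fun j x hx => ?_, h0, h0', ht⟩
  · exact (hC j x hx).1.trans (mul_le_mul_of_nonneg_right (hM j).1 (Real.exp_pos _).le)
  · exact (hC j x hx).2.trans (mul_le_mul_of_nonneg_right (hM j).1 (Real.exp_pos _).le)
  · exact (hD j x hx).1.trans (mul_le_mul_of_nonneg_right (hM j).2 (Real.exp_pos _).le)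
  · exact (hD j x hx).2.trans (mul_le_mul_of_nonneg_right (hM j).2 (Real.exp_pos _).le)

/-- The kernel built from solutions `θ`, `χ` in the variable `x` and functions `A`, `B` in the
variable `y`. For `A = θ` and `B = χ` it is Green's function of the star graph, for `A = θ'` and
`B = χ'` its derivative with respect to `y`. -/
def starKernel {n : ℕ} (V : Fin n → ℝ → ℝ) (ζ : ℂ) (χ A B : Fin n → ℝ → ℂ) (k j : Fin n)
    (y x : ℝ) : ℂ :=
  -(1 / starChar V ζ) * if j = k then
    (if x ≤ y then A k y * χ k x else B k y * jostTheta (V k) ζ x)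
    else cofactor₂ (fun l => jostTheta (V l) ζ 0) k j * A k y * jostTheta (V j) ζ x

section Green

variable {n : ℕ} {V : Fin n → ℝ → ℝ} {ζ : ℂ} {χ χ' : Fin n → ℝ → ℂ} {C : ℝ} {A B : Fin n → ℝ → ℂ}

/-- Green's function decays exponentially off the diagonal. -/
lemma exists_norm_starKernel_le (hζ : 0 < ζ.im)
    (h : IsVertexFamily V ζ χ χ' C) (hA : ∀ j x, 0 ≤ x → ‖A j x‖ ≤ C * Real.exp (-(ζ.im * x)))
    (hB : ∀ j x, 0 ≤ x → ‖B j x‖ ≤ C * Real.exp (ζ.im * x)) :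
    ∃ D, 0 ≤ D ∧ ∀ k j y x, 0 ≤ y → 0 ≤ x →
      ‖starKernel V ζ χ A B k j y x‖ ≤ D * Real.exp (-(ζ.im * |x - y|)) := by
  set P : ℝ := ∑ k, ∑ j, ‖cofactor₂ (fun l => jostTheta (V l) ζ 0) k j‖ with hP
  have hPle : ∀ k j, ‖cofactor₂ (fun l => jostTheta (V l) ζ 0) k j‖ ≤ P := fun k j => by
    refine (Finset.single_le_sum (f := fun j => ‖cofactor₂ (fun l => jostTheta (V l) ζ 0) k j‖)
      (fun _ _ => norm_nonneg _) (Finset.mem_univ j)).trans ?_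
    exact Finset.single_le_sum (f := fun k => ∑ j, ‖cofactor₂ (fun l => jostTheta (V l) ζ 0) k j‖)
      (fun _ _ => Finset.sum_nonneg fun _ _ => norm_nonneg _) (Finset.mem_univ k)
  have hP0 : 0 ≤ P := Finset.sum_nonneg fun _ _ => Finset.sum_nonneg fun _ _ => norm_nonneg _
  have hC := h.nonneg
  refine ⟨‖-(1 / starChar V ζ)‖ * ((1 + P) * (C * C)), by positivity, fun k j y x hy hx => ?_⟩
  rw [starKernel, norm_mul, mul_assoc ‖_‖]
  refine mul_le_mul_of_nonneg_left ?_ (norm_nonneg _)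
  have key : ∀ {u v : ℂ} {s t : ℝ}, ‖u‖ ≤ C * Real.exp s → ‖v‖ ≤ C * Real.exp t →
      ‖u * v‖ ≤ C * C * Real.exp (s + t) := by
    intro u v s t h1 h2
    rw [norm_mul, Real.exp_add]
    calc ‖u‖ * ‖v‖ ≤ (C * Real.exp s) * (C * Real.exp t) := by gcongr
      _ = _ := by ring
  have hle : ∀ {s : ℝ}, C * C * Real.exp s ≤ (1 + P) * (C * C) * Real.exp s := fun {s} => by
    have h2 : 0 ≤ C * C * Real.exp s := mul_nonneg (mul_nonneg hC hC) (Real.exp_pos s).le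
    nlinarith
  split_ifs with h1 h2
  · refine (key (hA k y hy) (h.norm_le k x hx)).trans ?_
    rw [abs_of_nonpos (by linarith), show -(ζ.im * y) + ζ.im * x = -(ζ.im * -(x - y)) by ring]
    exact hle
  · refine (key (hB k y hy) (h.theta_le k x hx)).trans ?_
    rw [abs_of_pos (by linarith), show ζ.im * y + -(ζ.im * x) = -(ζ.im * (x - y)) by ring]
    exact hle
  · have h3 := key (hA k y hy) (h.theta_le j x hx)
    have h4 := hPle k j
    have h5 : Real.exp (-(ζ.im * y) + -(ζ.im * x)) ≤ Real.exp (-(ζ.im * |x - y|)) := by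
      refine Real.exp_le_exp.2 ?_
      have : |x - y| ≤ y + x := abs_le.2 ⟨by linarith, by linarith⟩
      nlinarith
    rw [mul_assoc, norm_mul]
    calc _ ≤ P * (C * C * Real.exp (-(ζ.im * |x - y|))) := by
          refine mul_le_mul h4 (h3.trans ?_) (norm_nonneg _) hP0
          gcongr
      _ ≤ _ := by
        have : 0 ≤ C * C * Real.exp (-(ζ.im * |x - y|)) :=
          mul_nonneg (mul_nonneg hC hC) (Real.exp_pos _).le
        nlinarith

lemma IsVertexFamily.integrableOn_theta_mul (h : IsVertexFamily V ζ χ χ' C) (hζ : 0 < ζ.im)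
    (hV : ∀ j, IntegrableOn (V j) (Ioi 0)) {f : ℝ → ℂ} (hf : MemLp f 2 μ₀) (j : Fin n) :
    IntegrableOn (fun x => jostTheta (V j) ζ x * f x) (Ioi 0) :=
  (memLp_of_norm_le_exp hζ (isSchrodingerSol_jostTheta (hV j) hζ).left.continuousOn
    (h.theta_le j)).integrable_mul hf

lemma IsVertexFamily.intervalIntegrable_mul (h : IsVertexFamily V ζ χ χ' C)
    {f : ℝ → ℂ} (hf : MemLp f 2 μ₀) (j : Fin n) (x : ℝ) (hx : 0 ≤ x) :
    IntervalIntegrable (fun x => χ j x * f x) volume 0 x := by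
  refine IntervalIntegrable.continuousOn_mul ?_ ((h.sol j).left.continuousOn.mono (by
    rw [uIcc_of_le hx]; exact Icc_subset_Ici_self))
  rw [intervalIntegrable_iff_integrableOn_Ioc_of_le hx]
  exact (hf.mono_measure (Measure.restrict_mono Ioc_subset_Ioi_self le_rfl)).integrable (by norm_num)

/-- The integral operator with kernel `starKernel`, applied to `f`, is given by the variation of
constants formula. -/
lemma sum_integral_starKernel (hV : ∀ j, IntegrableOn (V j) (Ioi 0)) (hζ : 0 < ζ.im)
    (h : IsVertexFamily V ζ χ χ' C) {f : Fin n → ℝ → ℂ} (hf : ∀ j, MemLp (f j) 2 μ₀) (k : Fin n)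
    {y : ℝ} (hy : 0 ≤ y) :
    ∑ j, ∫ x in Ioi (0 : ℝ), starKernel V ζ χ A B k j y x * f j x = -(1 / starChar V ζ) *
      (A k y * (∫ x in (0 : ℝ)..y, χ k x * f k x) +
        B k y * (∫ x in Ioi y, jostTheta (V k) ζ x * f k x) +
        A k y * ∑ j ∈ Finset.univ.erase k, cofactor₂ (fun l => jostTheta (V l) ζ 0) k j *
          ∫ x in Ioi (0 : ℝ), jostTheta (V j) ζ x * f j x) := by
  have hd : ∫ x in Ioi (0 : ℝ), starKernel V ζ χ A B k k y x * f k x = -(1 / starChar V ζ) *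
      (A k y * (∫ x in (0 : ℝ)..y, χ k x * f k x) +
        B k y * (∫ x in Ioi y, jostTheta (V k) ζ x * f k x)) := by
    have i1 : IntegrableOn (fun x => χ k x * f k x) (Ioc 0 y) :=
      (intervalIntegrable_iff_integrableOn_Ioc_of_le hy).1 (h.intervalIntegrable_mul (hf k) k y hy)
    have i2 : IntegrableOn (fun x => jostTheta (V k) ζ x * f k x) (Ioi y) :=
      (h.integrableOn_theta_mul hζ hV (hf k) k).mono_set (Ioi_subset_Ioi hy)
    have e1 : ∀ x ∈ Ioc 0 y, -(1 / starChar V ζ) * A k y * (χ k x * f k x) =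
        starKernel V ζ χ A B k k y x * f k x := fun x hx => by
      rw [starKernel, if_pos rfl, if_pos hx.2]
      ring
    have e2 : ∀ x ∈ Ioi y, -(1 / starChar V ζ) * B k y * (jostTheta (V k) ζ x * f k x) =
        starKernel V ζ χ A B k k y x * f k x := fun x hx => by
      rw [starKernel, if_pos rfl, if_neg (not_le.2 hx)]
      ring
    rw [← Ioc_union_Ioi_eq_Ioi hy, setIntegral_union Ioc_disjoint_Ioi_same measurableSet_Ioi
      (IntegrableOn.congr_fun (i1.const_mul _ : IntegrableOn _ _ _) e1 measurableSet_Ioc)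
      (IntegrableOn.congr_fun (i2.const_mul _ : IntegrableOn _ _ _) e2 measurableSet_Ioi),
      ← setIntegral_congr_fun measurableSet_Ioc e1, ← setIntegral_congr_fun measurableSet_Ioi e2,
      integral_const_mul, integral_const_mul, intervalIntegral.integral_of_le hy]
    ring
  have ho : ∀ j ∈ Finset.univ.erase k, ∫ x in Ioi (0 : ℝ), starKernel V ζ χ A B k j y x * f j x =
      -(1 / starChar V ζ) * (A k y * (cofactor₂ (fun l => jostTheta (V l) ζ 0) k j *
          ∫ x in Ioi (0 : ℝ), jostTheta (V j) ζ x * f j x)) := by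
    intro j hj
    rw [← integral_const_mul, ← integral_const_mul, ← integral_const_mul]
    congr 1
    funext x
    rw [starKernel, if_neg (Finset.ne_of_mem_erase hj)]
    ring
  rw [← Finset.add_sum_erase _ _ (Finset.mem_univ k), hd, Finset.sum_congr rfl ho,
    ← Finset.mul_sum, ← Finset.mul_sum]
  ring

/-- The Wronskian of the two solutions that enter Green's function. -/
lemma IsVertexFamily.wronskian_eq (hV : ∀ j, IntegrableOn (V j) (Ioi 0)) (hζ : 0 < ζ.im)
    (h : IsVertexFamily V ζ χ χ' C) (j : Fin n) {x : ℝ} (hx : 0 ≤ x) :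
    χ j x * jostTheta' (V j) ζ x - χ' j x * jostTheta (V j) ζ x = starChar V ζ := by
  rw [(h.sol j).wronskian_const (isSchrodingerSol_jostTheta (hV j) hζ) hx, h.zero, h.zero',
    starChar, starDet_eq j]
  ring

lemma memLp_sum_integral_starKernel (hζ : 0 < ζ.im)
    (h : IsVertexFamily V ζ χ χ' C) (hA : ∀ j x, 0 ≤ x → ‖A j x‖ ≤ C * Real.exp (-(ζ.im * x)))
    (hB : ∀ j x, 0 ≤ x → ‖B j x‖ ≤ C * Real.exp (ζ.im * x))
    {f : Fin n → ℝ → ℂ} (hf : ∀ j, MemLp (f j) 2 μ₀) (k : Fin n)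
    (hm : AEStronglyMeasurable
      (fun y => ∑ j, ∫ x in Ioi (0 : ℝ), starKernel V ζ χ A B k j y x * f j x) μ₀) :
    MemLp (fun y => ∑ j, ∫ x in Ioi (0 : ℝ), starKernel V ζ χ A B k j y x * f j x) 2 μ₀ := by
  obtain ⟨D, hD0, hD⟩ := exists_norm_starKernel_le hζ h hA hB
  choose S hS hSle using fun j => integrableOn_sq_integral_exp_mul hζ (hf j)
  rw [memLp_two_iff_integrable_sq_norm hm]
  have hi : IntegrableOn (fun y => n * ∑ j, D ^ 2 * S j y) (Ioi 0) :=
    Integrable.const_mul (integrable_finsetSum _ fun j _ => (hS j).const_mul _) _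
  refine hi.mono' (hm.norm.pow 2) (ae_halfLine_of_forall fun y hy => ?_)
  rw [Real.norm_of_nonneg (by positivity)]
  have h1 : ∀ j, ‖∫ x in Ioi (0 : ℝ), starKernel V ζ χ A B k j y x * f j x‖ ≤
      D * ∫ x in Ioi (0 : ℝ), Real.exp (-(ζ.im * |x - y|)) * ‖f j x‖ := by
    intro j
    rw [← integral_const_mul]
    refine norm_integral_le_of_norm_le ((integrableOn_exp_mul_norm hζ (hf j) y).const_mul D)
      (ae_halfLine_of_forall fun x hx => ?_)
    rw [norm_mul, ← mul_assoc]
    exact mul_le_mul_of_nonneg_right (hD k j y x hy.le hx.le) (norm_nonneg _)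
  have h2 : ‖∑ j, ∫ x in Ioi (0 : ℝ), starKernel V ζ χ A B k j y x * f j x‖ ≤
      ∑ j, D * ∫ x in Ioi (0 : ℝ), Real.exp (-(ζ.im * |x - y|)) * ‖f j x‖ :=
    (norm_sum_le _ _).trans (Finset.sum_le_sum fun j _ => h1 j)
  refine (pow_le_pow_left₀ (norm_nonneg _) h2 2).trans ?_
  refine sq_sum_le_card_mul_sum_sq.trans ?_
  rw [Finset.card_univ, Fintype.card_fin]
  refine mul_le_mul_of_nonneg_left (Finset.sum_le_sum fun j _ => ?_) n.cast_nonneg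
  rw [mul_pow]
  exact mul_le_mul_of_nonneg_left (hSle j y) (sq_nonneg D)

/-- The functions given by Green's function solve the resolvent equation on the edges, are in `H¹`
and satisfy the vertex conditions. -/
lemma green_solution (hV : ∀ j, IntegrableOn (V j) (Ioi 0)) (hζ : 0 < ζ.im)
    (h : IsVertexFamily V ζ χ χ' C) (hG : starChar V ζ ≠ 0)
    {f : Fin n → ℝ → ℂ} (hf : ∀ j, MemLp (f j) 2 μ₀) :
    ∃ u w : Fin n → ℝ → ℂ, (∀ k y, 0 ≤ y → u k y = ∑ j, ∫ x in Ioi (0 : ℝ),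
        starKernel V ζ χ (fun j => jostTheta (V j) ζ) χ k j y x * f j x) ∧
      (∀ k, HasACDeriv (u k) (w k)) ∧
      (∀ k, HasACDeriv (w k) (fun t => ((V k t : ℂ) - ζ ^ 2) * u k t - f k t)) ∧
      (∀ k, MemLp (u k) 2 μ₀) ∧ (∀ k, MemLp (w k) 2 μ₀) ∧ (∀ j k, u j 0 = u k 0) ∧
      ∑ j, w j 0 = 0 := by
  have hθ := fun j => isSchrodingerSol_jostTheta (hV j) hζ
  set W := starChar V ζ with hW
  set wr : Fin n → ℂ := fun l => jostTheta (V l) ζ 0 with hwr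
  set pr : Fin n → ℂ := fun l => jostTheta' (V l) ζ 0 with hpr
  set T : Fin n → ℂ := fun j => ∫ x in Ioi (0 : ℝ), jostTheta (V j) ζ x * f j x with hT
  set I₁ : Fin n → ℝ → ℂ := fun k y => ∫ x in (0 : ℝ)..y, χ k x * f k x with hI₁
  set I₂ : Fin n → ℝ → ℂ := fun k y => ∫ x in Ioi y, jostTheta (V k) ζ x * f k x with hI₂
  set c : Fin n → ℂ := fun k => ∑ j ∈ Finset.univ.erase k, cofactor₂ wr k j * T j with hc
  have dI₁ : ∀ k, HasACDeriv (I₁ k) (fun x => χ k x * f k x) := fun k =>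
    (HasACDeriv.of_intervalIntegrable (h.intervalIntegrable_mul (hf k) k) 0).congr'
      (fun x _ => zero_add _) fun _ _ => rfl
  have dI₂ : ∀ k, HasACDeriv (I₂ k) (fun x => -(jostTheta (V k) ζ x * f k x)) := fun k =>
    HasACDeriv.integral_Ioi (h.integrableOn_theta_mul hζ hV (hf k) k)
  set u : Fin n → ℝ → ℂ := fun k y => -(1 / W) * (jostTheta (V k) ζ y * I₁ k y + χ k y * I₂ k y +
    jostTheta (V k) ζ y * c k) with hu
  set w : Fin n → ℝ → ℂ := fun k y => -(1 / W) * (jostTheta' (V k) ζ y * I₁ k y + χ' k y * I₂ k y +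
    jostTheta' (V k) ζ y * c k) with hw
  have hue : ∀ k y, 0 ≤ y → u k y = ∑ j, ∫ x in Ioi (0 : ℝ),
      starKernel V ζ χ (fun j => jostTheta (V j) ζ) χ k j y x * f j x := fun k y hy => by
    rw [sum_integral_starKernel hV hζ h hf k hy]
  have hwe : ∀ k y, 0 ≤ y → w k y = ∑ j, ∫ x in Ioi (0 : ℝ),
      starKernel V ζ χ (fun j => jostTheta' (V j) ζ) χ' k j y x * f j x := fun k y hy => by
    rw [sum_integral_starKernel hV hζ h hf k hy]
  have du : ∀ k, HasACDeriv (u k) (w k) := fun k => by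
    refine (((((hθ k).left.mul (dI₁ k)).add ((h.sol k).left.mul (dI₂ k))).add
      ((hθ k).left.mul (HasACDeriv.const (c k)))).const_mul (-(1 / W))).congr' (fun _ _ => rfl)
      fun x _ => ?_
    rw [hw]
    ring
  have dw : ∀ k, HasACDeriv (w k) (fun t => ((V k t : ℂ) - ζ ^ 2) * u k t - f k t) := fun k => by
    refine (((((hθ k).right.mul (dI₁ k)).add ((h.sol k).right.mul (dI₂ k))).add
      ((hθ k).right.mul (HasACDeriv.const (c k)))).const_mul (-(1 / W))).congr' (fun _ _ => rfl)
      fun x hx => ?_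
    have e := h.wronskian_eq hV hζ k hx.le
    have e2 : (1 / W) * W = 1 := by field_simp
    rw [hu]
    linear_combination -(1 / W) * f k x * e - f k x * e2
  refine ⟨u, w, hue, du, dw, fun k => ?_, fun k => ?_, ?_, ?_⟩
  · have hm := (du k).aestronglyMeasurable
    have hcongr : u k =ᵐ[μ₀] fun y => ∑ j, ∫ x in Ioi (0 : ℝ),
        starKernel V ζ χ (fun j => jostTheta (V j) ζ) χ k j y x * f j x :=
      ae_halfLine_of_forall fun y hy => hue k y hy.le
    exact (memLp_congr_ae hcongr).2 (memLp_sum_integral_starKernel hζ h h.theta_le h.norm_le hf k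
      (hm.congr hcongr))
  · have hm := (dw k).aestronglyMeasurable
    have hcongr : w k =ᵐ[μ₀] fun y => ∑ j, ∫ x in Ioi (0 : ℝ),
        starKernel V ζ χ (fun j => jostTheta' (V j) ζ) χ' k j y x * f j x :=
      ae_halfLine_of_forall fun y hy => hwe k y hy.le
    exact (memLp_congr_ae hcongr).2 (memLp_sum_integral_starKernel hζ h h.theta_le' h.norm_le' hf
      k (hm.congr hcongr))
  · have key : ∀ k, u k 0 = -(1 / W) * ∑ j, cofactor wr j * T j := fun k => by
      rw [← Finset.add_sum_erase _ _ (Finset.mem_univ k)]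
      simp only [hu, hI₁, hI₂, hc, intervalIntegral.integral_same, mul_zero, zero_add, h.zero]
      congr 2
      rw [Finset.mul_sum]
      refine Finset.sum_congr rfl fun j hj => ?_
      rw [← cofactor₂_mul (Finset.ne_of_mem_erase hj).symm, cofactor₂_comm]
      ring
    intro j k
    rw [key, key]
  · have key : ∀ k, w k 0 = -(1 / W) * (-(cofactorSum wr pr k * T k) +
        ∑ j ∈ Finset.univ.erase k, cofactor₂ wr k j * pr k * T j) := fun k => by
      simp only [hw, hI₁, hI₂, hc, intervalIntegral.integral_same, mul_zero, zero_add, h.zero']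
      congr 1
      rw [Finset.mul_sum, neg_mul]
      congr 1
      refine Finset.sum_congr rfl fun j hj => ?_
      ring
    rw [Finset.sum_congr rfl fun k _ => key k, ← Finset.mul_sum, Finset.sum_add_distrib,
      Finset.sum_neg_distrib]
    have hswap : ∑ k, ∑ j ∈ Finset.univ.erase k, cofactor₂ wr k j * pr k * T j =
        ∑ j, ∑ k ∈ Finset.univ.erase j, cofactor₂ wr k j * pr k * T j :=
      Finset.sum_comm' (by simp [eq_comm])
    rw [hswap]
    have : ∀ j, ∑ k ∈ Finset.univ.erase j, cofactor₂ wr k j * pr k * T j =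
        cofactorSum wr pr j * T j := fun j => by
      rw [cofactorSum, Finset.sum_mul]
      exact Finset.sum_congr rfl fun k _ => by rw [cofactor₂_comm]
    simp only [this]
    ring

/-- The value at `y` on the edge `k` of the function that Green's function assigns to `f`. -/
def greenFun (V : Fin n → ℝ → ℝ) (ζ : ℂ) (χ : Fin n → ℝ → ℂ) (f : StarL2 n) (k : Fin n) (y : ℝ) :
    ℂ :=
  ∑ j, ∫ x in Ioi (0 : ℝ), starKernel V ζ χ (fun j => jostTheta (V j) ζ) χ k j y x * f j x

/-- Green's function solves the resolvent equation in the weak form. -/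
lemma exists_starForm_eq (hV : ∀ j, IntegrableOn (V j) (Ioi 0)) (hζ : 0 < ζ.im)
    (h : IsVertexFamily V ζ χ χ' C) (hG : starChar V ζ ≠ 0) (f : StarL2 n) :
    ∃ (ψ : Fin n → ℝ → ℂ) (u : StarL2 n), IsStarH1 ψ ∧ (∀ j, u j =ᵐ[μ₀] ψ j) ∧
      (∀ k y, 0 ≤ y → ψ k y = greenFun V ζ χ f k y) ∧
      ∀ φ : Fin n → ℝ → ℂ, IsStarH1 φ →
        starForm V ψ φ = ∑ j, ∫ x in Ioi (0 : ℝ), (f + ζ ^ 2 • u) j x * conj (φ j x) := by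
  obtain ⟨u, w, he, du, dw, hu2, hw2, hv, hK⟩ :=
    green_solution hV hζ h hG (f := fun j => f j) fun j => Lp.memLp (f j)
  refine ⟨u, starToLp u hu2, ⟨fun j => (du j).isHalfLineH1 (hu2 j) (hw2 j), hv⟩,
    starToLp_ae u hu2, he, fun φ hφ => ?_⟩
  rw [starForm_eq_of_sol hV du dw hu2 hw2 (fun j => Lp.memLp (f j)) hK hφ]
  refine Finset.sum_congr rfl fun j _ => integral_congr_ae ?_
  filter_upwards [starToLp_ae u hu2 j, Lp.coeFn_smul (ζ ^ 2) (starToLp u hu2 j),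
    Lp.coeFn_add (f j) ((ζ ^ 2 • starToLp u hu2) j)] with x h1 h2 h3
  have h4 : (f + ζ ^ 2 • starToLp u hu2) j x = f j x + (ζ ^ 2 • starToLp u hu2) j x := h3
  have h5 : (ζ ^ 2 • starToLp u hu2) j x = ζ ^ 2 • (starToLp u hu2 j x) := h2
  rw [h4, h5, h1, smul_eq_mul]

end Green

section Resolvent

variable {n : ℕ} {V : Fin n → ℝ → ℝ} {ζ : ℂ}

lemma sq_mem_opResolventSet (hV : ∀ j, IntegrableOn (V j) (Ioi 0)) (hζ : 0 < ζ.im)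
    (hG : starChar V ζ ≠ 0) : ζ ^ 2 ∈ opResolventSet (starSchrodinger V) := by
  obtain ⟨χ, χ', C, h⟩ := exists_vertexFamily hV hζ
  refine mem_opResolventSet_of_solvable fun f => ?_
  obtain ⟨ψ, u, hψ, hu, -, he⟩ := exists_starForm_eq hV hζ h hG f
  exact ⟨u, ψ, hψ, hu, he⟩

lemma mem_opResolventSet_of_im_ne_zero (hn : 0 < n) (hV : ∀ j, IntegrableOn (V j) (Ioi 0)) {z : ℂ}
    (hz : z.im ≠ 0) : z ∈ opResolventSet (starSchrodinger V) := by
  obtain ⟨ζ, hζ, rfl⟩ : ∃ ζ : ℂ, 0 < ζ.im ∧ ζ ^ 2 = z := by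
    obtain ⟨s, hs⟩ := IsAlgClosed.exists_pow_nat_eq z two_pos
    rcases lt_trichotomy s.im 0 with h | h | h
    · exact ⟨-s, by simpa using h, by rw [neg_sq, hs]⟩
    · refine absurd ?_ hz
      rw [← hs, sq, Complex.mul_im, h]
      ring
    · exact ⟨s, h, hs⟩
  exact sq_mem_opResolventSet hV hζ (starChar_ne_zero_of_im hn hV hζ hz)

lemma isResolventAt_opResolvent {E : Type*} [NormedAddCommGroup E] [InnerProductSpace ℂ E]
    {A : Set (E × E)} {z : ℂ} (h : z ∈ opResolventSet A) :
    IsResolventAt A z (opResolvent A z) := by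
  have h' : ∃ R : E →L[ℂ] E, IsResolventAt A z R := h
  rw [opResolvent, dif_pos h']
  exact h'.choose_spec

/-- The resolvent is the integral operator with Green's function as its kernel. -/
lemma exists_opResolvent_eq {χ χ' : Fin n → ℝ → ℂ} {C : ℝ} (hV : ∀ j, IntegrableOn (V j) (Ioi 0))
    (hζ : 0 < ζ.im) (h : IsVertexFamily V ζ χ χ' C) (hG : starChar V ζ ≠ 0) (f : StarL2 n) :
    ∃ ψ : Fin n → ℝ → ℂ, IsStarH1 ψ ∧
      (∀ j, opResolvent (starSchrodinger V) (ζ ^ 2) f j =ᵐ[μ₀] ψ j) ∧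
      (∀ k y, 0 ≤ y → ψ k y = greenFun V ζ χ f k y) ∧
      ∀ φ : Fin n → ℝ → ℂ, IsStarH1 φ → starForm V ψ φ = ∑ j, ∫ x in Ioi (0 : ℝ),
        (f + ζ ^ 2 • opResolvent (starSchrodinger V) (ζ ^ 2) f) j x * conj (φ j x) := by
  obtain ⟨ψ, u, hψ, hu, hg, he⟩ := exists_starForm_eq hV hζ h hG f
  have h1 : opResolvent (starSchrodinger V) (ζ ^ 2) f = u :=
    (isResolventAt_opResolvent (sq_mem_opResolventSet hV hζ hG) f u).2 ⟨ψ, hψ, hu, he⟩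
  exact ⟨ψ, hψ, h1 ▸ hu, hg, h1 ▸ he⟩

lemma jostM_zero (hζ : 0 < ζ.im) {x : ℝ} (hx : 0 ≤ x) : jostM 0 ζ x = 1 := by
  have h := norm_jostM_sub_one_le (v := 0) integrableOn_zero hζ hx
  simp only [Pi.zero_apply, abs_zero, integral_zero, mul_zero] at h
  exact sub_eq_zero.1 (norm_le_zero_iff.1 h)

lemma jostM'_zero (hζ : 0 < ζ.im) {x : ℝ} (hx : 0 ≤ x) : jostM' 0 ζ x = 0 := by
  have h := norm_jostM'_le (v := 0) integrableOn_zero hζ hx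
  simp only [Pi.zero_apply, abs_zero, integral_zero, mul_zero] at h
  exact norm_le_zero_iff.1 h

/-- The characteristic function of the free star graph. -/
lemma starChar_zero (hζ : 0 < ζ.im) :
    starChar (0 : Fin n → ℝ → ℝ) ζ = n * (Complex.I * ζ) := by
  simp [starChar, starDet, cofactor, jostTheta, jostTheta', jostM_zero hζ, jostM'_zero hζ]

lemma starChar_zero_ne_zero (hn : 0 < n) (hζ : 0 < ζ.im) :
    starChar (0 : Fin n → ℝ → ℝ) ζ ≠ 0 := by
  rw [starChar_zero hζ]
  exact mul_ne_zero (by exact_mod_cast hn.ne')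
    (mul_ne_zero Complex.I_ne_zero (ne_zero_of_im_pos hζ))

end Resolvent

/-! ### Products of Hilbert-Schmidt operators -/

section HilbertSchmidt

variable {E F : Type*} [NormedAddCommGroup E] [InnerProductSpace ℂ E]
  [NormedAddCommGroup F] [InnerProductSpace ℂ F]

lemma Orthonormal.countable_of_separable [TopologicalSpace.SeparableSpace E] {ι : Type*} {e : ι → E}
    (he : Orthonormal ℂ e) : Countable ι := by
  refine Pairwise.countable_of_isOpen_disjoint (s := fun i => Metric.ball (e i) (1 / 2))
    (fun i j hij => Metric.ball_disjoint_ball ?_) (fun _ => Metric.isOpen_ball)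
    (fun i => ⟨e i, Metric.mem_ball_self (by norm_num)⟩)
  have h1 : ‖e i - e j‖ ^ 2 = 2 := by
    rw [@norm_sub_sq ℂ, he.2 hij, he.1, he.1]
    norm_num
  rw [dist_eq_norm]
  nlinarith [norm_nonneg (e i - e j)]

lemma HilbertBasis.hasSum_norm_inner_sq {ι : Type*} (e : HilbertBasis ι ℂ E) (x : E) :
    HasSum (fun i => ‖inner ℂ (e i) x‖ ^ 2) (‖x‖ ^ 2) := by
  have h := (e.hasSum_inner_mul_inner x x).mapL Complex.reCLM
  have h1 : Complex.reCLM (inner ℂ x x) = ‖x‖ ^ 2 := inner_self_eq_norm_sq (𝕜 := ℂ) x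
  rw [h1] at h
  refine h.congr_fun fun i => ?_
  rw [← inner_conj_symm x, mul_comm, Complex.mul_conj, Complex.normSq_eq_norm_sq,
    Complex.reCLM_apply, Complex.ofReal_re]

/-- The Hilbert-Schmidt norm of the adjoint is finite if that of the operator is. -/
lemma summable_norm_sq_adjoint [CompleteSpace E] [CompleteSpace F] {ι κ : Type*}
    (e : HilbertBasis ι ℂ E) (u : HilbertBasis κ ℂ F) {A : E →L[ℂ] F}
    (hA : Summable fun i => ‖A (e i)‖ ^ 2) :
    Summable fun k => ‖ContinuousLinearMap.adjoint A (u k)‖ ^ 2 := by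
  have h1 : Summable fun p : ι × κ => ‖inner ℂ (u p.2) (A (e p.1))‖ ^ 2 := by
    rw [summable_prod_of_nonneg fun _ => sq_nonneg _]
    refine ⟨fun i => (u.hasSum_norm_inner_sq (A (e i))).summable, hA.congr fun i => ?_⟩
    exact (u.hasSum_norm_inner_sq (A (e i))).tsum_eq.symm
  have h2 := ((summable_prod_of_nonneg fun _ => sq_nonneg _).1 h1.prod_symm).2
  refine h2.congr fun k => ?_
  rw [← (e.hasSum_norm_inner_sq (ContinuousLinearMap.adjoint A (u k))).tsum_eq]
  refine tsum_congr fun i => ?_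
  rw [ContinuousLinearMap.adjoint_inner_right, norm_inner_symm]
  rfl

/-- The product of two Hilbert-Schmidt operators is trace class. -/
lemma isTraceClass_of_hilbertSchmidt [CompleteSpace E] [CompleteSpace F]
    [TopologicalSpace.SeparableSpace F] {ι : Type*} (e : HilbertBasis ι ℂ E)
    {A B : E →L[ℂ] F} (hA : Summable fun i => ‖A (e i)‖ ^ 2)
    (hB : Summable fun i => ‖B (e i)‖ ^ 2) {T : E →L[ℂ] E}
    (hT : ∀ f, T f = ContinuousLinearMap.adjoint B (A f)) : IsTraceClass T := by
  obtain ⟨s, u, -⟩ := exists_hilbertBasis ℂ F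
  have : Countable s := u.orthonormal.countable_of_separable
  obtain ⟨c, hc⟩ := exists_injective_nat s
  have hA' := summable_norm_sq_adjoint e u hA
  have hB' := summable_norm_sq_adjoint e u hB
  refine ⟨Function.extend c (fun k => ContinuousLinearMap.adjoint A (u k)) 0,
    Function.extend c (fun k => ContinuousLinearMap.adjoint B (u k)) 0, ?_, fun f => ?_⟩
  · refine (hc.summable_iff fun i hi => ?_).1 ?_
    · rw [Function.extend_apply' _ _ _ (by simpa using hi)]
      simp
    · refine Summable.of_nonneg_of_le (fun _ => mul_nonneg (norm_nonneg _) (norm_nonneg _))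
        (fun k => ?_) (hA'.add hB')
      simp only [Function.comp_apply, hc.extend_apply]
      nlinarith [sq_nonneg (‖ContinuousLinearMap.adjoint A (u k)‖ -
        ‖ContinuousLinearMap.adjoint B (u k)‖), sq_nonneg (‖ContinuousLinearMap.adjoint A (u k)‖),
        sq_nonneg (‖ContinuousLinearMap.adjoint B (u k)‖)]
  · refine (hc.hasSum_iff fun i hi => ?_).1 ?_
    · rw [Function.extend_apply' _ _ _ (by simpa using hi)]
      simp
    · rw [hT]
      have h := (u.hasSum_repr (A f)).mapL (ContinuousLinearMap.adjoint B)
      refine h.congr_fun fun k => ?_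
      simp only [Function.comp_apply, hc.extend_apply, map_smul, u.repr_apply_apply,
        ContinuousLinearMap.adjoint_inner_left]

end HilbertSchmidt

/-! ### Weak integrals of operators of rank one -/

section WeakIntegral

variable {n : ℕ} {V : Fin n → ℝ → ℝ} {a b : Fin n → ℝ → StarL2 n} {M : ℝ}

instance : TopologicalSpace.SeparableSpace (StarL2 n) :=
  have : Fact ((2 : ENNReal) ≠ ⊤) := ⟨by simp⟩
  TopologicalSpace.SecondCountableTopology.to_separableSpace

lemma norm_sq_eq_sum_integral (f : StarL2 n) :
    ‖f‖ ^ 2 = ∑ j, ∫ x in Ioi (0 : ℝ), ‖f j x‖ ^ 2 := by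
  have h := star_inner_eq f f
  rw [inner_self_eq_norm_sq_to_K] at h
  have h2 : (((‖f‖ ^ 2 : ℝ)) : ℂ) = ((∑ j, ∫ x in Ioi (0 : ℝ), ‖f j x‖ ^ 2 : ℝ) : ℂ) := by
    rw [Complex.ofReal_pow, Complex.ofReal_sum]
    refine h.trans (Finset.sum_congr rfl fun j _ => ?_)
    rw [← integral_complex_ofReal]
    congr 1
    funext x
    rw [Complex.mul_conj, Complex.normSq_eq_norm_sq]
  exact_mod_cast h2

lemma norm_inner_sq_le (ha : ∀ k y, 0 ≤ y → ‖a k y‖ ≤ M) (f : StarL2 n) (k : Fin n) {y : ℝ}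
    (hy : 0 ≤ y) : ‖inner ℂ (a k y) f‖ ^ 2 ≤ M ^ 2 * ‖f‖ ^ 2 := by
  rw [← mul_pow]
  refine pow_le_pow_left₀ (norm_nonneg _) ((norm_inner_le_norm _ _).trans ?_) 2
  exact mul_le_mul_of_nonneg_right (ha k y hy) (norm_nonneg _)

lemma integrableOn_potential_mul_norm_inner_sq (hV : ∀ k, IntegrableOn (V k) (Ioi 0))
    (ha : ∀ k y, 0 ≤ y → ‖a k y‖ ≤ M)
    (ham : ∀ k f, AEStronglyMeasurable (fun y => inner ℂ (a k y) f) μ₀) (f : StarL2 n) (k : Fin n) :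
    IntegrableOn (fun y => |V k y| * ‖inner ℂ (a k y) f‖ ^ 2) (Ioi 0) := by
  refine Integrable.mul_bdd (c := M ^ 2 * ‖f‖ ^ 2) (hV k).abs ((ham k f).norm.pow 2)
    (ae_halfLine_of_forall fun y hy => ?_)
  rw [Real.norm_of_nonneg (by positivity)]
  exact norm_inner_sq_le ha f k hy.le

/-- Multiplication of the functions `⟨aₖ(y), f⟩` by the root of the potential gives a
Hilbert-Schmidt operator. -/
lemma exists_hilbertSchmidt (hV : ∀ k, IntegrableOn (V k) (Ioi 0))
    (ha : ∀ k y, 0 ≤ y → ‖a k y‖ ≤ M)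
    (ham : ∀ k f, AEStronglyMeasurable (fun y => inner ℂ (a k y) f) μ₀) {q : Fin n → ℝ → ℝ}
    (hq : ∀ k y, q k y ^ 2 = |V k y|) (hqm : ∀ k, AEStronglyMeasurable (q k) μ₀) :
    ∃ A : StarL2 n →L[ℂ] StarL2 n,
      (∀ f k, A f k =ᵐ[μ₀] fun y => (q k y : ℂ) * inner ℂ (a k y) f) ∧
      ∀ (ι : Type) (e : HilbertBasis ι ℂ (StarL2 n)), Summable fun i => ‖A (e i)‖ ^ 2 := by
  have hint := integrableOn_potential_mul_norm_inner_sq hV ha ham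
  have hsq : ∀ f k y, ‖(q k y : ℂ) * inner ℂ (a k y) f‖ ^ 2 =
      |V k y| * ‖inner ℂ (a k y) f‖ ^ 2 := fun f k y => by
    rw [norm_mul, mul_pow, Complex.norm_real, Real.norm_eq_abs, sq_abs, hq]
  have hmem : ∀ f k, MemLp (fun y => (q k y : ℂ) * inner ℂ (a k y) f) 2 μ₀ := fun f k => by
    have hm : AEStronglyMeasurable (fun y => (q k y : ℂ) * inner ℂ (a k y) f) μ₀ :=
      (Complex.continuous_ofReal.comp_aestronglyMeasurable (hqm k)).mul (ham k f)
    rw [memLp_two_iff_integrable_sq_norm hm]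
    simp only [hsq]
    exact hint f k
  have hae : ∀ f k, starToLp _ (hmem f) k =ᵐ[μ₀] fun y => (q k y : ℂ) * inner ℂ (a k y) f :=
    fun f => starToLp_ae _ (hmem f)
  have hnorm : ∀ f, ‖starToLp _ (hmem f)‖ ^ 2 =
      ∑ k, ∫ y in Ioi (0 : ℝ), |V k y| * ‖inner ℂ (a k y) f‖ ^ 2 := fun f => by
    rw [norm_sq_eq_sum_integral]
    refine Finset.sum_congr rfl fun k _ => integral_congr_ae ?_
    filter_upwards [hae f k] with y hy
    rw [hy, hsq]
  let L : StarL2 n →ₗ[ℂ] StarL2 n :=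
    { toFun := fun f => starToLp _ (hmem f)
      map_add' := fun f g => by
        ext k
        filter_upwards [hae (f + g) k, hae f k, hae g k, Lp.coeFn_add (starToLp _ (hmem f) k)
          (starToLp _ (hmem g) k)] with y h1 h2 h3 h4
        refine h1.trans (Eq.trans ?_ h4.symm)
        rw [Pi.add_apply, h2, h3, inner_add_right, mul_add]
      map_smul' := fun c f => by
        ext k
        filter_upwards [hae (c • f) k, hae f k, Lp.coeFn_smul c (starToLp _ (hmem f) k)]
          with y h1 h2 h3
        refine h1.trans (Eq.trans ?_ h3.symm)
        rw [Pi.smul_apply, h2, inner_smul_right, smul_eq_mul]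
        ring }
  set N : ℝ := ∑ k, ∫ y in Ioi (0 : ℝ), |V k y| * M ^ 2 with hN
  have hN0 : 0 ≤ N := Finset.sum_nonneg fun k _ => integral_nonneg fun y => by positivity
  have hbound : ∀ f, ‖L f‖ ≤ √N * ‖f‖ := fun f => by
    refine abs_le_of_sq_le_sq' ?_ (by positivity) |>.2
    rw [mul_pow, Real.sq_sqrt hN0, hN, Finset.sum_mul]
    refine (hnorm f).le.trans (Finset.sum_le_sum fun k _ => ?_)
    rw [← integral_mul_const]
    refine setIntegral_mono_on (hint f k) (((hV k).abs.mul_const _).mul_const _) measurableSet_Ioi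
      fun y hy => ?_
    rw [mul_assoc]
    exact mul_le_mul_of_nonneg_left (norm_inner_sq_le ha f k (le_of_lt hy)) (abs_nonneg _)
  refine ⟨L.mkContinuous (√N) hbound, fun f k => hae f k, fun ι e => ?_⟩
  · refine summable_of_sum_le (c := N) (fun _ => sq_nonneg _) fun s => ?_
    have h1 : ∀ i, ‖L.mkContinuous (√N) hbound (e i)‖ ^ 2 =
        ∑ k, ∫ y in Ioi (0 : ℝ), |V k y| * ‖inner ℂ (a k y) (e i)‖ ^ 2 := fun i => hnorm (e i)
    simp only [h1]
    rw [Finset.sum_comm]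
    refine Finset.sum_le_sum fun k _ => ?_
    rw [← integral_finsetSum _ fun i _ => hint (e i) k]
    refine setIntegral_mono_on (integrable_finsetSum _ fun i _ => hint (e i) k)
      ((hV k).abs.mul_const _) measurableSet_Ioi fun y hy => ?_
    rw [← Finset.mul_sum]
    refine mul_le_mul_of_nonneg_left ?_ (abs_nonneg _)
    have h2 := e.orthonormal.sum_inner_products_le (a k y) (s := s)
    simp only [norm_inner_symm (e _)] at h2
    exact h2.trans (pow_le_pow_left₀ (norm_nonneg _) (ha k y (le_of_lt hy)) 2)

variable {T : StarL2 n →L[ℂ] StarL2 n}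

/-- An operator that is weakly the integral of `V ⟨a, ·⟩ b`, with bounded `a` and `b`, is a product
of two Hilbert-Schmidt operators. -/
lemma isTraceClass_of_weak_integral (hV : ∀ k, IntegrableOn (V k) (Ioi 0))
    (ha : ∀ k y, 0 ≤ y → ‖a k y‖ ≤ M)
    (ham : ∀ k f, AEStronglyMeasurable (fun y => inner ℂ (a k y) f) μ₀)
    (hb : ∀ k y, 0 ≤ y → ‖b k y‖ ≤ M)
    (hbm : ∀ k f, AEStronglyMeasurable (fun y => inner ℂ (b k y) f) μ₀)
    (hT : ∀ f g, inner ℂ g (T f) = ∑ k, ∫ y in Ioi (0 : ℝ),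
      (V k y : ℂ) * (inner ℂ (a k y) f * inner ℂ g (b k y))) : IsTraceClass T := by
  have hm : ∀ k, AEStronglyMeasurable (fun y => √|V k y|) μ₀ := fun k =>
    Real.continuous_sqrt.comp_aestronglyMeasurable (hV k).abs.1
  obtain ⟨A, hA, hA2⟩ := exists_hilbertSchmidt hV ha ham (q := fun k y => √|V k y|)
    (fun k y => Real.sq_sqrt (abs_nonneg _)) hm
  -- the sign of the potential is put into the second factor; `0 / 0 = 0` where it vanishes
  obtain ⟨B, hB, hB2⟩ := exists_hilbertSchmidt hV hb hbm
    (q := fun k y => V k y / √|V k y|) (fun k y => by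
      rw [div_pow, Real.sq_sqrt (abs_nonneg _), ← sq_abs, sq, mul_self_div_self])
    fun k => ((hV k).1.aemeasurable.div (hm k).aemeasurable).aestronglyMeasurable
  obtain ⟨s, e, -⟩ := exists_hilbertBasis ℂ (StarL2 n)
  refine isTraceClass_of_hilbertSchmidt e (hA2 _ e) (hB2 _ e) fun f => ext_inner_left ℂ fun g => ?_
  rw [ContinuousLinearMap.adjoint_inner_right, hT, star_inner_eq]
  refine Finset.sum_congr rfl fun k _ => integral_congr_ae ?_
  filter_upwards [hA f k, hB g k] with y h1 h2
  have h3 : V k y = √|V k y| * (V k y / √|V k y|) := by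
    rcases eq_or_ne (V k y) 0 with h | h
    · simp [h]
    · field_simp [(Real.sqrt_pos.2 (abs_pos.2 h)).ne']
  rw [h1, h2, map_mul, Complex.conj_ofReal, inner_conj_symm]
  nth_rw 1 [h3]
  push_cast
  ring

/-- The trace of a weak integral of operators of rank one is the integral of the traces. -/
lemma hasTrace_of_weak_integral (hV : ∀ k, IntegrableOn (V k) (Ioi 0))
    (ha : ∀ k y, 0 ≤ y → ‖a k y‖ ≤ M)
    (ham : ∀ k f, AEStronglyMeasurable (fun y => inner ℂ (a k y) f) μ₀)
    (hb : ∀ k y, 0 ≤ y → ‖b k y‖ ≤ M)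
    (hbm : ∀ k f, AEStronglyMeasurable (fun y => inner ℂ (b k y) f) μ₀)
    (hT : ∀ f g, inner ℂ g (T f) = ∑ k, ∫ y in Ioi (0 : ℝ),
      (V k y : ℂ) * (inner ℂ (a k y) f * inner ℂ g (b k y))) :
    HasTrace T (∑ k, ∫ y in Ioi (0 : ℝ), (V k y : ℂ) * inner ℂ (a k y) (b k y)) := by
  intro ι e
  have : Countable ι := e.orthonormal.countable_of_separable
  simp only [hT]
  refine hasSum_sum fun k _ => ?_
  have hbm' : ∀ g, AEStronglyMeasurable (fun y => inner ℂ g (b k y)) μ₀ := fun g =>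
    (hbm k g).star.congr (Eventually.of_forall fun y => inner_conj_symm _ _)
  have hle : ∀ i y, ‖(V k y : ℂ) * (inner ℂ (a k y) (e i) * inner ℂ (e i) (b k y))‖ ≤
      |V k y| * ‖inner ℂ (a k y) (e i)‖ ^ 2 + |V k y| * ‖inner ℂ (b k y) (e i)‖ ^ 2 := by
    intro i y
    rw [norm_mul, norm_mul, Complex.norm_real, Real.norm_eq_abs, norm_inner_symm (e i), ← mul_add]
    refine mul_le_mul_of_nonneg_left ?_ (abs_nonneg _)
    nlinarith [sq_nonneg (‖inner ℂ (a k y) (e i)‖ - ‖inner ℂ (b k y) (e i)‖),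
      sq_nonneg (‖inner ℂ (a k y) (e i)‖), sq_nonneg (‖inner ℂ (b k y) (e i)‖)]
  have hia := fun i => integrableOn_potential_mul_norm_inner_sq hV ha ham (e i) k
  have hib := fun i => integrableOn_potential_mul_norm_inner_sq hV hb hbm (e i) k
  have hi : ∀ i, IntegrableOn
      (fun y => (V k y : ℂ) * (inner ℂ (a k y) (e i) * inner ℂ (e i) (b k y))) (Ioi 0) := fun i =>
    ((hia i).add (hib i)).mono' ((hV k).ofReal.1.mul ((ham k (e i)).mul (hbm' (e i))))
      (Eventually.of_forall (hle i))
  have hs : Summable fun i => ∫ y in Ioi (0 : ℝ),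
      ‖(V k y : ℂ) * (inner ℂ (a k y) (e i) * inner ℂ (e i) (b k y))‖ := by
    refine summable_of_sum_le (c := ∫ y in Ioi (0 : ℝ), |V k y| * (M ^ 2 + M ^ 2))
      (fun _ => integral_nonneg fun _ => norm_nonneg _) fun s => ?_
    rw [← integral_finsetSum _ fun i _ => (hi i).norm]
    refine setIntegral_mono_on (integrable_finsetSum _ fun i _ => (hi i).norm)
      ((hV k).abs.mul_const _) measurableSet_Ioi fun y hy => ?_
    refine (Finset.sum_le_sum fun i _ => hle i y).trans ?_
    rw [Finset.sum_add_distrib, ← Finset.mul_sum, ← Finset.mul_sum, ← mul_add]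
    have h1 := e.orthonormal.sum_inner_products_le (a k y) (s := s)
    have h2 := e.orthonormal.sum_inner_products_le (b k y) (s := s)
    simp only [norm_inner_symm (e _)] at h1 h2
    have h3 := pow_le_pow_left₀ (norm_nonneg _) (ha k y (le_of_lt hy)) 2
    have h4 := pow_le_pow_left₀ (norm_nonneg _) (hb k y (le_of_lt hy)) 2
    exact mul_le_mul_of_nonneg_left (by linarith) (abs_nonneg _)
  have h := hasSum_integral_of_summable_integral_norm hi hs
  simp only [tsum_mul_left, e.tsum_inner_mul_inner] at h
  exact h

end WeakIntegral

/-! ### The difference of the resolvents -/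

section ResolventDifference

variable {n : ℕ} {V : Fin n → ℝ → ℝ} {ζ : ℂ} {χ χ' χ₀ χ₀' : Fin n → ℝ → ℂ} {C C₀ : ℝ}

/-- Green's function of the star graph. -/
def greenKernel (V : Fin n → ℝ → ℝ) (ζ : ℂ) (χ : Fin n → ℝ → ℂ) : Fin n → Fin n → ℝ → ℝ → ℂ :=
  starKernel V ζ χ (fun j => jostTheta (V j) ζ) χ

lemma IsVertexFamily.exists_norm_greenKernel_le (h : IsVertexFamily V ζ χ χ' C) (hζ : 0 < ζ.im) :
    ∃ D, 0 ≤ D ∧ ∀ k j y x, 0 ≤ y → 0 ≤ x →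
      ‖greenKernel V ζ χ k j y x‖ ≤ D * Real.exp (-(ζ.im * |x - y|)) :=
  exists_norm_starKernel_le hζ h h.theta_le h.norm_le

lemma IsVertexFamily.aestronglyMeasurable_greenKernel (h : IsVertexFamily V ζ χ χ' C)
    (hζ : 0 < ζ.im) (hV : ∀ j, IntegrableOn (V j) (Ioi 0)) (k j : Fin n) :
    AEStronglyMeasurable (fun p : ℝ × ℝ => greenKernel V ζ χ k j p.1 p.2)
      (Measure.prod μ₀ μ₀) := by
  have hθ := fun j => (isSchrodingerSol_jostTheta (hV j) hζ).left.aestronglyMeasurable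
  have hχ := fun j => (h.sol j).left.aestronglyMeasurable
  unfold greenKernel starKernel
  refine AEStronglyMeasurable.const_mul ?_ _
  split_ifs with hjk
  · exact AEStronglyMeasurable.piecewise (s := {p : ℝ × ℝ | p.2 ≤ p.1})
      (measurableSet_le measurable_snd measurable_fst)
      ((hθ k).comp_fst.mul (hχ k).comp_snd).restrict ((hχ k).comp_fst.mul (hθ k).comp_snd).restrict
  · exact ((hθ k).comp_fst.const_mul _).mul (hθ j).comp_snd

lemma IsVertexFamily.aestronglyMeasurable_greenKernel_right (h : IsVertexFamily V ζ χ χ' C)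
    (hζ : 0 < ζ.im) (hV : ∀ j, IntegrableOn (V j) (Ioi 0)) (k j : Fin n) (y : ℝ) :
    AEStronglyMeasurable (greenKernel V ζ χ k j y) μ₀ := by
  have hθ := fun j => (isSchrodingerSol_jostTheta (hV j) hζ).left.aestronglyMeasurable
  have hχ := fun j => (h.sol j).left.aestronglyMeasurable
  unfold greenKernel starKernel
  refine AEStronglyMeasurable.const_mul ?_ _
  split_ifs with hjk
  · exact AEStronglyMeasurable.piecewise (s := Iic y) measurableSet_Iic
      ((hχ k).const_mul _).restrict ((hθ k).const_mul _).restrict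
  · exact (hθ j).const_mul _

/-- The elements of `L²(Γ)` that represent point evaluations of the resolvent. -/
lemma IsVertexFamily.exists_greenVector (h : IsVertexFamily V ζ χ χ' C)
    (hζ : 0 < ζ.im) (hV : ∀ j, IntegrableOn (V j) (Ioi 0)) :
    ∃ (M : ℝ) (a : Fin n → ℝ → StarL2 n), (∀ k y, 0 ≤ y → ‖a k y‖ ≤ M) ∧
      (∀ k y, 0 ≤ y → ∀ j, a k y j =ᵐ[μ₀] fun x => conj (greenKernel V ζ χ k j y x)) ∧
      ∀ k y, 0 ≤ y → ∀ f, inner ℂ (a k y) f = greenFun V ζ χ f k y := by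
  obtain ⟨D, hD0, hD⟩ := h.exists_norm_greenKernel_le hζ
  have hk := integrable_exp_neg_mul_abs hζ
  set N := ∫ s : ℝ, Real.exp (-(ζ.im * |s|)) with hN
  have hN0 : 0 ≤ N := integral_nonneg fun _ => (Real.exp_pos _).le
  have hsq : ∀ k j y x, 0 ≤ y → 0 < x →
      ‖greenKernel V ζ χ k j y x‖ ^ 2 ≤ D ^ 2 * Real.exp (-(ζ.im * |x - y|)) := by
    intro k j y x hy hx
    refine (pow_le_pow_left₀ (norm_nonneg _) (hD k j y x hy hx.le) 2).trans ?_
    rw [mul_pow]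
    refine mul_le_mul_of_nonneg_left ?_ (sq_nonneg D)
    have h1 := norm_exp_neg_mul_abs_le hζ (x - y)
    rw [Real.norm_of_nonneg (Real.exp_pos _).le] at h1
    nlinarith [Real.exp_pos (-(ζ.im * |x - y|))]
  have hi : ∀ y, IntegrableOn (fun x : ℝ => D ^ 2 * Real.exp (-(ζ.im * |x - y|))) (Ioi 0) :=
    fun y => ((hk.comp_sub_right y).const_mul _).integrableOn
  have hm := h.aestronglyMeasurable_greenKernel_right hζ hV
  have hL : ∀ k j y, 0 ≤ y → MemLp (greenKernel V ζ χ k j y) 2 μ₀ := fun k j y hy => by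
    rw [memLp_two_iff_integrable_sq_norm (hm k j y)]
    refine (hi y).mono' ((hm k j y).norm.pow 2) (ae_halfLine_of_forall fun x hx => ?_)
    rw [Real.norm_of_nonneg (sq_nonneg _)]
    exact hsq k j y x hy hx
  have key : ∀ k y, 0 ≤ y → ∃ a : StarL2 n, ‖a‖ ≤ √(n * (D ^ 2 * N)) ∧
      (∀ j, a j =ᵐ[μ₀] fun x => conj (greenKernel V ζ χ k j y x)) ∧
      ∀ f, inner ℂ a f = greenFun V ζ χ f k y := by
    intro k y hy
    have hae := starToLp_ae _ fun j => memLp_conj (hL k j y hy)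
    refine ⟨starToLp _ fun j => memLp_conj (hL k j y hy), Real.le_sqrt_of_sq_le ?_, hae,
      fun f => ?_⟩
    · rw [norm_sq_eq_sum_integral]
      have h1 : ∀ j, ∫ x in Ioi (0 : ℝ), ‖starToLp _ (fun j => memLp_conj (hL k j y hy)) j x‖ ^ 2 ≤
          D ^ 2 * N := by
        intro j
        have h2 : ∫ x in Ioi (0 : ℝ), ‖starToLp _ (fun j => memLp_conj (hL k j y hy)) j x‖ ^ 2 =
            ∫ x in Ioi (0 : ℝ), ‖greenKernel V ζ χ k j y x‖ ^ 2 := by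
          refine integral_congr_ae ?_
          filter_upwards [hae j] with x hx
          rw [hx, RCLike.norm_conj]
        rw [h2]
        calc _ ≤ ∫ x in Ioi (0 : ℝ), D ^ 2 * Real.exp (-(ζ.im * |x - y|)) :=
              setIntegral_mono_on ((memLp_two_iff_integrable_sq_norm (hm k j y)).1 (hL k j y hy))
                (hi y) measurableSet_Ioi fun x hx => hsq k j y x hy hx
          _ ≤ ∫ x : ℝ, D ^ 2 * Real.exp (-(ζ.im * |x - y|)) :=
              setIntegral_le_integral ((hk.comp_sub_right y).const_mul _)
                (Eventually.of_forall fun _ => by positivity)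
          _ = D ^ 2 * N := by
              rw [integral_const_mul,
                integral_sub_right_eq_self (fun s => Real.exp (-(ζ.im * |s|))) (μ := volume) y]
      refine (Finset.sum_le_sum fun j _ => h1 j).trans ?_
      simp
    · rw [star_inner_eq, greenFun]
      refine Finset.sum_congr rfl fun j _ => integral_congr_ae ?_
      filter_upwards [hae j] with x hx
      rw [hx, Complex.conj_conj, mul_comm, greenKernel]
  choose! a ha using key
  exact ⟨_, a, fun k y hy => (ha k y hy).1, fun k y hy => (ha k y hy).2.1,
    fun k y hy => (ha k y hy).2.2⟩

lemma integrableOn_zero_potential (j : Fin n) :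
    IntegrableOn ((0 : Fin n → ℝ → ℝ) j) (Ioi 0) := integrableOn_zero

/-- The second resolvent identity, in weak form. -/
lemma inner_resolvent_sub (hV : ∀ j, IntegrableOn (V j) (Ioi 0)) (hn : 0 < n) (hζ : 0 < ζ.im)
    (h : IsVertexFamily V ζ χ χ' C) (h₀ : IsVertexFamily 0 ζ χ₀ χ₀' C₀) (hG : starChar V ζ ≠ 0)
    (f g : StarL2 n) :
    inner ℂ g ((opResolvent (starSchrodinger (0 : Fin n → ℝ → ℝ)) (ζ ^ 2) -
        opResolvent (starSchrodinger V) (ζ ^ 2)) f) =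
      ∑ k, ∫ y in Ioi (0 : ℝ), (V k y : ℂ) *
        (greenFun V ζ χ f k y * greenFun 0 ζ χ₀ (starConj g) k y) := by
  have hG₀ : starChar (0 : Fin n → ℝ → ℝ) ζ ≠ 0 := starChar_zero_ne_zero hn hζ
  obtain ⟨ψ, hψ, hψR, hψe, hψf⟩ := exists_opResolvent_eq hV hζ h hG f
  obtain ⟨φ, hφ, hφR, hφe, hφf⟩ :=
    exists_opResolvent_eq integrableOn_zero_potential hζ h₀ hG₀ (starConj g)
  set R := opResolvent (starSchrodinger V) (ζ ^ 2)
  set R₀ := opResolvent (starSchrodinger (0 : Fin n → ℝ → ℝ)) (ζ ^ 2) with hR₀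
  have e1 : starForm V ψ (fun j x => conj (φ j x)) =
      starPairing (f + ζ ^ 2 • R f) (R₀ (starConj g)) := by
    rw [hψf _ hφ.complex_conj, starPairing]
    refine Finset.sum_congr rfl fun j _ => integral_congr_ae ?_
    filter_upwards [hφR j] with x hx
    rw [hx, Complex.conj_conj]
  have e2 : starForm 0 ψ (fun j x => conj (φ j x)) =
      starPairing (starConj g + ζ ^ 2 • R₀ (starConj g)) (R f) := by
    rw [starForm_conj_comm, hφf _ hψ.complex_conj, starPairing]
    refine Finset.sum_congr rfl fun j _ => integral_congr_ae ?_
    filter_upwards [hψR j] with x hx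
    rw [hx, Complex.conj_conj]
  have e3 : starForm V ψ (fun j x => conj (φ j x)) - starForm 0 ψ (fun j x => conj (φ j x)) =
      ∑ k, ∫ y in Ioi (0 : ℝ), (V k y : ℂ) *
        (greenFun V ζ χ f k y * greenFun 0 ζ χ₀ (starConj g) k y) := by
    rw [starForm, starForm, ← Finset.sum_sub_distrib]
    refine Finset.sum_congr rfl fun k _ => ?_
    simp only [Pi.zero_apply, Complex.ofReal_zero, zero_mul, integral_zero, add_zero,
      add_sub_cancel_left, Complex.conj_conj]
    refine setIntegral_congr_fun measurableSet_Ioi fun y hy => ?_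
    rw [hψe k y (le_of_lt hy), hφe k y (le_of_lt hy), mul_assoc]
  have hmem : ∀ u, (R₀ u, u + ζ ^ 2 • R₀ u) ∈ starSchrodinger (0 : Fin n → ℝ → ℝ) := fun u =>
    (isResolventAt_opResolvent
      (sq_mem_opResolventSet integrableOn_zero_potential hζ hG₀) u (R₀ u)).1 rfl
  have e4 := starPairing_symm (hmem f) (hmem (starConj g))
  have e5 : inner ℂ g (R₀ f) = starPairing (starConj g) (R₀ f) := by
    rw [starPairing_eq_inner, starConj_conj]
  have e6 : inner ℂ g (R f) = starPairing (starConj g) (R f) := by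
    rw [starPairing_eq_inner, starConj_conj]
  rw [← e3, e1, e2, sub_apply, inner_sub_right, e5, e6]
  rw [starPairing_add_left, starPairing_smul_left, starPairing_comm (R₀ f) (_ + _),
    starPairing_add_left, starPairing_smul_left, starPairing_comm (R₀ _) (R₀ f)] at e4
  rw [starPairing_add_left, starPairing_smul_left, starPairing_add_left, starPairing_smul_left,
    starPairing_comm (R₀ _) (R f)]
  linear_combination -e4

lemma inner_starConj_comm (f g : StarL2 n) :
    inner ℂ f (starConj g) = inner ℂ g (starConj f) := by
  have h : ∀ p q : StarL2 n, inner ℂ p (starConj q) = starPairing (starConj p) (starConj q) :=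
    fun p q => by rw [starPairing_eq_inner, starConj_conj]
  rw [h, h, starPairing_comm]

lemma norm_starConj (f : StarL2 n) : ‖starConj f‖ = ‖f‖ := by
  rw [← sq_eq_sq₀ (norm_nonneg _) (norm_nonneg _), norm_sq_eq_sum_integral,
    norm_sq_eq_sum_integral]
  refine Finset.sum_congr rfl fun j _ => integral_congr_ae ?_
  filter_upwards [starConj_ae f j] with x hx
  rw [hx, RCLike.norm_conj]

lemma IsTraceClass.neg {E : Type*} [NormedAddCommGroup E] [InnerProductSpace ℂ E] {T : E →L[ℂ] E}
    (h : IsTraceClass T) : IsTraceClass (-T) := by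
  obtain ⟨x, y, hs, hT⟩ := h
  refine ⟨x, fun i => -y i, by simpa using hs, fun f => ?_⟩
  simpa using (hT f).neg

/-- The difference of the resolvents is trace class, its trace being the integral over `Γ × Γ` of
`V` and the product of the two Green's functions. -/
lemma isTraceClass_and_hasTrace (hV : ∀ j, IntegrableOn (V j) (Ioi 0)) (hn : 0 < n)
    (hζ : 0 < ζ.im) (h : IsVertexFamily V ζ χ χ' C) (h₀ : IsVertexFamily 0 ζ χ₀ χ₀' C₀)
    (hG : starChar V ζ ≠ 0) :
    IsTraceClass (opResolvent (starSchrodinger V) (ζ ^ 2) -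
        opResolvent (starSchrodinger (0 : Fin n → ℝ → ℝ)) (ζ ^ 2)) ∧
      HasTrace (opResolvent (starSchrodinger (0 : Fin n → ℝ → ℝ)) (ζ ^ 2) -
        opResolvent (starSchrodinger V) (ζ ^ 2)) (∑ k, ∫ y in Ioi (0 : ℝ), (V k y : ℂ) *
          ∑ j, ∫ x in Ioi (0 : ℝ), greenKernel V ζ χ k j y x * greenKernel 0 ζ χ₀ k j y x) := by
  have hG₀ : starChar (0 : Fin n → ℝ → ℝ) ζ ≠ 0 := starChar_zero_ne_zero hn hζ
  obtain ⟨M, a, haM, ha, haf⟩ := h.exists_greenVector hζ hV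
  obtain ⟨M₀, b, hbM, hb, hbf⟩ := h₀.exists_greenVector hζ integrableOn_zero_potential
  have ham : ∀ k f, AEStronglyMeasurable (fun y => inner ℂ (a k y) f) μ₀ := fun k f => by
    obtain ⟨ψ, hψ, -, hψe, -⟩ := exists_opResolvent_eq hV hζ h hG f
    exact (hψ.edge k).hasACDeriv.aestronglyMeasurable.congr
      (ae_halfLine_of_forall fun y hy => (hψe k y hy.le).trans (haf k y hy.le f).symm)
  have hbm : ∀ k f, AEStronglyMeasurable (fun y => inner ℂ (b k y) f) μ₀ := fun k f => by
    obtain ⟨ψ, hψ, -, hψe, -⟩ :=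
      exists_opResolvent_eq integrableOn_zero_potential hζ h₀ hG₀ f
    exact (hψ.edge k).hasACDeriv.aestronglyMeasurable.congr
      (ae_halfLine_of_forall fun y hy => (hψe k y hy.le).trans (hbf k y hy.le f).symm)
  have hcM : ∀ k y, 0 ≤ y → ‖starConj (b k y)‖ ≤ M₀ := fun k y hy => by
    rw [norm_starConj]
    exact hbM k y hy
  have hcm : ∀ k f, AEStronglyMeasurable (fun y => inner ℂ (starConj (b k y)) f) μ₀ := fun k f =>
    (hbm k (starConj f)).star.congr (Eventually.of_forall fun y => by
      have h1 := inner_starConj_comm (starConj (b k y)) (starConj f)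
      rw [starConj_conj, starConj_conj] at h1
      exact (inner_conj_symm _ _).trans h1.symm)
  have hT : ∀ f g, inner ℂ g ((opResolvent (starSchrodinger (0 : Fin n → ℝ → ℝ)) (ζ ^ 2) -
        opResolvent (starSchrodinger V) (ζ ^ 2)) f) = ∑ k, ∫ y in Ioi (0 : ℝ),
        (V k y : ℂ) * (inner ℂ (a k y) f * inner ℂ g (starConj (b k y))) := fun f g => by
    rw [inner_resolvent_sub hV hn hζ h h₀ hG]
    refine Finset.sum_congr rfl fun k _ => setIntegral_congr_fun measurableSet_Ioi fun y hy => ?_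
    rw [haf k y (le_of_lt hy), inner_starConj_comm, hbf k y (le_of_lt hy)]
  have haM' : ∀ k y, 0 ≤ y → ‖a k y‖ ≤ max M M₀ := fun k y hy => (haM k y hy).trans (le_max_left _ _)
  have hcM' : ∀ k y, 0 ≤ y → ‖starConj (b k y)‖ ≤ max M M₀ := fun k y hy =>
    (hcM k y hy).trans (le_max_right _ _)
  constructor
  · rw [← neg_sub]
    exact (isTraceClass_of_weak_integral hV haM' ham hcM' hcm hT).neg
  · convert hasTrace_of_weak_integral hV haM' ham hcM' hcm hT using 1
    refine Finset.sum_congr rfl fun k _ => setIntegral_congr_fun measurableSet_Ioi fun y hy => ?_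
    rw [star_inner_eq]
    congr 1
    refine Finset.sum_congr rfl fun j _ => integral_congr_ae ?_
    filter_upwards [ha k y (le_of_lt hy) j, hb k y (le_of_lt hy) j, starConj_ae (b k y) j]
      with x h1 h2 h3
    rw [h3, h1, h2, Complex.conj_conj, Complex.conj_conj, mul_comm]

end ResolventDifference

/-! ### Derivatives of the Jost solution with respect to the spectral parameter -/

section DerivJost

variable {v : ℝ → ℝ} {ζ : ℂ}

lemma hasDerivAt_jostTheta (hv : IntegrableOn v (Ioi 0)) (hζ : 0 < ζ.im) {x : ℝ} (hx : 0 ≤ x) :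
    HasDerivAt (fun η => jostTheta v η x) (Complex.exp (Complex.I * ζ * x) *
      (Complex.I * x * jostM v ζ x + deriv (fun η => jostM v η x) ζ)) ζ := by
  have hU : {ζ : ℂ | 0 < ζ.im} ∈ 𝓝 ζ :=
    (isOpen_lt continuous_const Complex.continuous_im).mem_nhds hζ
  have h1 := ((differentiableOn_jostM hv hx).differentiableAt hU).hasDerivAt
  have h2 : HasDerivAt (fun η : ℂ => Complex.exp (Complex.I * η * x))
      (Complex.exp (Complex.I * ζ * x) * (Complex.I * 1 * x)) ζ :=
    (((hasDerivAt_id ζ).const_mul Complex.I).mul_const (x : ℂ)).cexp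
  refine (h2.mul h1).congr_deriv ?_
  ring

lemma hasDerivAt_jostTheta' (hv : IntegrableOn v (Ioi 0)) (hζ : 0 < ζ.im) {x : ℝ} (hx : 0 ≤ x) :
    HasDerivAt (fun η => jostTheta' v η x) (Complex.exp (Complex.I * ζ * x) *
      (Complex.I * x * (Complex.I * ζ * jostM v ζ x + jostM' v ζ x) + Complex.I * jostM v ζ x +
        Complex.I * ζ * deriv (fun η => jostM v η x) ζ + deriv (fun η => jostM' v η x) ζ)) ζ := by
  have hU : {ζ : ℂ | 0 < ζ.im} ∈ 𝓝 ζ :=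
    (isOpen_lt continuous_const Complex.continuous_im).mem_nhds hζ
  have h1 := ((differentiableOn_jostM hv hx).differentiableAt hU).hasDerivAt
  have h1' := ((differentiableOn_jostM' hv hx).differentiableAt hU).hasDerivAt
  have h2 : HasDerivAt (fun η : ℂ => Complex.exp (Complex.I * η * x))
      (Complex.exp (Complex.I * ζ * x) * (Complex.I * 1 * x)) ζ :=
    (((hasDerivAt_id ζ).const_mul Complex.I).mul_const (x : ℂ)).cexp
  have h3 : HasDerivAt (fun η : ℂ => Complex.I * η) (Complex.I * 1) ζ :=
    (hasDerivAt_id ζ).const_mul Complex.I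
  refine (h2.mul ((h3.mul h1).add h1')).congr_deriv ?_
  simp only [Pi.add_apply, Pi.mul_apply]
  ring

/-- The Wronskian of a solution `y` with the derivative of the Jost solution in `ζ`. -/
def derivWronskian (v : ℝ → ℝ) (ζ : ℂ) (y p : ℝ → ℂ) (x : ℝ) : ℂ :=
  y x * deriv (fun η => jostTheta' v η x) ζ - p x * deriv (fun η => jostTheta v η x) ζ

/-- Integrals of products with a Jost solution, by differentiation of the Wronskian of `y` and the
Jost solution at `η` in the parameter `η` at `η = ζ`. -/
lemma IsSchrodingerSol.integral_mul_jostTheta (hv : IntegrableOn v (Ioi 0)) (hζ : 0 < ζ.im)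
    {y p : ℝ → ℂ} (h : IsSchrodingerSol v (ζ ^ 2) y p) {X : ℝ} (hX : 0 ≤ X) :
    2 * ζ * ∫ x in (0 : ℝ)..X, y x * jostTheta v ζ x =
      derivWronskian v ζ y p 0 - derivWronskian v ζ y p X := by
  have hU : IsOpen {η : ℂ | ζ.im / 2 < η.im} := isOpen_lt continuous_const Complex.continuous_im
  have hζU : ζ ∈ {η : ℂ | ζ.im / 2 < η.im} := half_lt_self hζ
  have hpos : ∀ η ∈ {η : ℂ | ζ.im / 2 < η.im}, 0 < η.im := fun η hη => (half_pos hζ).trans hη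
  have hle : ∀ η ∈ {η : ℂ | ζ.im / 2 < η.im}, ζ.im / 2 ≤ ‖η‖ := fun η hη =>
    (le_of_lt hη).trans ((le_abs_self _).trans (Complex.abs_im_le_norm η))
  have h4 : 0 ≤ ∫ t in Ioi (0 : ℝ), |v t| := integral_nonneg fun _ => abs_nonneg _
  have hyc : ContinuousOn y (Icc 0 X) := h.left.continuousOn.mono Icc_subset_Ici_self
  have hF := differentiableOn_integral_of_dominated (μ := volume.restrict (Ioc 0 X)) hU
    (F := fun η x => y x * jostTheta v η x)
    (bound := fun x => ‖y x‖ * Real.exp (1 / (ζ.im / 2) * ∫ t in Ioi (0 : ℝ), |v t|))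
    (fun η hη => ((h.left.continuousOn.mul
      (isSchrodingerSol_jostTheta hv (hpos η hη)).left.continuousOn).mono
        (Ioc_subset_Ioi_self.trans Ioi_subset_Ici_self)).aestronglyMeasurable measurableSet_Ioc)
    ((ae_restrict_iff' measurableSet_Ioc).2 (Eventually.of_forall fun x hx η hη =>
      ((hasDerivAt_jostTheta hv (hpos η hη) hx.1.le).differentiableAt.const_mul
        (y x)).differentiableWithinAt))
    ((ae_restrict_iff' measurableSet_Ioc).2 (Eventually.of_forall fun x hx η hη => by
      rw [norm_mul, jostTheta, norm_mul, norm_exp_I_mul]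
      refine mul_le_mul_of_nonneg_left ?_ (norm_nonneg _)
      have h1 : Real.exp (-(η.im * x)) ≤ 1 := Real.exp_le_one_iff.2 (by
        have := mul_nonneg (hpos η hη).le hx.1.le
        linarith)
      have h2 := norm_jostM_le hv (hpos η hη) hx.1.le
      refine (mul_le_of_le_one_left (norm_nonneg _) h1).trans (h2.trans ?_)
      have h3 := hle η hη
      have h5 : 0 < ζ.im / 2 := half_pos hζ
      gcongr))
    ((hyc.norm.integrableOn_Icc.mono_set Ioc_subset_Icc_self).mul_const _)
  have hF' := (hF.differentiableAt (hU.mem_nhds hζU)).hasDerivAt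
  have hQ : HasDerivAt (fun η : ℂ => ζ ^ 2 - η ^ 2) (-(2 * ζ)) ζ := by
    refine ((hasDerivAt_pow 2 ζ).const_sub (ζ ^ 2)).congr_deriv ?_
    norm_num
  have hR := hQ.mul hF'
  have hW : ∀ x, 0 ≤ x → HasDerivAt (fun η => y x * jostTheta' v η x - p x * jostTheta v η x)
      (derivWronskian v ζ y p x) ζ := fun x hx =>
    ((hasDerivAt_jostTheta' hv hζ hx).differentiableAt.hasDerivAt.const_mul (y x)).sub
      ((hasDerivAt_jostTheta hv hζ hx).differentiableAt.hasDerivAt.const_mul (p x))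
  have hL := (hW X hX).sub (hW 0 le_rfl)
  have heq : (fun η => (y X * jostTheta' v η X - p X * jostTheta v η X) -
      (y 0 * jostTheta' v η 0 - p 0 * jostTheta v η 0)) =ᶠ[𝓝 ζ]
      fun η => (ζ ^ 2 - η ^ 2) * ∫ x in Ioc 0 X, y x * jostTheta v η x := by
    filter_upwards [hU.mem_nhds hζU] with η hη
    have h1 := (h.wronskian (isSchrodingerSol_jostTheta hv (hpos η hη))).integral_eq_sub le_rfl hX
    rw [← h1, ← intervalIntegral.integral_of_le hX, ← intervalIntegral.integral_const_mul]
    congr 1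
    funext x
    ring
  -- at `η = ζ` the factor `ζ² - η²` vanishes, so that only its own derivative contributes
  have h1 := (hR.congr_of_eventuallyEq heq).unique hL
  rw [intervalIntegral.integral_of_le hX]
  linear_combination -h1

end DerivJost

section DiagonalAsymptotics

variable {n : ℕ} {V : Fin n → ℝ → ℝ} {ζ : ℂ} {χ χ' : Fin n → ℝ → ℂ} {C : ℝ}

/-- Asymptotics of the Wronskian with the derivative of the Jost solution. -/
lemma IsVertexFamily.tendsto_derivWronskian (h : IsVertexFamily V ζ χ χ' C) (hζ : 0 < ζ.im)
    (hV : ∀ j, IntegrableOn (V j) (Ioi 0)) (j : Fin n) :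
    Tendsto (fun x : ℝ => derivWronskian (V j) ζ (χ j) (χ' j) x - Complex.I * x * starChar V ζ)
      atTop (𝓝 (starChar V ζ / (2 * ζ))) := by
  have hζ0 := ne_zero_of_im_pos hζ
  set G := starChar V ζ with hG
  set m := jostM (V j) ζ
  set m' := jostM' (V j) ζ
  set d := fun x => deriv (fun η => jostM (V j) η x) ζ
  set d' := fun x => deriv (fun η => jostM' (V j) η x) ζ
  set e := fun x : ℝ => Complex.exp (Complex.I * ζ * x) with he
  have tm : Tendsto m atTop (𝓝 1) := tendsto_jostM (hV j) hζ
  have tm' : Tendsto m' atTop (𝓝 0) := tendsto_jostM' (hV j) hζ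
  have td : Tendsto d atTop (𝓝 0) := tendsto_deriv_jostM (hV j) hζ
  have td' : Tendsto d' atTop (𝓝 0) := tendsto_deriv_jostM' (hV j) hζ
  have tb := h.tendsto j
  have hden : Tendsto (fun x => 2 * Complex.I * ζ * m x + m' x) atTop (𝓝 (2 * Complex.I * ζ)) := by
    simpa using (tm.const_mul (2 * Complex.I * ζ)).add tm'
  have hne : 2 * Complex.I * ζ ≠ 0 := by simp [hζ0]
  have hwr : ∀ x, 0 ≤ x → χ j x * (e x * (Complex.I * ζ * m x + m' x)) - χ' j x * (e x * m x) = G :=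
    fun x hx => h.wronskian_eq hV hζ j hx
  -- the constant Wronskian with the Jost solution determines the amplitude of `χ`
  have ta : Tendsto (fun x => e x * χ j x) atTop (𝓝 (G / (2 * Complex.I * ζ))) := by
    have h1 := ((tb.mul tm).const_add G).div hden hne
    simp only [zero_mul, add_zero] at h1
    refine h1.congr' ?_
    filter_upwards [eventually_ge_atTop 0, hden.eventually_ne hne] with x hx hx'
    rw [Pi.div_apply, div_eq_iff hx', ← hwr x hx]
    ring
  have tc : Tendsto (fun x => e x * χ' j x) atTop (𝓝 (-(G / 2))) := by
    have h1 := tb.sub (ta.const_mul (Complex.I * ζ))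
    have h2 : 0 - Complex.I * ζ * (G / (2 * Complex.I * ζ)) = -(G / 2) := by
      field_simp
      ring
    rw [h2] at h1
    refine h1.congr fun x => ?_
    simp only [he]
    ring
  have hlim := (ta.mul (((tm.const_mul Complex.I).add (td.const_mul (Complex.I * ζ))).add td')).sub
    (tc.mul td)
  have h2 : G / (2 * Complex.I * ζ) * (Complex.I * 1 + Complex.I * ζ * 0 + 0) - -(G / 2) * 0 =
      G / (2 * ζ) := by
    field_simp
    ring
  rw [h2] at hlim
  refine hlim.congr' ?_
  filter_upwards [eventually_ge_atTop 0] with x hx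
  rw [derivWronskian, (hasDerivAt_jostTheta' (hV j) hζ hx).deriv,
    (hasDerivAt_jostTheta (hV j) hζ hx).deriv, ← hwr x hx]
  ring

/-- The characteristic function is holomorphic; its derivative at `ζ` is the sum of the Wronskians
at the vertex. -/
lemma IsVertexFamily.hasDerivAt_starChar (h : IsVertexFamily V ζ χ χ' C) (hζ : 0 < ζ.im)
    (hV : ∀ j, IntegrableOn (V j) (Ioi 0)) :
    HasDerivAt (starChar V) (∑ j, derivWronskian (V j) ζ (χ j) (χ' j) 0) ζ := by
  have hw := fun j => (hasDerivAt_jostTheta (hV j) hζ le_rfl).differentiableAt.hasDerivAt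
  have hp := fun j => (hasDerivAt_jostTheta' (hV j) hζ le_rfl).differentiableAt.hasDerivAt
  have hc : ∀ j, HasDerivAt (fun η => cofactor (fun k => jostTheta (V k) η 0) j)
      (∑ k ∈ Finset.univ.erase j, cofactor₂ (fun k => jostTheta (V k) ζ 0) j k *
        deriv (fun η => jostTheta (V k) η 0) ζ) ζ := fun j => by
    have := HasDerivAt.fun_finsetProd (u := Finset.univ.erase j) fun k _ => hw k
    simp only [smul_eq_mul] at this
    exact this
  have hs := HasDerivAt.fun_sum (u := Finset.univ) fun j _ => (hp j).mul (hc j)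
  refine hs.congr_deriv ?_
  have e1 : ∀ j, derivWronskian (V j) ζ (χ j) (χ' j) 0 =
      deriv (fun η => jostTheta' (V j) η 0) ζ * cofactor (fun k => jostTheta (V k) ζ 0) j +
      ∑ k ∈ Finset.univ.erase j, cofactor₂ (fun k => jostTheta (V k) ζ 0) j k *
        jostTheta' (V k) ζ 0 * deriv (fun η => jostTheta (V j) η 0) ζ := fun j => by
    rw [derivWronskian, h.zero, h.zero', cofactorSum, ← Finset.sum_mul]
    ring
  rw [Finset.sum_congr rfl fun j _ => e1 j, Finset.sum_add_distrib, Finset.sum_add_distrib]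
  congr 1
  simp only [Finset.mul_sum]
  rw [Finset.sum_comm' (t' := Finset.univ) (s' := fun k => Finset.univ.erase k)
    (by simp [eq_comm])]
  refine Finset.sum_congr rfl fun j _ => Finset.sum_congr rfl fun k _ => ?_
  rw [cofactor₂_comm]
  ring

/-- The regularized trace of Green's function is the logarithmic derivative of the characteristic
function. -/
lemma tendsto_sum_integral_diagonal {χ₀ χ₀' : Fin n → ℝ → ℂ} {C₀ : ℝ}
    (h : IsVertexFamily V ζ χ χ' C) (h₀ : IsVertexFamily 0 ζ χ₀ χ₀' C₀) (hn : 0 < n)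
    (hζ : 0 < ζ.im) (hV : ∀ j, IntegrableOn (V j) (Ioi 0)) (hG : starChar V ζ ≠ 0) :
    Tendsto (fun X : ℝ => ∑ j, ∫ x in (0 : ℝ)..X, (χ j x * jostTheta (V j) ζ x / starChar V ζ -
      χ₀ j x * jostTheta 0 ζ x / starChar (0 : Fin n → ℝ → ℝ) ζ)) atTop
      (𝓝 (1 / (2 * ζ) * (deriv (starChar V) ζ / starChar V ζ - 1 / ζ))) := by
  have hζ0 := ne_zero_of_im_pos hζ
  have hV₀ := integrableOn_zero_potential (n := n)
  have hG₀ := starChar_zero_ne_zero hn hζ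
  have hD := (h.hasDerivAt_starChar hζ hV).deriv
  have hD₀ := (h₀.hasDerivAt_starChar hζ hV₀).deriv
  have hd₀ : deriv (starChar (0 : Fin n → ℝ → ℝ)) ζ = n * Complex.I := by
    have h1 : starChar (0 : Fin n → ℝ → ℝ) =ᶠ[𝓝 ζ] fun η => n * (Complex.I * η) := by
      filter_upwards [(isOpen_lt continuous_const Complex.continuous_im).mem_nhds hζ] with η hη
      exact starChar_zero hη
    rw [h1.deriv_eq]
    have h2 := ((hasDerivAt_id ζ).const_mul Complex.I).const_mul (n : ℂ)
    rw [mul_one] at h2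
    exact h2.deriv
  have hq : deriv (starChar (0 : Fin n → ℝ → ℝ)) ζ / starChar (0 : Fin n → ℝ → ℝ) ζ = 1 / ζ := by
    have hn' : (n : ℂ) ≠ 0 := by exact_mod_cast hn.ne'
    rw [hd₀, starChar_zero hζ]
    field_simp
  set G := starChar V ζ with hGdef
  set G₀ := starChar (0 : Fin n → ℝ → ℝ) ζ with hG₀def
  set W := fun j x => derivWronskian (V j) ζ (χ j) (χ' j) x
  set W₀ := fun j x => derivWronskian ((0 : Fin n → ℝ → ℝ) j) ζ (χ₀ j) (χ₀' j) x
  have hlim : Tendsto (fun X : ℝ => 1 / (2 * ζ) * ∑ j, ((W j 0 / G - W₀ j 0 / G₀) -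
      ((W j X - Complex.I * X * G) / G - (W₀ j X - Complex.I * X * G₀) / G₀))) atTop
      (𝓝 (1 / (2 * ζ) * ∑ j : Fin n, ((W j 0 / G - W₀ j 0 / G₀) -
        (G / (2 * ζ) / G - G₀ / (2 * ζ) / G₀)))) :=
    (tendsto_finsetSum _ fun j _ => (((h.tendsto_derivWronskian hζ hV j).div_const G).sub
      ((h₀.tendsto_derivWronskian hζ hV₀ j).div_const G₀)).const_sub _).const_mul _
  have hval : 1 / (2 * ζ) * ∑ j : Fin n, ((W j 0 / G - W₀ j 0 / G₀) -
        (G / (2 * ζ) / G - G₀ / (2 * ζ) / G₀)) =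
      1 / (2 * ζ) * (deriv (starChar V) ζ / G - 1 / ζ) := by
    rw [← hq, hD, hD₀, Finset.sum_div, Finset.sum_div, ← Finset.sum_sub_distrib]
    congr 1
    refine Finset.sum_congr rfl fun j _ => ?_
    have : G / (2 * ζ) / G - G₀ / (2 * ζ) / G₀ = 0 := by
      field_simp
      ring
    rw [this, sub_zero]
  rw [hval] at hlim
  refine hlim.congr' ?_
  filter_upwards [eventually_ge_atTop 0] with X hX
  rw [Finset.mul_sum]
  refine Finset.sum_congr rfl fun j _ => ?_
  have i1 : IntervalIntegrable (fun x => χ j x * jostTheta (V j) ζ x / G) volume 0 X :=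
    ((((h.sol j).left.continuousOn.mul
      (isSchrodingerSol_jostTheta (hV j) hζ).left.continuousOn).div_const G).mono
        (by rw [uIcc_of_le hX]; exact Icc_subset_Ici_self)).intervalIntegrable
  have i2 : IntervalIntegrable (fun x => χ₀ j x * jostTheta 0 ζ x / G₀) volume 0 X :=
    ((((h₀.sol j).left.continuousOn.mul
      (isSchrodingerSol_jostTheta (hV₀ j) hζ).left.continuousOn).div_const G₀).mono
        (by rw [uIcc_of_le hX]; exact Icc_subset_Ici_self)).intervalIntegrable
  have e1 := (h.sol j).integral_mul_jostTheta (hV j) hζ hX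
  have e2 := (h₀.sol j).integral_mul_jostTheta (hV₀ j) hζ hX
  rw [intervalIntegral.integral_sub i1 i2, intervalIntegral.integral_div,
    intervalIntegral.integral_div]
  have hne : 2 * ζ ≠ 0 := by simp [hζ0]
  have e1' : ∫ x in (0 : ℝ)..X, χ j x * jostTheta (V j) ζ x = (W j 0 - W j X) / (2 * ζ) := by
    rw [eq_div_iff hne, mul_comm]
    exact e1
  have e2' : ∫ x in (0 : ℝ)..X, χ₀ j x * jostTheta 0 ζ x = (W₀ j 0 - W₀ j X) / (2 * ζ) := by
    rw [eq_div_iff hne, mul_comm]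
    exact e2
  rw [e1', e2']
  field_simp
  ring

end DiagonalAsymptotics

/-! ### Evaluation of the trace -/

section TraceEvaluation

variable {n : ℕ} {V : Fin n → ℝ → ℝ} {ζ : ℂ} {χ χ' χ₀ χ₀' : Fin n → ℝ → ℂ} {C C₀ : ℝ}

/-- The integrand of the trace is integrable over the product of two edges. -/
lemma integrable_potential_mul_greenKernel (h : IsVertexFamily V ζ χ χ' C)
    (h₀ : IsVertexFamily 0 ζ χ₀ χ₀' C₀) (hζ : 0 < ζ.im) (hV : ∀ j, IntegrableOn (V j) (Ioi 0))
    (k j : Fin n) :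
    Integrable (fun p : ℝ × ℝ => (V k p.1 : ℂ) *
      (greenKernel V ζ χ k j p.1 p.2 * greenKernel 0 ζ χ₀ k j p.1 p.2)) (Measure.prod μ₀ μ₀) := by
  obtain ⟨D, hD0, hD⟩ := h.exists_norm_greenKernel_le hζ
  obtain ⟨D₀, hD₀0, hD₀⟩ := h₀.exists_norm_greenKernel_le hζ
  have hm := (hV k).ofReal.1.comp_fst (ν := μ₀) |>.mul
    ((h.aestronglyMeasurable_greenKernel hζ hV k j).mul
      (h₀.aestronglyMeasurable_greenKernel hζ integrableOn_zero_potential k j))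
  have hconv := (Integrable.convolution_integrand (ContinuousLinearMap.mul ℝ ℝ)
    (IntegrableOn.integrable_indicator (hV k).abs measurableSet_Ioi)
    (integrable_exp_neg_mul_abs hζ)).swap
  have hb : Integrable (fun p : ℝ × ℝ => D * D₀ *
      (|V k p.1| * Real.exp (-(ζ.im * |p.2 - p.1|)))) (Measure.prod μ₀ μ₀) := by
    rw [Measure.prod_restrict]
    refine Integrable.const_mul ?_ _
    refine hconv.integrableOn.congr_fun (fun p hp => ?_) (measurableSet_Ioi.prod measurableSet_Ioi)
    simp only [Function.comp_apply, Prod.fst_swap, Prod.snd_swap, ContinuousLinearMap.mul_apply']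
    rw [indicator_of_mem hp.1]
  refine hb.mono' hm ?_
  rw [Measure.prod_restrict, ae_restrict_iff' (measurableSet_Ioi.prod measurableSet_Ioi)]
  refine Eventually.of_forall fun p hp => ?_
  have hp1 : 0 < p.1 := hp.1
  have hp2 : 0 < p.2 := hp.2
  have h1 := hD k j p.1 p.2 hp1.le hp2.le
  have h2 := hD₀ k j p.1 p.2 hp1.le hp2.le
  have h3 := norm_exp_neg_mul_abs_le hζ (p.2 - p.1)
  rw [Real.norm_of_nonneg (Real.exp_pos _).le] at h3
  set E := Real.exp (-(ζ.im * |p.2 - p.1|)) with hE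
  have hE0 : 0 < E := Real.exp_pos _
  rw [norm_mul, norm_mul, Complex.norm_real, Real.norm_eq_abs]
  calc |V k p.1| * (‖greenKernel V ζ χ k j p.1 p.2‖ * ‖greenKernel 0 ζ χ₀ k j p.1 p.2‖)
      ≤ |V k p.1| * ((D * E) * (D₀ * 1)) := by
        refine mul_le_mul_of_nonneg_left (mul_le_mul h1 (h2.trans ?_) (norm_nonneg _)
          (by positivity)) (abs_nonneg _)
        gcongr
    _ = D * D₀ * (|V k p.1| * E) := by ring

/-- The Wronskian of a solution for the potential `v` and a free solution. -/
lemma IsSchrodingerSol.wronskian_free {v : ℝ → ℝ} {z : ℂ} {y p y₀ p₀ : ℝ → ℂ}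
    (h : IsSchrodingerSol v z y p) (h₀ : IsSchrodingerSol 0 z y₀ p₀) :
    HasACDeriv (fun x => p x * y₀ x - y x * p₀ x) (fun x => (v x : ℂ) * (y x * y₀ x)) :=
  ((h.wronskian h₀).const_mul (-1)).congr' (fun x _ => by ring) fun x _ => by
    simp only [Pi.zero_apply, Complex.ofReal_zero]
    ring

/-- Integration of the potential against the product of the two Green's functions gives the
difference of their diagonals. -/
lemma sum_integral_potential_mul_greenKernel (h : IsVertexFamily V ζ χ χ' C)
    (h₀ : IsVertexFamily 0 ζ χ₀ χ₀' C₀) (hn : 0 < n) (hζ : 0 < ζ.im)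
    (hV : ∀ j, IntegrableOn (V j) (Ioi 0)) (hG : starChar V ζ ≠ 0) (j : Fin n) {x : ℝ}
    (hx : 0 < x) :
    ∑ k, ∫ y in Ioi (0 : ℝ), (V k y : ℂ) *
        (greenKernel V ζ χ k j y x * greenKernel 0 ζ χ₀ k j y x) =
      χ j x * jostTheta (V j) ζ x / starChar V ζ -
        χ₀ j x * jostTheta 0 ζ x / starChar (0 : Fin n → ℝ → ℝ) ζ := by
  have hV₀ := integrableOn_zero_potential (n := n)
  have hG₀ := starChar_zero_ne_zero hn hζ
  have hθ := fun k => isSchrodingerSol_jostTheta (hV k) hζ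
  have hθ₀ : IsSchrodingerSol 0 (ζ ^ 2) (jostTheta 0 ζ) (jostTheta' 0 ζ) :=
    isSchrodingerSol_jostTheta (v := 0) integrableOn_zero hζ
  set w := fun l => jostTheta (V l) ζ 0 with hw
  set w₀ := fun l => jostTheta ((0 : Fin n → ℝ → ℝ) l) ζ 0 with hw₀
  set G := starChar V ζ
  set G₀ := starChar (0 : Fin n → ℝ → ℝ) ζ
  -- the Wronskians of Jost solutions, which vanish at infinity
  have hint : ∀ k, IntegrableOn (fun y => (V k y : ℂ) * (jostTheta (V k) ζ y * jostTheta 0 ζ y))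
      (Ioi 0) := fun k => by
    refine (integrableOn_potential_mul (C := C) (D := C₀) (hV k)
      (hθ k).left.aestronglyMeasurable hθ₀.left.aestronglyMeasurable
      (fun x hx => (h.theta_le k x hx).trans ?_)
      (fun x hx => (h₀.theta_le k x hx).trans ?_)).congr
        (Eventually.of_forall fun y => mul_assoc _ _ _)
    all_goals
      refine mul_le_of_le_one_right ?_ (Real.exp_le_one_iff.2 (neg_nonpos.2
        (mul_nonneg hζ.le hx)))
    exacts [h.nonneg, h₀.nonneg]
  have hzero : ∀ k, Tendsto (fun y => jostTheta' (V k) ζ y * jostTheta 0 ζ y -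
      jostTheta (V k) ζ y * jostTheta' 0 ζ y) atTop (𝓝 0) := fun k => by
    have he : Tendsto (fun y : ℝ => 2 * (C * C₀) * Real.exp (-(ζ.im * y))) atTop (𝓝 0) := by
      simpa using (Real.tendsto_exp_neg_atTop_nhds_zero.comp
        (tendsto_id.const_mul_atTop hζ)).const_mul (2 * (C * C₀))
    refine squeeze_zero_norm' ?_ he
    filter_upwards [eventually_ge_atTop 0] with y hy
    have hE0 : 0 < Real.exp (-(ζ.im * y)) := Real.exp_pos _
    have hE1 : Real.exp (-(ζ.im * y)) ≤ 1 :=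
      Real.exp_le_one_iff.2 (neg_nonpos.2 (mul_nonneg hζ.le hy))
    have hC := h.nonneg
    have hC₀ := h₀.nonneg
    have key : ∀ {a b : ℂ}, ‖a‖ ≤ C * Real.exp (-(ζ.im * y)) → ‖b‖ ≤ C₀ * Real.exp (-(ζ.im * y)) →
        ‖a * b‖ ≤ C * C₀ * Real.exp (-(ζ.im * y)) := by
      intro a b h1 h2
      rw [norm_mul]
      calc ‖a‖ * ‖b‖ ≤ (C * Real.exp (-(ζ.im * y))) * (C₀ * 1) := by
            refine mul_le_mul h1 (h2.trans ?_) (norm_nonneg _) (by positivity)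
            gcongr
        _ = _ := by ring
    have h1 := key (h.theta_le' k y hy) (h₀.theta_le k y hy)
    have h2 := key (h.theta_le k y hy) (h₀.theta_le' k y hy)
    refine (norm_sub_le _ _).trans ?_
    simp only [Pi.zero_apply] at h1 h2
    linarith
  have hIoi : ∀ k y, 0 ≤ y → ∫ t in Ioi y, (V k t : ℂ) * (jostTheta (V k) ζ t * jostTheta 0 ζ t) =
      -(jostTheta' (V k) ζ y * jostTheta 0 ζ y - jostTheta (V k) ζ y * jostTheta' 0 ζ y) :=
    fun k y hy => ((hθ k).wronskian_free hθ₀).setIntegral_Ioi (hint k) (hzero k) hy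
  have hχW := (h.sol j).wronskian_free (h₀.sol j)
  -- the diagonal term
  have hdiag : ∫ y in Ioi (0 : ℝ), (V j y : ℂ) *
      (greenKernel V ζ χ j j y x * greenKernel 0 ζ χ₀ j j y x) = 1 / G * (1 / G₀) *
      (jostTheta (V j) ζ x * jostTheta 0 ζ x * ((χ' j x * χ₀ j x - χ j x * χ₀' j x) -
          (χ' j 0 * χ₀ j 0 - χ j 0 * χ₀' j 0)) -
        χ j x * χ₀ j x * (jostTheta' (V j) ζ x * jostTheta 0 ζ x -
          jostTheta (V j) ζ x * jostTheta' 0 ζ x)) := by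
    have i1 : IntegrableOn (fun y => (V j y : ℂ) * (χ j y * χ₀ j y)) (Ioc 0 x) :=
      (intervalIntegrable_iff_integrableOn_Ioc_of_le hx.le).1 (hχW.intervalIntegrable x hx.le)
    have i2 : IntegrableOn (fun y => (V j y : ℂ) * (jostTheta (V j) ζ y * jostTheta 0 ζ y))
      (Ioi x) := (hint j).mono_set (Ioi_subset_Ioi hx.le)
    -- open at `x`, because the first branch of the kernel includes the diagonal
    have e1 : ∀ y ∈ Ioo 0 x, 1 / G * (1 / G₀) * (jostTheta (V j) ζ x * jostTheta 0 ζ x) *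
        ((V j y : ℂ) * (χ j y * χ₀ j y)) =
        (V j y : ℂ) * (greenKernel V ζ χ j j y x * greenKernel 0 ζ χ₀ j j y x) := fun y hy => by
      simp only [greenKernel, starKernel, if_pos, if_neg (not_le.2 hy.2), Pi.zero_apply]
      ring
    have e2 : ∀ y ∈ Ioi x, 1 / G * (1 / G₀) * (χ j x * χ₀ j x) *
        ((V j y : ℂ) * (jostTheta (V j) ζ y * jostTheta 0 ζ y)) =
        (V j y : ℂ) * (greenKernel V ζ χ j j y x * greenKernel 0 ζ χ₀ j j y x) := fun y hy => by
      simp only [greenKernel, starKernel, if_pos, if_pos (le_of_lt hy : x ≤ y), Pi.zero_apply]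
      ring
    have i1' : IntegrableOn (fun y => (V j y : ℂ) *
        (greenKernel V ζ χ j j y x * greenKernel 0 ζ χ₀ j j y x)) (Ioc 0 x) := by
      rw [integrableOn_Ioc_iff_integrableOn_Ioo]
      exact IntegrableOn.congr_fun ((i1.mono_set Ioo_subset_Ioc_self).const_mul _ :
        IntegrableOn _ _ _) e1 measurableSet_Ioo
    have i2' : IntegrableOn (fun y => (V j y : ℂ) *
        (greenKernel V ζ χ j j y x * greenKernel 0 ζ χ₀ j j y x)) (Ioi x) :=
      IntegrableOn.congr_fun (i2.const_mul _ : IntegrableOn _ _ _) e2 measurableSet_Ioi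
    rw [← Ioc_union_Ioi_eq_Ioi hx.le, setIntegral_union Ioc_disjoint_Ioi_same measurableSet_Ioi
      i1' i2', integral_Ioc_eq_integral_Ioo, ← setIntegral_congr_fun measurableSet_Ioo e1,
      ← setIntegral_congr_fun measurableSet_Ioi e2, integral_const_mul, integral_const_mul,
      hIoi j x hx.le, ← integral_Ioc_eq_integral_Ioo, ← intervalIntegral.integral_of_le hx.le,
      hχW.integral_eq_sub le_rfl hx.le]
    ring
  -- the other terms
  have hoff : ∀ k ∈ Finset.univ.erase j, ∫ y in Ioi (0 : ℝ), (V k y : ℂ) *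
      (greenKernel V ζ χ k j y x * greenKernel 0 ζ χ₀ k j y x) = 1 / G * (1 / G₀) *
      (jostTheta (V j) ζ x * jostTheta 0 ζ x) * -(cofactor w j * (cofactor₂ w₀ j k *
        -jostTheta' 0 ζ 0) + cofactor₂ w j k * jostTheta' (V k) ζ 0 * cofactor w₀ j) := by
    intro k hk
    have hkj := Finset.ne_of_mem_erase hk
    have e : ∀ y, (V k y : ℂ) * (greenKernel V ζ χ k j y x * greenKernel 0 ζ χ₀ k j y x) =
        1 / G * (1 / G₀) * (cofactor₂ w j k * cofactor₂ w₀ j k) *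
          (jostTheta (V j) ζ x * jostTheta 0 ζ x) *
        ((V k y : ℂ) * (jostTheta (V k) ζ y * jostTheta 0 ζ y)) := fun y => by
      simp only [greenKernel, starKernel, if_neg hkj.symm, Pi.zero_apply, cofactor₂_comm k j, hw,
        hw₀]
      ring
    simp only [e]
    rw [integral_const_mul, hIoi k 0 le_rfl, ← cofactor₂_mul hkj, ← cofactor₂_mul hkj]
    simp only [hw, hw₀, Pi.zero_apply]
    ring
  have hv := h.wronskian_eq hV hζ j hx.le
  have hv₀ := h₀.wronskian_eq hV₀ hζ j hx.le
  have hc : χ' j 0 = -cofactorSum w (fun k => jostTheta' (V k) ζ 0) j := h.zero' j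
  have hc₀ : χ₀' j 0 = -cofactorSum w₀ (fun k => jostTheta' ((0 : Fin n → ℝ → ℝ) k) ζ 0) j :=
    h₀.zero' j
  -- the other edges contribute what the diagonal term lacks at the vertex
  have hs : ∑ k ∈ Finset.univ.erase j, -(cofactor w j * (cofactor₂ w₀ j k *
        -jostTheta' 0 ζ 0) + cofactor₂ w j k * jostTheta' (V k) ζ 0 * cofactor w₀ j) =
      χ' j 0 * χ₀ j 0 - χ j 0 * χ₀' j 0 := by
    rw [hc, hc₀, h.zero, h₀.zero, cofactorSum, cofactorSum, neg_mul, mul_neg, sub_neg_eq_add,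
      Finset.sum_mul, Finset.mul_sum, ← Finset.sum_neg_distrib, ← Finset.sum_add_distrib]
    refine Finset.sum_congr rfl fun k _ => ?_
    simp only [hw, hw₀, Pi.zero_apply]
    ring
  rw [← Finset.add_sum_erase _ _ (Finset.mem_univ j), hdiag, Finset.sum_congr rfl hoff,
    ← Finset.mul_sum, hs]
  simp only [Pi.zero_apply] at hv₀
  have hne : G ≠ 0 := hG
  have hne₀ : G₀ ≠ 0 := hG₀
  field_simp
  linear_combination χ j x * jostTheta (V j) ζ x * hv₀ - χ₀ j x * jostTheta 0 ζ x * hv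

/-- The double integral that is the trace, evaluated by integrating over the variable of `V`
first. -/
lemma trace_integral_eq (h : IsVertexFamily V ζ χ χ' C)
    (h₀ : IsVertexFamily 0 ζ χ₀ χ₀' C₀) (hn : 0 < n) (hζ : 0 < ζ.im)
    (hV : ∀ j, IntegrableOn (V j) (Ioi 0)) (hG : starChar V ζ ≠ 0) :
    ∑ k, ∫ y in Ioi (0 : ℝ), (V k y : ℂ) *
        ∑ j, ∫ x in Ioi (0 : ℝ), greenKernel V ζ χ k j y x * greenKernel 0 ζ χ₀ k j y x =
      1 / (2 * ζ) * (deriv (starChar V) ζ / starChar V ζ - 1 / ζ) := by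
  set Φ : Fin n → Fin n → ℝ → ℝ → ℂ := fun k j y x => (V k y : ℂ) *
      (greenKernel V ζ χ k j y x * greenKernel 0 ζ χ₀ k j y x) with hΦ
  have hi : ∀ k j, Integrable (Function.uncurry (Φ k j)) (Measure.prod μ₀ μ₀) :=
    integrable_potential_mul_greenKernel h h₀ hζ hV
  set d : Fin n → ℝ → ℂ := fun j x => χ j x * jostTheta (V j) ζ x / starChar V ζ -
      χ₀ j x * jostTheta 0 ζ x / starChar (0 : Fin n → ℝ → ℝ) ζ with hd
  have e1 : ∑ k, ∫ y in Ioi (0 : ℝ), (V k y : ℂ) *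
        ∑ j, ∫ x in Ioi (0 : ℝ), greenKernel V ζ χ k j y x * greenKernel 0 ζ χ₀ k j y x =
      ∑ j, ∑ k, ∫ x in Ioi (0 : ℝ), ∫ y in Ioi (0 : ℝ), Φ k j y x := by
    rw [Finset.sum_comm]
    refine Finset.sum_congr rfl fun k _ => ?_
    simp only [Finset.mul_sum, ← integral_const_mul]
    refine (integral_finsetSum (μ := μ₀) Finset.univ (f := fun j y => ∫ x in Ioi (0 : ℝ), Φ k j y x)
      fun j _ => (hi k j).integral_prod_left).trans ?_
    refine Finset.sum_congr rfl fun j _ => ?_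
    exact integral_integral_swap (hi k j)
  have hid : ∀ j, IntegrableOn (fun x => ∑ k, ∫ y in Ioi (0 : ℝ), Φ k j y x) (Ioi 0) := fun j =>
    integrable_finsetSum _ fun k _ => (hi k j).integral_prod_right
  have hde : ∀ j, ∀ x ∈ Ioi (0 : ℝ), ∑ k, ∫ y in Ioi (0 : ℝ), Φ k j y x = d j x := fun j x hx =>
    sum_integral_potential_mul_greenKernel h h₀ hn hζ hV hG j hx
  have e2 : ∑ j, ∑ k, ∫ x in Ioi (0 : ℝ), ∫ y in Ioi (0 : ℝ), Φ k j y x =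
      ∑ j, ∫ x in Ioi (0 : ℝ), d j x := by
    refine Finset.sum_congr rfl fun j _ => ?_
    refine (integral_finsetSum (μ := μ₀) Finset.univ (f := fun k x => ∫ y in Ioi (0 : ℝ), Φ k j y x)
      fun k _ => (hi k j).integral_prod_right).symm.trans ?_
    exact setIntegral_congr_fun measurableSet_Ioi (hde j)
  have hdi : ∀ j, IntegrableOn (d j) (Ioi 0) := fun j =>
    (hid j).congr_fun (hde j) measurableSet_Ioi
  rw [e1, e2]
  exact tendsto_nhds_unique (tendsto_finsetSum _ fun j _ =>
    intervalIntegral_tendsto_integral_Ioi 0 (hdi j) tendsto_id)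
    (tendsto_sum_integral_diagonal h h₀ hn hζ hV hG)

end TraceEvaluation

/-! ### The trace formula -/

section TraceFormula

variable {n : ℕ} {V : Fin n → ℝ → ℝ} {ζ : ℂ}

lemma upperHalf_mem_nhds (hζ : 0 < ζ.im) : {η : ℂ | 0 < η.im} ∈ 𝓝 ζ :=
  (isOpen_lt continuous_const Complex.continuous_im).mem_nhds hζ

lemma starJost_eq (hV : ∀ j, IntegrableOn (V j) (Ioi 0)) (hζ : 0 < ζ.im)
    (hw : ∀ j, jostTheta (V j) ζ 0 ≠ 0) : starJost V ζ = starChar V ζ / ζ := by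
  have h1 : starK V ζ * ∏ j, jostTheta (V j) ζ 0 = starChar V ζ := by
    rw [starK, starChar, starDet, Finset.sum_mul]
    refine Finset.sum_congr rfl fun j _ => ?_
    have h2 : jostSolution (V j) ζ 0 = jostTheta (V j) ζ 0 := jostFunction_eq (hV j) hζ
    rw [derivWithin_jostSolution_eq (hV j) hζ, h2,
      ← cofactor_mul (w := fun j => jostTheta (V j) ζ 0) j]
    field_simp [hw j]
  rw [starJost, Finset.prod_congr rfl fun j _ => jostFunction_eq (hV j) hζ, ← h1]
  ring

lemma eventuallyEq_starJost (hV : ∀ j, IntegrableOn (V j) (Ioi 0)) (hζ : 0 < ζ.im)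
    (hw : ∀ j, jostTheta (V j) ζ 0 ≠ 0) :
    starJost V =ᶠ[𝓝 ζ] fun η => starChar V η / η := by
  have h1 : ∀ᶠ η in 𝓝 ζ, ∀ j, jostTheta (V j) η 0 ≠ 0 := eventually_all.2 fun j =>
    (hasDerivAt_jostTheta (hV j) hζ le_rfl).continuousAt.eventually_ne (hw j)
  filter_upwards [h1, upperHalf_mem_nhds hζ] with η h2 h3 using starJost_eq hV h3 h2

/-- The zeros of the Jost function are isolated. -/
lemma eventually_jostTheta_ne_zero {v : ℝ → ℝ} (hv : IntegrableOn v (Ioi 0)) (hζ : 0 < ζ.im) :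
    ∀ᶠ η in 𝓝[≠] ζ, jostTheta v η 0 ≠ 0 := by
  have hd : DifferentiableOn ℂ (fun η => jostTheta v η 0) {η | 0 < η.im} := fun η hη =>
    (hasDerivAt_jostTheta hv hη le_rfl).differentiableAt.differentiableWithinAt
  refine (hd.analyticAt (upperHalf_mem_nhds hζ)).eventually_eq_zero_or_eventually_ne_zero.resolve_left
    fun h0 => ?_
  -- every neighbourhood of `ζ` contains points with nonreal square
  obtain ⟨r, hr, hr0⟩ := Metric.eventually_nhds_iff.1 h0
  obtain ⟨t, ht, htr⟩ : ∃ t : ℝ, |t| < r ∧ ζ.re + t ≠ 0 := by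
    by_cases h : ζ.re = 0
    · exact ⟨r / 2, by rw [abs_of_pos (by linarith)]; linarith, by rw [h]; linarith⟩
    · exact ⟨0, by simpa using hr, by simpa using h⟩
  have him : (ζ + t).im = ζ.im := by simp
  refine jostTheta_zero_ne_zero hv (ζ := ζ + t) (by rwa [him]) ?_ (hr0 ?_)
  · rw [sq, Complex.mul_im, him, Complex.add_re, Complex.ofReal_re]
    have := mul_ne_zero htr hζ.ne'
    intro h
    apply this
    linarith
  · rw [dist_eq_norm, add_sub_cancel_left, Complex.norm_real]
    exact ht

lemma differentiableOn_starChar (hV : ∀ j, IntegrableOn (V j) (Ioi 0)) :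
    DifferentiableOn ℂ (starChar V) {η | 0 < η.im} := fun η hη => by
  obtain ⟨χ, χ', C, h⟩ := exists_vertexFamily hV hη
  exact (h.hasDerivAt_starChar hη hV).differentiableAt.differentiableWithinAt

lemma logDeriv_starJost (hV : ∀ j, IntegrableOn (V j) (Ioi 0)) (hζ : 0 < ζ.im)
    (hw : ∀ j, jostTheta (V j) ζ 0 ≠ 0) (hG : starChar V ζ ≠ 0) :
    logDeriv (starJost V) ζ = deriv (starChar V) ζ / starChar V ζ - 1 / ζ := by
  have hd := (differentiableOn_starChar hV).differentiableAt (upperHalf_mem_nhds hζ)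
  rw [logDeriv_apply, (eventuallyEq_starJost hV hζ hw).deriv_eq,
    (eventuallyEq_starJost hV hζ hw).eq_of_nhds, ← logDeriv_apply,
    logDeriv_div ζ hG (ne_zero_of_im_pos hζ) hd differentiableAt_fun_id, logDeriv_apply,
    logDeriv_id']

lemma tendsto_logDeriv_starJost (hV : ∀ j, IntegrableOn (V j) (Ioi 0)) (hζ : 0 < ζ.im)
    (hG : starChar V ζ ≠ 0) :
    Tendsto (fun η : ℂ => 1 / (2 * η) * logDeriv (starJost V) η) (𝓝[≠] ζ)
      (𝓝 (1 / (2 * ζ) * (deriv (starChar V) ζ / starChar V ζ - 1 / ζ))) := by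
  have hζ0 := ne_zero_of_im_pos hζ
  have hd := differentiableOn_starChar hV
  have hU : IsOpen {η : ℂ | 0 < η.im} := isOpen_lt continuous_const Complex.continuous_im
  have c1 := (hd.differentiableAt (upperHalf_mem_nhds hζ)).continuousAt
  have c2 := ((hd.deriv hU).differentiableAt (upperHalf_mem_nhds hζ)).continuousAt
  have h1 : ContinuousAt (fun η : ℂ => 1 / (2 * η) *
      (deriv (starChar V) η / starChar V η - 1 / η)) ζ :=
    (continuousAt_const.div (continuousAt_const.mul continuousAt_id) (by simp [hζ0])).mul
      ((c2.div c1 hG).sub (continuousAt_const.div continuousAt_id hζ0))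
  refine (h1.tendsto.mono_left nhdsWithin_le_nhds).congr' ?_
  filter_upwards [eventually_all.2 fun j => eventually_jostTheta_ne_zero (hV j) hζ,
    mem_nhdsWithin_of_mem_nhds (upperHalf_mem_nhds hζ),
    mem_nhdsWithin_of_mem_nhds (c1.eventually_ne hG)] with η h2 h3 h4
  rw [logDeriv_starJost hV h3 h2 h4]

end TraceFormula

end

theorem theorem1p1 (n : ℕ) (hn : 2 ≤ n) (V : Fin n → ℝ → ℝ)
    (hV : ∀ j, IntegrableOn (V j) (Ioi (0 : ℝ)) volume) :
    -- the Jost solutions exist, and every nonreal number is in the resolvent set of `H`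
    (∀ (j : Fin n) (ζ : ℂ), 0 < ζ.im → IsJostSolution (V j) ζ (jostSolution (V j) ζ)) ∧
    (∀ z : ℂ, z.im ≠ 0 → z ∈ opResolventSet (starSchrodinger V)) ∧
    ∀ ζ : ℂ, 0 < ζ.im → ζ ^ 2 ∈ opResolventSet (starSchrodinger V) →
      ζ ^ 2 ∈ opResolventSet (starSchrodinger (0 : Fin n → ℝ → ℝ)) ∧
      IsTraceClass (opResolvent (starSchrodinger V) (ζ ^ 2) -
        opResolvent (starSchrodinger (0 : Fin n → ℝ → ℝ)) (ζ ^ 2)) ∧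
      ∃ τ : ℂ,
        HasTrace (opResolvent (starSchrodinger (0 : Fin n → ℝ → ℝ)) (ζ ^ 2) -
          opResolvent (starSchrodinger V) (ζ ^ 2)) τ ∧
        -- the trace formula, `d/dζ ln F` being the logarithmic derivative `F' / F`
        ((∀ j, jostFunction (V j) ζ ≠ 0) →
          DifferentiableAt ℂ (starJost V) ζ ∧ starJost V ζ ≠ 0 ∧
          τ = 1 / (2 * ζ) * logDeriv (starJost V) ζ) ∧
        -- in the limit sense also where some `wⱼ(ζ) = 0`, so that `K(ζ)` is undefined
        Tendsto (fun η : ℂ => 1 / (2 * η) * logDeriv (starJost V) η) (𝓝[≠] ζ) (𝓝 τ) := by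
  have hn0 : 0 < n := by omega
  refine ⟨fun j ζ hζ => isJostSolution_jostSolution (hV j) hζ,
    fun z hz => mem_opResolventSet_of_im_ne_zero hn0 hV hz, fun ζ hζ hres => ?_⟩
  have hG := starChar_ne_zero hn0 hV hζ hres
  obtain ⟨χ, χ', C, h⟩ := exists_vertexFamily hV hζ
  obtain ⟨χ₀, χ₀', C₀, h₀⟩ := exists_vertexFamily (integrableOn_zero_potential (n := n)) hζ
  obtain ⟨htc, htr⟩ := isTraceClass_and_hasTrace hV hn0 hζ h h₀ hG
  rw [trace_integral_eq h h₀ hn0 hζ hV hG] at htr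
  refine ⟨sq_mem_opResolventSet integrableOn_zero_potential hζ (starChar_zero_ne_zero hn0 hζ), htc,
    _, htr, fun hw => ?_, tendsto_logDeriv_starJost hV hζ hG⟩
  have hw' : ∀ j, jostTheta (V j) ζ 0 ≠ 0 := fun j => jostFunction_eq (hV j) hζ ▸ hw j
  have hζ0 := ne_zero_of_im_pos hζ
  refine ⟨?_, ?_, by rw [logDeriv_starJost hV hζ hw' hG]⟩
  · exact (((differentiableOn_starChar hV).differentiableAt (upperHalf_mem_nhds hζ)).div
      differentiableAt_fun_id hζ0).congr_of_eventuallyEq (eventuallyEq_starJost hV hζ hw')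
  · rw [starJost_eq hV hζ hw']
    exact div_ne_zero hG hζ0
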